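/- Let $\mathbb T^2=(\mathbb R/2\pi\mathbb Z)^2$ with the measure $dp$ of total mass $(2\pi)^2$, and let $L^{2,o}(\mathbb T^2)$ be the complex Hilbert space of square-integrable odd functions on $\mathbb T^2$. For $\lambda,\mu\in\mathbb R$ let $H_{\lambda\mu}(0)$ be the operator on $L^{2,o}(\mathbb T^2)$ $$[H_{\lambda\mu}(0)f](p)=2\sum_{i=1}^2(1-\cos p_i)\,f(p)+\frac1{(2\pi)^2}\int_{\mathbb T^2}v_{\lambda\mu}(p-u)f(u)\,du,$$ $$v_{\lambda\mu}(p)=\lambda\sum_{i=1}^2\cos p_i+\mu\sum_{i=1}^2\cos 2p_i+2\mu\sum_{i=1}^2\sum_{j\ne i}\cos p_i\cos p_j .$$ Put $$\mu_0^\pm=\frac{88-30\pi\pm\sqrt{1044\pi^2-6720\pi+10816}}{240\pi-24\pi^2-512}\,\pi,$$ $$\mu_1^\pm=\frac{128-16\pi-9\pi^2\pm\sqrt{225\pi^4-1440\pi^3+3904\pi^2-10240\pi+16384}}{120\pi-12\pi^2-256},$$ $$\Lambda^-(\mu)=-\frac{8(\mu-\mu_0^+)(\mu-\mu_0^-)}{(\mu-\mu_1^+)(\mu-\mu_1^-)},\qquad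 \Lambda^+(\mu)=\frac{8(\mu+\mu_0^+)(\mu+\mu_0^-)}{(\mu+\mu_1^+)(\mu+\mu_1^-)},$$ and define the following subsets of the $(\lambda,\mu)$-plane: - $\mathcal C_0^-=\{\lambda>\Lambda^-(\mu),\ \mu>\mu_1^+\}$; - $\mathcal C_1^-=\{\lambda<\Lambda^-(\mu),\ \mu>\mu_1^+\}\cup\{\mu=\mu_1^+\}\cup\{\lambda>\Lambda^-(\mu),\ \mu_1^-<\mu<\mu_1^+\}$; - $\mathcal C_2^-=\{\lambda<\Lambda^-(\mu),\ \mu_1^-<\mu<\mu_1^+\}\cup\{\mu=\mu_1^-\}\cup\{\lambda>\Lambda^-(\mu),\ \mu<\mu_1^-\}$; - $\mathcal C_3^-=\{\lambda<\Lambda^-(\mu),\ \mu<\mu_1^-\}$; - $\mathcal C_0^+=\{\lambda<\Lambda^+(\mu),\ \mu<-\mu_1^+\}$; - $\mathcal C_1^+=\{\lambda>\Lambda^+(\mu),\ \mu<-\mu_1^+\}\cup\{\mu=-\mu_1^+\}\cup\{\lambda<\Lambda^+(\mu),\ -\mu_1^+<\mu<-\mu_1^-\}$; - $\mathcal C_2^+=\{\lambda>\Lambda^+(\mu),\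 -\mu_1^+<\mu<-\mu_1^-\}\cup\{\mu=-\mu_1^-\}\cup\{\lambda<\Lambda^+(\mu),\ \mu>-\mu_1^-\}$; - $\mathcal C_3^+=\{\lambda>\Lambda^+(\mu),\ \mu>-\mu_1^-\}$. Theorem. For all $\lambda,\mu\in\mathbb R$ the essential spectrum of $H_{\lambda\mu}(0)$ is $[0,8]$. The eigenvalues of $H_{\lambda\mu}(0)$ outside the essential spectrum are described as follows; the eigenvalues named in each item are all the eigenvalues outside $[0,8]$, they are pairwise distinct, and each has multiplicity exactly two. - (i) If $(\lambda,\mu)\in\mathcal C_3^-$: exactly three, $z_1<z_2<z_3<0$. - (ii) If $(\lambda,\mu)\in\mathcal C_2^-\cap\mathcal C_0^+$: exactly two, $z_1<z_2<0$. - (iii) If $(\lambda,\mu)\in\mathcal C_2^-\cap\mathcal C_1^+$: exactly two in $(-\infty,0)$ and exactly one in $(8,\infty)$. - (iv) If $(\lambda,\mu)\in\mathcal C_1^-\cap\mathcal C_1^+$: exactly two, $z_1<0$ and $z_2>8$. - (v) If $(\lambda,\mu)\in\mathcal C_1^-\cap\mathcal C_0^+$: exactly one, $z<0$. - (vi) If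 $(\lambda,\mu)\in\mathcal C_0^-\cap\mathcal C_0^+$: none. - (vii) If $(\lambda,\mu)\in\mathcal C_0^-\cap\mathcal C_1^+$: exactly one, $z>8$. - (viii) If $(\lambda,\mu)\in\mathcal C_1^-\cap\mathcal C_2^+$: exactly one in $(-\infty,0)$ and exactly two in $(8,\infty)$. - (ix) If $(\lambda,\mu)\in\mathcal C_0^-\cap\mathcal C_2^+$: exactly two, $8<z_2<z_1$. - (x) If $(\lambda,\mu)\in\mathcal C_3^+$: exactly three, $8<z_3<z_2<z_1$. -/

import Mathlib

open scoped Real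
open MeasureTheory Filter Topology

namespace LatticeFermion

noncomputable section

/-! ### The torus `𝕋² = (ℝ/2πℤ)²` with Lebesgue (Haar) measure of total mass `(2π)²` -/

instance factTwoPiPos : Fact (0 < 2 * π) := ⟨Real.two_pi_pos⟩

/-- The two-dimensional torus `(ℝ/2πℤ)²`; its `volume` is the product of the measures `dt` on
`ℝ/2πℤ`, of total mass `(2π)²`. -/
abbrev Torus : Type := AddCircle (2 * π) × AddCircle (2 * π)

/-- The cosine as a function on `ℝ/2πℤ`. -/
def cosT : AddCircle (2 * π) → ℝ := Real.cos_periodic.lift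

/-- The two-particle dispersion relation at zero quasimomentum,
`𝓔₀(p) = 2 ∑ᵢ (1 - cos pᵢ)`. -/
def dispersion (p : Torus) : ℝ := 2 * ((1 - cosT p.1) + (1 - cosT p.2))

/-- The momentum-space interaction function
`v(p) = λ ∑ᵢ cos pᵢ + μ ∑ᵢ cos 2pᵢ + 2μ ∑ᵢ ∑_{j ≠ i} cos pᵢ cos pⱼ`. -/
def potential (l m : ℝ) (p : Torus) : ℝ :=
  l * (cosT p.1 + cosT p.2) + m * (cosT ((2 : ℕ) • p.1) + cosT ((2 : ℕ) • p.2))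
    + 2 * m * (cosT p.1 * cosT p.2 + cosT p.2 * cosT p.1)

theorem cosT_coe (x : ℝ) : cosT (x : AddCircle (2 * π)) = Real.cos x := rfl

theorem continuous_cosT : Continuous cosT :=
  Real.continuous_cos.quotient_liftOn' _

theorem cosT_neg (x : AddCircle (2 * π)) : cosT (-x) = cosT x := by
  induction x using QuotientAddGroup.induction_on with
  | H x => exact Real.cos_neg x

theorem continuous_dispersion : Continuous dispersion := by
  have h := continuous_cosT
  unfold dispersion
  fun_prop

theorem continuous_potential (l m : ℝ) : Continuous (potential l m) := by
  have h := continuous_cosT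
  unfold potential
  fun_prop

theorem dispersion_neg (p : Torus) : dispersion (-p) = dispersion p := by
  simp [dispersion, cosT_neg]

theorem potential_neg (l m : ℝ) (p : Torus) : potential l m (-p) = potential l m p := by
  simp [potential, cosT_neg, smul_neg]

/-! ### The Hilbert space of odd functions and the Hamiltonian -/

/-- The complex Hilbert space `L²(𝕋²)`. -/
abbrev L2 : Type := Lp ℂ 2 (volume : Measure Torus)

instance isNegInvariantTorus : (volume : Measure Torus).IsNegInvariant := by
  have h := Measure.measurePreserving_neg (volume : Measure (AddCircle (2 * π)))
  exact ⟨(h.prod h).map_eq⟩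

/-- The closed subspace `L^{2,o}(𝕋²)` of odd functions. -/
def oddL2 : Submodule ℂ L2 where
  carrier := {f | ∀ᵐ p : Torus, f (-p) = -f p}
  zero_mem' := by
    have h := Lp.coeFn_zero ℂ 2 (volume : Measure Torus)
    filter_upwards [h, (Measure.measurePreserving_neg
      (volume : Measure Torus)).quasiMeasurePreserving.ae h] with p h1 h2
    simp_all
  add_mem' := by
    intro f g hf hg
    change ∀ᵐ p : Torus, (f + g : L2) (-p) = -(f + g : L2) p
    have h := Lp.coeFn_add f g
    filter_upwards [h, (Measure.measurePreserving_neg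
      (volume : Measure Torus)).quasiMeasurePreserving.ae h, hf, hg] with p h1 h2 h3 h4
    rw [h1, h2, Pi.add_apply, Pi.add_apply, h3, h4]
    ring
  smul_mem' := by
    intro c f hf
    change ∀ᵐ p : Torus, (c • f : L2) (-p) = -(c • f : L2) p
    have h := Lp.coeFn_smul c f
    filter_upwards [h, (Measure.measurePreserving_neg
      (volume : Measure Torus)).quasiMeasurePreserving.ae h, hf] with p h1 h2 h3
    rw [h1, h2, Pi.smul_apply, Pi.smul_apply, h3, smul_neg]

/-- `p ↦ 𝓔₀(p) f(p)`. -/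
def freeFun (f : Torus → ℂ) (p : Torus) : ℂ := (dispersion p : ℂ) * f p

/-- `p ↦ (2π)⁻² ∫_{𝕋²} v(p - u) f(u) du`. -/
def interactionFun (l m : ℝ) (f : Torus → ℂ) (p : Torus) : ℂ :=
  (1 / (2 * π) ^ 2 : ℝ) * ∫ u : Torus, (potential l m (p - u) : ℂ) * f u

theorem memLp_freeFun (f : L2) : MemLp (freeFun f) 2 (volume : Measure Torus) := by
  obtain ⟨C, hC⟩ := (isCompact_univ (X := Torus)).exists_bound_of_continuousOn
    (f := fun p : Torus => (dispersion p : ℂ))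
    (Complex.continuous_ofReal.comp continuous_dispersion).continuousOn
  have hm : MemLp (fun p : Torus => (dispersion p : ℂ)) ⊤ (volume : Measure Torus) :=
    memLp_top_of_bound
      (Complex.continuous_ofReal.comp continuous_dispersion).aestronglyMeasurable C
      (Eventually.of_forall fun p => hC p (Set.mem_univ p))
  exact (Lp.memLp f).mul hm

theorem exists_potential_bound (l m : ℝ) :
    ∃ C, ∀ p : Torus, ‖(potential l m p : ℂ)‖ ≤ C := by
  obtain ⟨C, hC⟩ := (isCompact_univ (X := Torus)).exists_bound_of_continuousOn
    (f := fun p : Torus => (potential l m p : ℂ))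
    (Complex.continuous_ofReal.comp (continuous_potential l m)).continuousOn
  exact ⟨C, fun p => hC p (Set.mem_univ p)⟩

theorem integrable_L2 (f : L2) : Integrable f (volume : Measure Torus) :=
  (Lp.memLp f).integrable (by norm_num)

theorem integrable_interaction (l m : ℝ) (f : L2) (p : Torus) :
    Integrable (fun u : Torus => (potential l m (p - u) : ℂ) * f u) volume := by
  obtain ⟨C, hC⟩ := exists_potential_bound l m
  refine (integrable_L2 f).bdd_mul (c := C) ?_ (Eventually.of_forall fun u => hC _)
  have h := continuous_potential l m
  exact Continuous.aestronglyMeasurable (by fun_prop)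

theorem memLp_interactionFun (l m : ℝ) (f : L2) :
    MemLp (interactionFun l m f) 2 (volume : Measure Torus) := by
  obtain ⟨C, hC⟩ := exists_potential_bound l m
  have hm : AEStronglyMeasurable
      (fun p : Torus => ∫ u : Torus, (potential l m (p - u) : ℂ) * f u) volume := by
    refine AEStronglyMeasurable.integral_prod_right'
      (f := fun q : Torus × Torus => (potential l m (q.1 - q.2) : ℂ) * f q.2) ?_
    have h := continuous_potential l m
    exact (Continuous.aestronglyMeasurable (by fun_prop)).mul
      ((Lp.aestronglyMeasurable f).comp_snd)
  refine MemLp.const_mul (MemLp.of_bound hm (∫ u : Torus, C * ‖f u‖)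
    (Eventually.of_forall fun p => ?_)) _
  refine (norm_integral_le_integral_norm _).trans ?_
  refine integral_mono (integrable_interaction l m f p).norm
    ((integrable_L2 f).norm.const_mul C) fun u => ?_
  simp only [norm_mul]
  exact mul_le_mul_of_nonneg_right (hC _) (norm_nonneg _)

/-- The free operator `H₀(0)` on `L²(𝕋²)`: multiplication by `𝓔₀`. -/
def freeL2 : L2 →ₗ[ℂ] L2 where
  toFun f := (memLp_freeFun f).toLp (freeFun f)
  map_add' f g := by
    refine Lp.ext ?_
    filter_upwards [(memLp_freeFun (f + g)).coeFn_toLp, (memLp_freeFun f).coeFn_toLp,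
      (memLp_freeFun g).coeFn_toLp, Lp.coeFn_add f g,
      Lp.coeFn_add ((memLp_freeFun f).toLp _) ((memLp_freeFun g).toLp _)] with p h1 h2 h3 h4 h5
    rw [h1, h5, Pi.add_apply, h2, h3, freeFun, freeFun, freeFun, h4, Pi.add_apply, mul_add]
  map_smul' c f := by
    refine Lp.ext ?_
    filter_upwards [(memLp_freeFun (c • f)).coeFn_toLp, (memLp_freeFun f).coeFn_toLp,
      Lp.coeFn_smul c f, Lp.coeFn_smul c ((memLp_freeFun f).toLp _)] with p h1 h2 h3 h4
    rw [RingHom.id_apply, h1, h4, Pi.smul_apply, h2, freeFun, freeFun, h3, Pi.smul_apply,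
      smul_eq_mul, smul_eq_mul]
    ring

/-- The interaction operator on `L²(𝕋²)`: convolution with `(2π)⁻² v`. -/
def interactionL2 (l m : ℝ) : L2 →ₗ[ℂ] L2 where
  toFun f := (memLp_interactionFun l m f).toLp (interactionFun l m f)
  map_add' f g := by
    refine Lp.ext ?_
    filter_upwards [(memLp_interactionFun l m (f + g)).coeFn_toLp,
      (memLp_interactionFun l m f).coeFn_toLp, (memLp_interactionFun l m g).coeFn_toLp,
      Lp.coeFn_add ((memLp_interactionFun l m f).toLp _) ((memLp_interactionFun l m g).toLp _)]
      with p h1 h2 h3 h4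
    rw [h1, h4, Pi.add_apply, h2, h3, interactionFun, interactionFun, interactionFun, ← mul_add,
      ← integral_add (integrable_interaction l m f p) (integrable_interaction l m g p)]
    congr 1
    refine integral_congr_ae ?_
    filter_upwards [Lp.coeFn_add f g] with u hu
    rw [hu, Pi.add_apply, mul_add]
  map_smul' c f := by
    refine Lp.ext ?_
    filter_upwards [(memLp_interactionFun l m (c • f)).coeFn_toLp,
      (memLp_interactionFun l m f).coeFn_toLp,
      Lp.coeFn_smul c ((memLp_interactionFun l m f).toLp _)] with p h1 h2 h3
    rw [RingHom.id_apply, h1, h3, Pi.smul_apply, h2, interactionFun, interactionFun, smul_eq_mul,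
      mul_left_comm, ← integral_const_mul c]
    congr 1
    refine integral_congr_ae ?_
    filter_upwards [Lp.coeFn_smul c f] with u hu
    rw [hu, Pi.smul_apply, smul_eq_mul]
    ring

theorem freeL2_mem_odd (f : L2) (hf : f ∈ oddL2) : freeL2 f ∈ oddL2 := by
  have h := (memLp_freeFun f).coeFn_toLp
  have hf' : ∀ᵐ p : Torus, f (-p) = -f p := hf
  change ∀ᵐ p : Torus, ((memLp_freeFun f).toLp _ : L2) (-p) = -((memLp_freeFun f).toLp _ : L2) p
  filter_upwards [h, (Measure.measurePreserving_neg
    (volume : Measure Torus)).quasiMeasurePreserving.ae h, hf'] with p h1 h2 h3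
  rw [h1, h2, freeFun, freeFun, dispersion_neg, h3, mul_neg]

theorem interactionL2_mem_odd (l m : ℝ) (f : L2) (hf : f ∈ oddL2) :
    interactionL2 l m f ∈ oddL2 := by
  have h := (memLp_interactionFun l m f).coeFn_toLp
  have hf' : ∀ᵐ p : Torus, f (-p) = -f p := hf
  change ∀ᵐ p : Torus, ((memLp_interactionFun l m f).toLp _ : L2) (-p)
    = -((memLp_interactionFun l m f).toLp _ : L2) p
  filter_upwards [h, (Measure.measurePreserving_neg
    (volume : Measure Torus)).quasiMeasurePreserving.ae h] with p h1 h2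
  rw [h1, h2, interactionFun, interactionFun, ← mul_neg, ← integral_neg,
    ← integral_neg_eq_self]
  congr 1
  refine integral_congr_ae ?_
  filter_upwards [hf'] with u hu
  rw [hu, show -p - -u = -(p - u) by abel, potential_neg, mul_neg]

/-- The discrete Schrödinger operator `H_{λμ}(0) = H₀(0) + V_{λμ}` on `L^{2,o}(𝕋²)`:
`(H f)(p) = 𝓔₀(p) f(p) + (2π)⁻² ∫_{𝕋²} v(p - u) f(u) du`. -/
def hamiltonian (l m : ℝ) : oddL2 →ₗ[ℂ] oddL2 :=
  freeL2.restrict freeL2_mem_odd + (interactionL2 l m).restrict (interactionL2_mem_odd l m)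

/-! ### Spectral notions -/

/-- The essential spectrum of an everywhere defined self-adjoint operator, by Weyl's criterion:
`z` belongs to it iff there are unit vectors `fₙ` converging weakly to `0` with
`(T - z) fₙ → 0` in norm. -/
def essentialSpectrum {E : Type*} [NormedAddCommGroup E] [InnerProductSpace ℂ E]
    (T : E →ₗ[ℂ] E) : Set ℂ :=
  {z | ∃ f : ℕ → E, (∀ n, ‖f n‖ = 1) ∧
    (∀ g : E, Tendsto (fun n => inner ℂ g (f n)) atTop (𝓝 0)) ∧
    Tendsto (fun n => T (f n) - z • f n) atTop (𝓝 0)}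

/-- The eigenvalues of `T` outside the essential spectrum are exactly the elements of `S`, and
each of them has multiplicity two. -/
def OuterEigenvaluesAreDouble {E : Type*} [NormedAddCommGroup E] [InnerProductSpace ℂ E]
    (T : E →ₗ[ℂ] E) (S : Set ℝ) : Prop :=
  {z : ℂ | Module.End.HasEigenvalue T z ∧ z ∉ essentialSpectrum T} = Complex.ofReal '' S ∧
    ∀ x ∈ S, Module.finrank ℂ (Module.End.eigenspace T (x : ℂ)) = 2

/-! ### The partition of the `(λ, μ)`-plane -/

/-- `μ₀⁺`. -/
def mu0p : ℝ := (88 - 30 * π + √(1044 * π ^ 2 - 6720 * π + 10816))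
  / (240 * π - 24 * π ^ 2 - 512) * π

/-- `μ₀⁻`. -/
def mu0m : ℝ := (88 - 30 * π - √(1044 * π ^ 2 - 6720 * π + 10816))
  / (240 * π - 24 * π ^ 2 - 512) * π

/-- `μ₁⁺`. -/
def mu1p : ℝ := (128 - 16 * π - 9 * π ^ 2
    + √(225 * π ^ 4 - 1440 * π ^ 3 + 3904 * π ^ 2 - 10240 * π + 16384))
  / (120 * π - 12 * π ^ 2 - 256)

/-- `μ₁⁻`. -/
def mu1m : ℝ := (128 - 16 * π - 9 * π ^ 2
    - √(225 * π ^ 4 - 1440 * π ^ 3 + 3904 * π ^ 2 - 10240 * π + 16384))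
  / (120 * π - 12 * π ^ 2 - 256)

/-- The function of `μ` whose graph is the curve `C⁻(λ, μ) = 0`. -/
def curveMinus (m : ℝ) : ℝ := -(8 * (m - mu0p) * (m - mu0m) / ((m - mu1p) * (m - mu1m)))

/-- The function of `μ` whose graph is the curve `C⁺(λ, μ) = 0`. -/
def curvePlus (m : ℝ) : ℝ := 8 * (m + mu0p) * (m + mu0m) / ((m + mu1p) * (m + mu1m))

/-- `𝒞₀⁻` -/
def regionMinus0 : Set (ℝ × ℝ) := {x | x.1 > curveMinus x.2 ∧ x.2 > mu1p}

/-- `𝒞₁⁻` -/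
def regionMinus1 : Set (ℝ × ℝ) :=
  {x | x.1 < curveMinus x.2 ∧ x.2 > mu1p} ∪ {x | x.2 = mu1p} ∪
    {x | x.1 > curveMinus x.2 ∧ mu1m < x.2 ∧ x.2 < mu1p}

/-- `𝒞₂⁻` -/
def regionMinus2 : Set (ℝ × ℝ) :=
  {x | x.1 < curveMinus x.2 ∧ mu1m < x.2 ∧ x.2 < mu1p} ∪ {x | x.2 = mu1m} ∪
    {x | x.1 > curveMinus x.2 ∧ x.2 < mu1m}

/-- `𝒞₃⁻` -/
def regionMinus3 : Set (ℝ × ℝ) := {x | x.1 < curveMinus x.2 ∧ x.2 < mu1m}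

/-- `𝒞₀⁺` -/
def regionPlus0 : Set (ℝ × ℝ) := {x | x.1 < curvePlus x.2 ∧ x.2 < -mu1p}

/-- `𝒞₁⁺` -/
def regionPlus1 : Set (ℝ × ℝ) :=
  {x | x.1 > curvePlus x.2 ∧ x.2 < -mu1p} ∪ {x | x.2 = -mu1p} ∪
    {x | x.1 < curvePlus x.2 ∧ -mu1p < x.2 ∧ x.2 < -mu1m}

/-- `𝒞₂⁺` -/
def regionPlus2 : Set (ℝ × ℝ) :=
  {x | x.1 > curvePlus x.2 ∧ -mu1p < x.2 ∧ x.2 < -mu1m} ∪ {x | x.2 = -mu1m} ∪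
    {x | x.1 < curvePlus x.2 ∧ x.2 > -mu1m}

/-- `𝒞₃⁺` -/
def regionPlus3 : Set (ℝ × ℝ) := {x | x.1 > curvePlus x.2 ∧ x.2 > -mu1m}

end

end LatticeFermion

/-! On odd functions only the part of v(p - u) that is odd in u acts. It is a sum of six rank-one
kernels: the functions φ = (sin p₁, sin 2p₁, 2 sin p₁ cos p₂) with couplings (λ, μ, μ), and their
images under p₁ ↔ p₂ (`potential_sub`, `interactionL2_eq`). The interaction therefore has finite
rank, and Weyl's criterion gives the range [0, 8] of the dispersion E as essential spectrum.

The two triples do not interact, by parity in p₁, and they share the Gram matrix G(z) of averages of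
φⱼφₖ/(E - z). With D = diag(λ, μ, μ), the eigenspace at z outside [0, 8] is two copies of ker(1 +
G(z)D) (`eigenspaceEquiv`). This is the source of the multiplicity two, once that kernel is known to
be at most a line.

For z < 0 write 1 + GD = G·A with A(z) = G(z)⁻¹ + D. Since G is positive definite and strictly
increasing, A strictly decreases, and it is nonnegative far to the left. Each negative eigenvalue of
A(0) thus comes from one crossing of zero. When the kernels are at most lines, the zeros of det A on
(-∞, 0) are exactly as many as the negative eigenvalues of A(0)
(`Matrix.exists_strictMono_range_det_eq_zero`). The bound on the kernels rests on the identity Eφ₀ =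
4φ₀ - φ₁ - φ₂, which determines the first row of G⁻¹, and on the strict inequality G₀₁ < G₀₂
(`gram_zero_one_lt`).

The products φⱼφₖ are O(E), so A is continuous up to z = 0, and G(0) is computed explicitly. The
numbers -μ₁± are the eigenvalues of the lower 2×2 block of G(0)⁻¹, and det A(0) = λ(μ - μ₁⁺)(μ -
μ₁⁻) + 8(μ - μ₀⁺)(μ - μ₀⁻). The index of the block, shifted by μ, confines the index of A(0) to two
neighbouring values, and the sign of the determinant decides between them; this gives index k on
𝒞ₖ⁻. The translation by (π, π) replaces E by 8 - E, hence (λ, μ, z) by (-λ, -μ, 8 - z), and the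
eigenvalues above 8 are counted in the same way by the regions 𝒞ₖ⁺. -/

namespace Matrix.IsHermitian

/-! ### Index of a real symmetric matrix and its variational characterization -/

theorem finrank_add_le_card_of_disjoint {n : Type*} [Fintype n]
    {U W : Submodule ℝ (n → ℝ)} (h : Disjoint U W) :
    Module.finrank ℝ U + Module.finrank ℝ W ≤ Fintype.card n := by
  rw [← Module.finrank_fintype_fun_eq_card ℝ]
  exact Submodule.finrank_add_finrank_le_of_disjoint h

variable {n : Type*} [Fintype n] [DecidableEq n] {A : Matrix n n ℝ}

/-- The number of negative eigenvalues of a real symmetric matrix. -/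
noncomputable def negIndex (hA : A.IsHermitian) : ℕ :=
  (Finset.univ.filter fun i => hA.eigenvalues i < 0).card

/-- The multiplicity of the eigenvalue zero of a real symmetric matrix. -/
noncomputable def zeroIndex (hA : A.IsHermitian) : ℕ :=
  (Finset.univ.filter fun i => hA.eigenvalues i = 0).card

theorem exists_diagonalization (hA : A.IsHermitian) :
    ∃ e : (n → ℝ) ≃ₗ[ℝ] (n → ℝ),
      ∀ x, x ⬝ᵥ A *ᵥ x = ∑ i, hA.eigenvalues i * (e x i) ^ 2 := by
  refine ⟨Matrix.UnitaryGroup.toLinearEquiv (star hA.eigenvectorUnitary), fun x => ?_⟩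
  have hsp := hA.spectral_theorem
  rw [Unitary.conjStarAlgAut_apply] at hsp
  have he : ∀ i, Matrix.UnitaryGroup.toLinearEquiv (star hA.eigenvectorUnitary) x i
      = ((star (hA.eigenvectorUnitary : Matrix n n ℝ)) *ᵥ x) i := fun i => rfl
  conv_lhs => rw [hsp]
  rw [← Matrix.mulVec_mulVec, ← Matrix.mulVec_mulVec, Matrix.dotProduct_mulVec,
    ← Matrix.mulVec_transpose]
  simp_rw [he]
  have hT : ((hA.eigenvectorUnitary : Matrix n n ℝ))ᵀ
      = star (hA.eigenvectorUnitary : Matrix n n ℝ) := by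
    rw [Matrix.star_eq_conjTranspose, Matrix.conjTranspose_eq_transpose_of_trivial]
  rw [hT]
  simp only [dotProduct, Matrix.mulVec_diagonal]
  refine Finset.sum_congr rfl fun i _ => ?_
  simp
  ring

theorem finrank_coordinateSubspace (s : Finset n) :
    Module.finrank ℝ (⨅ i ∈ (sᶜ : Finset n), LinearMap.ker (LinearMap.proj i : (n → ℝ) →ₗ[ℝ] ℝ)
      : Submodule ℝ (n → ℝ)) = s.card := by
  have h := LinearMap.iInfKerProjEquiv ℝ (fun _ : n => ℝ) (I := (s : Set n))
    (J := ((sᶜ : Finset n) : Set n)) (by simpa using disjoint_compl_right) (by simp)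
  refine (LinearEquiv.finrank_eq h).trans ?_
  simp

/-- `U` is the span of the eigenvectors with indices in `s`, obtained as the preimage of a
coordinate subspace under the diagonalizing map. The four sign choices that follow are instances. -/
theorem exists_subspace (hA : A.IsHermitian) (s : Finset n) :
    ∃ (U : Submodule ℝ (n → ℝ)) (e : (n → ℝ) ≃ₗ[ℝ] (n → ℝ)), Module.finrank ℝ U = s.card ∧
      ∀ x ∈ U, x ⬝ᵥ A *ᵥ x = ∑ i ∈ s, hA.eigenvalues i * (e x i) ^ 2 ∧
        (x ≠ 0 → ∃ i ∈ s, e x i ≠ 0) := by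
  obtain ⟨e, he⟩ := hA.exists_diagonalization
  refine ⟨Submodule.comap (e : (n → ℝ) →ₗ[ℝ] (n → ℝ))
    (⨅ i ∈ (sᶜ : Finset n), LinearMap.ker (LinearMap.proj i : (n → ℝ) →ₗ[ℝ] ℝ)), e, ?_, ?_⟩
  · rw [← finrank_coordinateSubspace s]
    exact LinearEquiv.finrank_eq (e.ofSubmodule' _)
  · intro x hx
    have hx0 : ∀ i ∉ s, e x i = 0 := by
      simpa [Submodule.mem_iInf] using hx
    refine ⟨?_, fun hne => ?_⟩
    · rw [he, ← Finset.sum_subset (Finset.subset_univ s)]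
      intro i _ hi
      rw [hx0 i hi]
      ring
    · by_contra! h
      apply hne
      rw [← e.map_eq_zero_iff]
      ext i
      by_cases hi : i ∈ s
      · exact h i hi
      · exact hx0 i hi

theorem exists_neg_subspace (hA : A.IsHermitian) :
    ∃ U : Submodule ℝ (n → ℝ), Module.finrank ℝ U = hA.negIndex ∧
      ∀ x ∈ U, x ≠ 0 → x ⬝ᵥ A *ᵥ x < 0 := by
  obtain ⟨U, e, h1, h2⟩ := hA.exists_subspace (Finset.univ.filter fun i => hA.eigenvalues i < 0)
  refine ⟨U, h1, fun x hx hne => ?_⟩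
  obtain ⟨h3, h4⟩ := h2 x hx
  obtain ⟨i, hi, hi0⟩ := h4 hne
  rw [h3]
  refine Finset.sum_neg' (fun j hj => ?_) ⟨i, hi, ?_⟩
  · exact mul_nonpos_of_nonpos_of_nonneg (Finset.mem_filter.1 hj).2.le (sq_nonneg _)
  · exact mul_neg_of_neg_of_pos (Finset.mem_filter.1 hi).2 (by positivity)

theorem exists_nonpos_subspace (hA : A.IsHermitian) :
    ∃ U : Submodule ℝ (n → ℝ), Module.finrank ℝ U = hA.negIndex + hA.zeroIndex ∧
      ∀ x ∈ U, x ⬝ᵥ A *ᵥ x ≤ 0 := by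
  obtain ⟨U, e, h1, h2⟩ := hA.exists_subspace ((Finset.univ.filter fun i => hA.eigenvalues i < 0) ∪
    (Finset.univ.filter fun i => hA.eigenvalues i = 0))
  refine ⟨U, ?_, fun x hx => ?_⟩
  · rw [h1, Finset.card_union_of_disjoint, negIndex, zeroIndex]
    exact Finset.disjoint_filter.2 fun i _ hi => hi.ne
  · rw [(h2 x hx).1]
    refine Finset.sum_nonpos fun j hj => ?_
    have : hA.eigenvalues j ≤ 0 := by
      simp only [Finset.mem_union, Finset.mem_filter, Finset.mem_univ, true_and] at hj
      rcases hj with h | h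
      · exact h.le
      · exact h.le
    exact mul_nonpos_of_nonpos_of_nonneg this (sq_nonneg _)

theorem exists_pos_subspace (hA : A.IsHermitian) :
    ∃ U : Submodule ℝ (n → ℝ),
      Module.finrank ℝ U + (hA.negIndex + hA.zeroIndex) = Fintype.card n ∧
      ∀ x ∈ U, x ≠ 0 → 0 < x ⬝ᵥ A *ᵥ x := by
  obtain ⟨U, e, h1, h2⟩ := hA.exists_subspace (Finset.univ.filter fun i => 0 < hA.eigenvalues i)
  refine ⟨U, ?_, fun x hx hne => ?_⟩
  · rw [h1, negIndex, zeroIndex, ← Finset.card_union_of_disjoint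
      (Finset.disjoint_filter.2 fun i _ hi => hi.ne), ← Finset.card_union_of_disjoint,
      ← Finset.card_univ]
    · congr 1
      ext i
      simp only [Finset.mem_union, Finset.mem_filter, Finset.mem_univ, true_and, iff_true]
      rcases lt_trichotomy (hA.eigenvalues i) 0 with h | h | h <;> tauto
    · rw [Finset.disjoint_left]
      intro i hi
      simp only [Finset.mem_union, Finset.mem_filter, Finset.mem_univ, true_and] at hi ⊢
      push Not
      exact ⟨hi.le, hi.ne'⟩
  · obtain ⟨h3, h4⟩ := h2 x hx
    obtain ⟨i, hi, hi0⟩ := h4 hne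
    rw [h3]
    refine Finset.sum_pos' (fun j hj => ?_) ⟨i, hi, ?_⟩
    · exact mul_nonneg (Finset.mem_filter.1 hj).2.le (sq_nonneg _)
    · exact mul_pos (Finset.mem_filter.1 hi).2 (by positivity)

theorem exists_nonneg_subspace (hA : A.IsHermitian) :
    ∃ U : Submodule ℝ (n → ℝ), Module.finrank ℝ U + hA.negIndex = Fintype.card n ∧
      ∀ x ∈ U, 0 ≤ x ⬝ᵥ A *ᵥ x := by
  obtain ⟨U, e, h1, h2⟩ := hA.exists_subspace (Finset.univ.filter fun i => ¬ hA.eigenvalues i < 0)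
  refine ⟨U, ?_, fun x hx => ?_⟩
  · rw [h1, negIndex, add_comm, Finset.card_filter_add_card_filter_not, Finset.card_univ]
  · rw [(h2 x hx).1]
    refine Finset.sum_nonneg fun j hj => ?_
    exact mul_nonneg (not_lt.1 (Finset.mem_filter.1 hj).2) (sq_nonneg _)

/-- A subspace on which the form is negative meets the span of the eigenvectors with nonnegative
eigenvalue only in zero, and the codimension of that span is the index. -/
theorem finrank_le_negIndex (hA : A.IsHermitian) {W : Submodule ℝ (n → ℝ)}
    (hW : ∀ x ∈ W, x ≠ 0 → x ⬝ᵥ A *ᵥ x < 0) : Module.finrank ℝ W ≤ hA.negIndex := by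
  obtain ⟨U, h1, h2⟩ := hA.exists_nonneg_subspace
  have h := finrank_add_le_card_of_disjoint (U := U) (W := W) (by
    rw [Submodule.disjoint_def]
    intro x hx hx'
    by_contra hne
    exact absurd (h2 x hx) (not_le.2 (hW x hx' hne)))
  omega

theorem finrank_add_negIndex_le (hA : A.IsHermitian) {W : Submodule ℝ (n → ℝ)}
    (hW : ∀ x ∈ W, 0 ≤ x ⬝ᵥ A *ᵥ x) :
    Module.finrank ℝ W + hA.negIndex ≤ Fintype.card n := by
  obtain ⟨U, h1, h2⟩ := hA.exists_neg_subspace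
  rw [← h1]
  refine finrank_add_le_card_of_disjoint ?_
  rw [Submodule.disjoint_def]
  intro x hx hx'
  by_contra hne
  exact absurd (hW x hx) (not_le.2 (h2 x hx' hne))

theorem det_eq_zero_iff_zeroIndex (hA : A.IsHermitian) : A.det = 0 ↔ 1 ≤ hA.zeroIndex := by
  rw [hA.det_eq_prod_eigenvalues, Finset.prod_eq_zero_iff, zeroIndex, Nat.one_le_iff_ne_zero,
    Finset.card_ne_zero]
  simp [Finset.Nonempty]

/-- The sign of the determinant is (-1) to the number of negative eigenvalues. This parity later
fixes an index known up to two neighbouring values. -/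
theorem even_negIndex_iff (hA : A.IsHermitian) (h0 : A.det ≠ 0) :
    Even hA.negIndex ↔ 0 < A.det := by
  have key : A.det = (-1) ^ hA.negIndex * ∏ i, |hA.eigenvalues i| := by
    rw [hA.det_eq_prod_eigenvalues, negIndex, ← Finset.prod_const, Finset.prod_filter,
      ← Finset.prod_mul_distrib]
    refine Finset.prod_congr rfl fun i _ => ?_
    split_ifs with h
    · simp [abs_of_neg h]
    · simp [abs_of_nonneg (not_lt.1 h)]
  have hpos : 0 < ∏ i, |hA.eigenvalues i| := by
    refine lt_of_le_of_ne (Finset.prod_nonneg fun i _ => abs_nonneg _) fun h => h0 ?_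
    rw [key, ← h, mul_zero]
  rw [key]
  rcases Nat.even_or_odd hA.negIndex with h | h
  · simp [h, h.neg_one_pow, hpos]
  · simp [h.neg_one_pow, Nat.not_even_iff_odd.2 h, hpos.le]

theorem zeroIndex_add_rank (hA : A.IsHermitian) : hA.zeroIndex + A.rank = Fintype.card n := by
  rw [hA.rank_eq_card_non_zero_eigs, Fintype.card_subtype, zeroIndex,
    Finset.card_filter_add_card_filter_not, Finset.card_univ]

theorem zeroIndex_eq_finrank_ker (hA : A.IsHermitian) :
    hA.zeroIndex = Module.finrank ℝ (LinearMap.ker A.mulVecLin) := by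
  have h1 := hA.zeroIndex_add_rank
  have h2 := LinearMap.finrank_range_add_finrank_ker A.mulVecLin
  rw [Module.finrank_fintype_fun_eq_card] at h2
  rw [Matrix.rank] at h1
  omega

end Matrix.IsHermitian

/-! ### Semicontinuity and monotonicity of the index -/

namespace Matrix.IsHermitian

/-- By homogeneity it suffices to control the form on the unit sphere of `W`, which is compact, so
one neighbourhood of `A` serves all vectors. -/
theorem eventually_neg_on_subspace {n : Type*} [Fintype n] {A : Matrix n n ℝ}
    {W : Submodule ℝ (n → ℝ)} (hW : ∀ x ∈ W, x ≠ 0 → x ⬝ᵥ A *ᵥ x < 0) :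
    ∀ᶠ B in 𝓝 A, ∀ x ∈ W, x ≠ 0 → x ⬝ᵥ B *ᵥ x < 0 := by
  have hK : IsCompact ((W : Set (n → ℝ)) ∩ Metric.sphere 0 1) :=
    (isCompact_sphere (0 : n → ℝ) 1).inter_left W.closed_of_finiteDimensional
  have h := hK.eventually_forall_of_forall_eventually (x₀ := A)
    (P := fun B x => x ⬝ᵥ B *ᵥ x < 0) (by
      rintro x ⟨hx, hx1⟩
      have hc : Continuous fun z : Matrix n n ℝ × (n → ℝ) => z.2 ⬝ᵥ z.1 *ᵥ z.2 := by fun_prop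
      have hne : x ≠ 0 := by
        rintro rfl
        simp at hx1
      exact hc.continuousAt.eventually_lt continuousAt_const (hW x hx hne))
  filter_upwards [h] with B hB x hx hne
  have hn : 0 < ‖x‖ := norm_pos_iff.2 hne
  have h1 := hB (‖x‖⁻¹ • x) ⟨W.smul_mem _ hx, by simp [norm_smul, hn.ne']⟩
  rw [Matrix.mulVec_smul, smul_dotProduct, dotProduct_smul, smul_eq_mul, smul_eq_mul,
    ← mul_assoc] at h1
  by_contra hge
  exact absurd h1 (not_lt.2 (mul_nonneg (by positivity) (not_lt.1 hge)))

variable {n : Type*} [Fintype n] [DecidableEq n] {A : Matrix n n ℝ}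

theorem eventually_le_negIndex (hA : A.IsHermitian) :
    ∀ᶠ B in 𝓝 A, ∀ hB : B.IsHermitian, hA.negIndex ≤ hB.negIndex := by
  obtain ⟨U, h1, h2⟩ := hA.exists_neg_subspace
  filter_upwards [eventually_neg_on_subspace h2] with B h hB
  rw [← h1]
  exact hB.finrank_le_negIndex h

/-- The form stays positive on the positive subspace of `A` for all nearby matrices; only the
negative and null directions of `A` can turn negative. -/
theorem eventually_negIndex_le (hA : A.IsHermitian) :
    ∀ᶠ B in 𝓝 A, ∀ hB : B.IsHermitian, hB.negIndex ≤ hA.negIndex + hA.zeroIndex := by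
  obtain ⟨U, h1, h2⟩ := hA.exists_pos_subspace
  have h3 := eventually_neg_on_subspace (A := -A) (W := U) (fun x hx hne => by
    rw [Matrix.neg_mulVec, dotProduct_neg]
    exact neg_lt_zero.2 (h2 x hx hne))
  filter_upwards [continuous_neg.continuousAt.eventually h3] with B h hB
  have h4 := hB.finrank_add_negIndex_le (W := U) (fun x hx => by
    by_cases hne : x = 0
    · simp [hne]
    · have := h x hx hne
      rw [Matrix.neg_mulVec, dotProduct_neg] at this
      linarith)
  omega

/-- Strict decrease makes the form of `B` negative on every nonzero vector where the form of `A` is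
nonpositive, so null directions of `A` count as negative for `B`. -/
theorem negIndex_add_zeroIndex_le {B : Matrix n n ℝ} (hA : A.IsHermitian) (hB : B.IsHermitian)
    (h : ∀ x, x ≠ 0 → x ⬝ᵥ B *ᵥ x < x ⬝ᵥ A *ᵥ x) :
    hA.negIndex + hA.zeroIndex ≤ hB.negIndex := by
  obtain ⟨U, h1, h2⟩ := hA.exists_nonpos_subspace
  rw [← h1]
  exact hB.finrank_le_negIndex fun x hx hne => (h x hne).trans_le (h2 x hx)

end Matrix.IsHermitian

/-! ### Counting the crossings of a monotone family -/

/-- A left-continuous step function `ν` on `(-∞, 0]` which vanishes near `-∞` and jumps by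
`κ ≤ 1` has exactly `ν 0` jumps on `(-∞, 0)`. -/
theorem exists_strictMono_range_of_step {ν κ : ℝ → ℕ} {z₀ : ℝ} (hz₀ : z₀ ≤ 0) (h0 : ν z₀ = 0)
    (hmono : ∀ z z', z < z' → z' ≤ 0 → ν z + κ z ≤ ν z')
    (hleft : ∀ z ≤ 0, ∃ y < z, ∀ x, y < x → x < z → ν z ≤ ν x)
    (hright : ∀ z < 0, ∃ y > z, ∀ x, z < x → x < y → x ≤ 0 → ν x ≤ ν z + κ z)
    (hκ : ∀ z < 0, κ z ≤ 1) :
    ∃ Z : Fin (ν 0) → ℝ, StrictMono Z ∧ (∀ j, Z j < 0) ∧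
      ∀ z < 0, 1 ≤ κ z ↔ z ∈ Set.range Z := by
  have hm : ∀ z z', z ≤ z' → z' ≤ 0 → ν z ≤ ν z' := by
    intro z z' h h'
    rcases h.eq_or_lt with rfl | h
    · exact le_rfl
    · exact (Nat.le_add_right _ _).trans (hmono z z' h h')
  have key : ∀ j : Fin (ν 0), ∃ z < 0, ν z = j ∧ κ z = 1 := by
    intro j
    -- The jump from level j is the last point at which ν is at most j. The left condition puts the
    -- supremum itself into S. Just to its right ν exceeds j, so the right condition and κ ≤ 1 force
    -- ν = j and κ = 1 there.
    set S : Set ℝ := {z | z ≤ 0 ∧ ν z ≤ j} with hS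
    have hne : S.Nonempty := ⟨z₀, hz₀, by omega⟩
    have hbdd : BddAbove S := ⟨0, fun z hz => hz.1⟩
    set Z := sSup S with hZ
    have hZ0 : Z ≤ 0 := csSup_le hne fun z hz => hz.1
    have hνZ : ν Z ≤ j := by
      obtain ⟨y, hy, hyz⟩ := hleft Z hZ0
      obtain ⟨x, hx, hyx⟩ := exists_lt_of_lt_csSup hne hy
      rcases (le_csSup hbdd hx).eq_or_lt with h | h
      · rw [← hZ] at h
        rw [← h]
        exact hx.2
      · exact (hyz x hyx h).trans hx.2
    have hlt : Z < 0 := by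
      refine hZ0.lt_of_ne fun h => ?_
      rw [h] at hνZ
      omega
    obtain ⟨y, hy, hyz⟩ := hright Z hlt
    have hx1 : Z < min (y) 0 := lt_min hy hlt
    obtain ⟨x, hZx, hx⟩ := exists_between hx1
    have hx0 : x ≤ 0 := (hx.trans_le (min_le_right _ _)).le
    have h1 := hyz x hZx (hx.trans_le (min_le_left _ _)) hx0
    have h2 : ¬ ν x ≤ j := fun h => absurd (le_csSup hbdd ⟨hx0, h⟩) (not_le.2 hZx)
    have h3 := hκ Z hlt
    exact ⟨Z, hlt, by omega, by omega⟩
  choose Z hZ0 hZν hZκ using key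
  refine ⟨Z, ?_, hZ0, fun z hz => ⟨fun h => ?_, ?_⟩⟩
  · intro i j hij
    by_contra hle
    have h1 := hm _ _ (not_lt.1 hle) (hZ0 i).le
    rw [hZν, hZν] at h1
    exact absurd hij (not_lt.2 h1)
  · have h1 := hmono z 0 hz le_rfl
    refine ⟨⟨ν z, by omega⟩, ?_⟩
    set j : Fin (ν 0) := ⟨ν z, by omega⟩
    have hj : ν (Z j) = ν z := hZν j
    have hk := hZκ j
    rcases lt_trichotomy (Z j) z with h2 | h2 | h2
    · have := hmono _ _ h2 hz.le
      omega
    · exact h2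
    · have := hmono _ _ h2 (hZ0 j).le
      omega
  · rintro ⟨j, rfl⟩
    exact (hZκ j).ge

namespace Matrix

/-- For a continuous strictly decreasing family of real symmetric matrices on `(-∞, 0]` which is
positive near `-∞` and whose kernels are at most one-dimensional, the zeros of the determinant on
`(-∞, 0)` are as many as the negative eigenvalues at `0`. -/
theorem exists_strictMono_range_det_eq_zero {n : Type*} [Fintype n] [DecidableEq n]
    {A : ℝ → Matrix n n ℝ} (hA : ∀ z, (A z).IsHermitian) (hc : ContinuousOn A (Set.Iic 0))
    (hlt : ∀ z z', z < z' → z' ≤ 0 → ∀ x, x ≠ 0 → x ⬝ᵥ A z' *ᵥ x < x ⬝ᵥ A z *ᵥ x)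
    {z₀ : ℝ} (hz₀ : z₀ ≤ 0) (hpos : ∀ x, 0 ≤ x ⬝ᵥ A z₀ *ᵥ x)
    (hker : ∀ z < 0, Module.finrank ℝ (LinearMap.ker (A z).mulVecLin) ≤ 1) :
    ∃ Z : Fin (hA 0).negIndex → ℝ, StrictMono Z ∧ (∀ j, Z j < 0) ∧
      ∀ z < 0, (A z).det = 0 ↔ z ∈ Set.range Z := by
  -- ν counts the negative eigenvalues and κ the zero ones. Strict decrease turns the kernel at z
  -- into negative directions at every later point, which is the jump condition.
  have h := exists_strictMono_range_of_step (ν := fun z => (hA z).negIndex)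
    (κ := fun z => (hA z).zeroIndex) hz₀
    (by
      have := (hA z₀).finrank_add_negIndex_le (W := ⊤) fun x _ => hpos x
      simpa using this)
    (fun z z' h h' => (hA z).negIndex_add_zeroIndex_le (hA z') (hlt z z' h h'))
    (fun z hz => by
      have h1 := (hc z hz).eventually (hA z).eventually_le_negIndex
      have h2 : ∀ᶠ x in 𝓝[<] z, (hA z).negIndex ≤ (hA x).negIndex := by
        have h3 : 𝓝[<] z ≤ 𝓝[Set.Iic 0] z :=
          nhdsWithin_mono _ fun x hx => (Set.mem_Iio.1 hx).le.trans hz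
        filter_upwards [h3 h1] with x hx using hx (hA x)
      obtain ⟨y, hy, hyz⟩ := (mem_nhdsLT_iff_exists_Ioo_subset).1 h2
      exact ⟨y, hy, fun x h h' => hyz ⟨h, h'⟩⟩)
    (fun z hz => by
      have h1 := (hc z hz.le).eventually (hA z).eventually_negIndex_le
      have h2 : ∀ᶠ x in 𝓝 z, (hA x).negIndex ≤ (hA z).negIndex + (hA z).zeroIndex := by
        rw [nhdsWithin_eq_nhds.2 (Iic_mem_nhds hz)] at h1
        filter_upwards [h1] with x hx using hx (hA x)
      obtain ⟨y, hy, hyz⟩ := (mem_nhdsGT_iff_exists_Ioo_subset).1 (mem_nhdsWithin_of_mem_nhds h2)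
      exact ⟨y, hy, fun x h h' _ => hyz ⟨h, h'⟩⟩)
    (fun z hz => by
      rw [(hA z).zeroIndex_eq_finrank_ker]
      exact hker z hz)
  obtain ⟨Z, h1, h2, h3⟩ := h
  exact ⟨Z, h1, h2, fun z hz => by rw [(hA z).det_eq_zero_iff_zeroIndex, h3 z hz]⟩

end Matrix

/-! ### Trigonometry on the circle and the range of the dispersion -/

namespace LatticeFermion

noncomputable section

open scoped Matrix

/-- The sine as a function on `ℝ/2πℤ`. -/
def sinT : AddCircle (2 * π) → ℝ := Real.sin_periodic.lift

theorem sinT_coe (x : ℝ) : sinT (x : AddCircle (2 * π)) = Real.sin x := rfl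

theorem continuous_sinT : Continuous sinT :=
  Real.continuous_sin.quotient_liftOn' _

theorem sinT_neg (x : AddCircle (2 * π)) : sinT (-x) = -sinT x := by
  induction x using QuotientAddGroup.induction_on with
  | H x => exact Real.sin_neg x

theorem sinT_sq (x : AddCircle (2 * π)) : sinT x ^ 2 = 1 - cosT x ^ 2 := by
  induction x using QuotientAddGroup.induction_on with
  | H x => exact Real.sin_sq x

theorem cosT_sub (x y : AddCircle (2 * π)) :
    cosT (x - y) = cosT x * cosT y + sinT x * sinT y := by
  induction x using QuotientAddGroup.induction_on with
  | H x =>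
    induction y using QuotientAddGroup.induction_on with
    | H y => exact Real.cos_sub x y

theorem cosT_two_nsmul (x : AddCircle (2 * π)) : cosT ((2 : ℕ) • x) = 2 * cosT x ^ 2 - 1 := by
  induction x using QuotientAddGroup.induction_on with
  | H x =>
    rw [show cosT (x : AddCircle (2 * π)) = Real.cos x from rfl, ← Real.cos_two_mul]
    have : ((2 : ℕ) • (x : AddCircle (2 * π))) = ((2 * x : ℝ) : AddCircle (2 * π)) := by
      rw [two_nsmul, two_mul x, AddCircle.coe_add]
    rw [show (QuotientAddGroup.mk x : AddCircle (2 * π)) = (x : AddCircle (2 * π)) from rfl, this]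
    rfl

theorem cosT_add_pi (x : AddCircle (2 * π)) : cosT (x + (π : ℝ)) = -cosT x := by
  induction x using QuotientAddGroup.induction_on with
  | H x => exact Real.cos_add_pi x

theorem sinT_add_pi (x : AddCircle (2 * π)) : sinT (x + (π : ℝ)) = -sinT x := by
  induction x using QuotientAddGroup.induction_on with
  | H x => exact Real.sin_add_pi x

theorem cosT_mem_Icc (x : AddCircle (2 * π)) : cosT x ∈ Set.Icc (-1) 1 := by
  induction x using QuotientAddGroup.induction_on with
  | H x => exact Real.cos_mem_Icc x

theorem dispersion_nonneg (p : Torus) : 0 ≤ dispersion p := by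
  have h1 := (cosT_mem_Icc p.1).2
  have h2 := (cosT_mem_Icc p.2).2
  unfold dispersion
  linarith

theorem dispersion_le (p : Torus) : dispersion p ≤ 8 := by
  have h1 := (cosT_mem_Icc p.1).1
  have h2 := (cosT_mem_Icc p.2).1
  unfold dispersion
  linarith

/-! ### Averages over the torus -/

theorem integral_addCircle (f : AddCircle (2 * π) → ℝ) :
    ∫ x, f x = ∫ x in (0 : ℝ)..2 * π, f x := by
  have := AddCircle.intervalIntegral_preimage (2 * π) 0 f
  rw [← this, zero_add]

/-- The moments of the cosine on the circle. -/
def cosMoment (n : ℕ) : ℝ := (2 * π)⁻¹ * ∫ x, cosT x ^ n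

theorem cosMoment_zero : cosMoment 0 = 1 := by
  rw [cosMoment, integral_addCircle]
  simp only [pow_zero, intervalIntegral.integral_const, smul_eq_mul]
  field_simp
  ring

theorem cosMoment_one : cosMoment 1 = 0 := by
  rw [cosMoment, integral_addCircle]
  simp [cosT_coe]

theorem cosMoment_two : cosMoment 2 = 1 / 2 := by
  rw [cosMoment, integral_addCircle]
  simp [cosT_coe, integral_cos_sq]
  field_simp

theorem cosMoment_three : cosMoment 3 = 0 := by
  rw [cosMoment, integral_addCircle]
  simp [cosT_coe, integral_cos_pow_three]

theorem cosMoment_four : cosMoment 4 = 3 / 8 := by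
  rw [cosMoment, integral_addCircle]
  simp only [cosT_coe]
  rw [integral_cos_pow]
  simp [integral_cos_sq]
  field_simp
  ring

/-- The average of a function over the torus. -/
def avg (F : Torus → ℝ) : ℝ := 1 / (2 * π) ^ 2 * ∫ p, F p

theorem avg_add {F G : Torus → ℝ} (hF : Integrable F) (hG : Integrable G) :
    avg (fun p => F p + G p) = avg F + avg G := by
  rw [avg, avg, avg, integral_add hF hG, mul_add]

theorem avg_const_mul (c : ℝ) (F : Torus → ℝ) : avg (fun p => c * F p) = c * avg F := by
  rw [avg, avg, integral_const_mul]
  ring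

theorem avg_neg (F : Torus → ℝ) : avg (fun p => - F p) = - avg F := by
  rw [avg, avg, integral_neg]
  ring

theorem avg_sub {F G : Torus → ℝ} (hF : Integrable F) (hG : Integrable G) :
    avg (fun p => F p - G p) = avg F - avg G := by
  rw [avg, avg, avg, integral_sub hF hG, mul_sub]

theorem avg_mono {F G : Torus → ℝ} (hF : Integrable F) (hG : Integrable G)
    (h : ∀ p, F p ≤ G p) : avg F ≤ avg G :=
  mul_le_mul_of_nonneg_left (integral_mono hF hG h) (by positivity)

theorem avg_swap (F : Torus → ℝ) : avg (fun p => F p.swap) = avg F := by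
  rw [avg, avg, Measure.volume_eq_prod, integral_prod_swap F]

theorem avg_add_pi (F : Torus → ℝ) :
    avg (fun p => F (p + (((π : ℝ) : AddCircle (2 * π)), ((π : ℝ) : AddCircle (2 * π))))) =
      avg F := by
  have : (volume : Measure Torus).IsAddLeftInvariant := by
    rw [Measure.volume_eq_prod]
    infer_instance
  simp_rw [avg, add_comm _ (((π : ℝ) : AddCircle (2 * π)), ((π : ℝ) : AddCircle (2 * π)))]
  rw [integral_add_left_eq_self F]

theorem avg_neg_fst (F : Torus → ℝ) : avg (fun p => F (-p.1, p.2)) = avg F := by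
  have h := (Measure.measurePreserving_neg (volume : Measure (AddCircle (2 * π)))).prod
    (MeasurePreserving.id (volume : Measure (AddCircle (2 * π))))
  rw [avg, avg]
  congr 1
  exact h.integral_comp
    ((MeasurableEquiv.neg (AddCircle (2 * π))).prodCongr
      (MeasurableEquiv.refl (AddCircle (2 * π)))).measurableEmbedding F

theorem integrable_of_continuous {F : Torus → ℝ} (hF : Continuous F) : Integrable F :=
  hF.integrable_of_hasCompactSupport (HasCompactSupport.of_compactSpace F)

theorem avg_cos_pow (m n : ℕ) :
    avg (fun p => cosT p.1 ^ m * cosT p.2 ^ n) = cosMoment m * cosMoment n := by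
  rw [avg, Measure.volume_eq_prod,
    integral_prod_mul (fun x => cosT x ^ m) (fun x => cosT x ^ n), cosMoment, cosMoment]
  field_simp

/-- The average as a linear functional on continuous functions. -/
def avgC : C(Torus, ℝ) →ₗ[ℝ] ℝ where
  toFun F := avg F
  map_add' F G := avg_add (integrable_of_continuous F.continuous)
    (integrable_of_continuous G.continuous)
  map_smul' c F := avg_const_mul c F

/-- `cos p₁` as a continuous function. -/
def cosC₁ : C(Torus, ℝ) := ⟨fun p => cosT p.1, continuous_cosT.comp continuous_fst⟩

/-- `cos p₂` as a continuous function. -/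
def cosC₂ : C(Torus, ℝ) := ⟨fun p => cosT p.2, continuous_cosT.comp continuous_snd⟩

theorem avgC_monomial (m n : ℕ) :
    avgC (cosC₁ ^ m * cosC₂ ^ n) = cosMoment m * cosMoment n :=
  avg_cos_pow m n

theorem avg_eq_avgC {F : Torus → ℝ} (G : C(Torus, ℝ)) (h : ∀ p, F p = G p) : avg F = avgC G :=
  congrArg avg (funext h)

/-! ### The basis functions of the interaction and their Gram matrix -/

/-- The even factors of the functions spanning the range of the interaction. -/
def psi : Fin 3 → Torus → ℝ := ![fun _ => 1, fun p => 2 * cosT p.1, fun p => 2 * cosT p.2]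

/-- The functions `sin p₁`, `sin 2p₁`, `2 sin p₁ cos p₂`. -/
def phi (k : Fin 3) (p : Torus) : ℝ := sinT p.1 * psi k p

theorem continuous_psi (k : Fin 3) : Continuous (psi k) := by
  have h := continuous_cosT
  fin_cases k <;> simp only [psi] <;> simp <;> fun_prop

theorem continuous_phi (k : Fin 3) : Continuous (phi k) := by
  have h := continuous_sinT
  have h' := continuous_psi k
  unfold phi
  fun_prop

theorem phi_mul_phi (j k : Fin 3) (p : Torus) :
    phi j p * phi k p = (1 - cosT p.1 ^ 2) * (psi j p * psi k p) := by
  rw [phi, phi, ← sinT_sq]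
  ring

theorem abs_psi_le (k : Fin 3) (p : Torus) : |psi k p| ≤ 2 := by
  have h1 := abs_le.2 (cosT_mem_Icc p.1)
  have h2 := abs_le.2 (cosT_mem_Icc p.2)
  fin_cases k <;> simp [psi, abs_mul] <;> linarith

/-- The factor sin² p₁ is at most 2(1 - cos p₁), hence at most the dispersion. This cancels the
singularity of 1/(E - z) at z = 0 and bounds the integrands of the Gram matrix uniformly in z ≤ 0.
-/
theorem abs_phi_mul_phi_le (j k : Fin 3) (p : Torus) :
    |phi j p * phi k p| ≤ 4 * dispersion p := by
  have h1 := cosT_mem_Icc p.1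
  have h2 := cosT_mem_Icc p.2
  have h0 : 0 ≤ 1 - cosT p.1 ^ 2 := by nlinarith [h1.1, h1.2]
  have h3 : |psi j p * psi k p| ≤ 4 := by
    rw [abs_mul]
    nlinarith [abs_psi_le j p, abs_psi_le k p, abs_nonneg (psi j p), abs_nonneg (psi k p)]
  rw [phi_mul_phi, abs_mul, abs_of_nonneg h0, dispersion]
  have h4 : 1 - cosT p.1 ^ 2 ≤ 2 * (1 - cosT p.1 + (1 - cosT p.2)) := by
    nlinarith [h1.1, h1.2, h2.2]
  nlinarith

/-- The Gram matrix of the functions `phi` with weight `1 / (𝓔₀ - z)`. -/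
def gram (z : ℝ) : Matrix (Fin 3) (Fin 3) ℝ :=
  Matrix.of fun j k => avg fun p => phi j p * phi k p / (dispersion p - z)

theorem gram_apply (z : ℝ) (j k : Fin 3) :
    gram z j k = avg fun p => phi j p * phi k p / (dispersion p - z) := rfl

theorem gram_symm (z : ℝ) (j k : Fin 3) : gram z j k = gram z k j := by
  simp only [gram_apply, mul_comm]

theorem abs_gram_integrand_le (j k : Fin 3) {z : ℝ} (hz : z ≤ 0) (p : Torus) :
    |phi j p * phi k p / (dispersion p - z)| ≤ 4 := by
  have h0 := dispersion_nonneg p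
  have h1 := abs_phi_mul_phi_le j k p
  rw [abs_div, abs_of_nonneg (show 0 ≤ dispersion p - z by linarith)]
  exact div_le_of_le_mul₀ (by linarith) (by norm_num) (by linarith)

theorem aestronglyMeasurable_gram_integrand (j k : Fin 3) (z : ℝ) :
    AEStronglyMeasurable (fun p : Torus => phi j p * phi k p / (dispersion p - z)) := by
  refine Measurable.aestronglyMeasurable ?_
  have h1 := (continuous_phi j).measurable
  have h2 := (continuous_phi k).measurable
  have h3 := continuous_dispersion.measurable
  fun_prop

theorem integrable_gram_integrand (j k : Fin 3) {z : ℝ} (hz : z ≤ 0) :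
    Integrable (fun p : Torus => phi j p * phi k p / (dispersion p - z)) :=
  Integrable.of_bound (aestronglyMeasurable_gram_integrand j k z) 4
    (Eventually.of_forall fun p => abs_gram_integrand_le j k hz p)

theorem continuousOn_gram : ContinuousOn gram (Set.Iic 0) := by
  refine continuousOn_pi.2 fun j => continuousOn_pi.2 fun k => ?_
  simp only [gram_apply, avg]
  refine ContinuousOn.mul continuousOn_const ?_
  refine continuousOn_of_dominated (bound := fun _ => 4)
    (fun z _ => aestronglyMeasurable_gram_integrand j k z)
    (fun z hz => Eventually.of_forall fun p => abs_gram_integrand_le j k hz p)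
    (integrable_const _) (Eventually.of_forall fun p => ?_)
  rcases (dispersion_nonneg p).eq_or_lt with h | h
  · have h0 : phi j p * phi k p = 0 := by
      have := abs_phi_mul_phi_le j k p
      rw [← h, mul_zero] at this
      exact abs_eq_zero.1 (le_antisymm this (abs_nonneg _))
    simp only [h0, zero_div]
    exact continuousOn_const
  · refine ContinuousOn.div continuousOn_const (by fun_prop) fun z hz => ?_
    have : z ≤ 0 := hz
    linarith

theorem avg_phi_mul_phi (j k : Fin 3) :
    avg (fun p => phi j p * phi k p) =
      if j = k then (![1 / 2, 1 / 2, 1] : Fin 3 → ℝ) j else 0 := by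
  have key : ∀ (c : ℝ) (m n : ℕ), (∀ p, psi j p * psi k p = c * (cosT p.1 ^ m * cosT p.2 ^ n)) →
      avg (fun p => phi j p * phi k p) =
        c * ((cosMoment m - cosMoment (m + 2)) * cosMoment n) := by
    intro c m n h
    rw [avg_eq_avgC (c • (cosC₁ ^ m * cosC₂ ^ n) - c • (cosC₁ ^ (m + 2) * cosC₂ ^ n)), map_sub,
      map_smul, map_smul, avgC_monomial, avgC_monomial, smul_eq_mul, smul_eq_mul]
    · ring
    · intro p
      rw [phi_mul_phi, h]
      simp [cosC₁, cosC₂]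
      ring
  fin_cases j <;> fin_cases k
  · rw [key 1 0 0 (by intro p; simp [psi])]
    norm_num [cosMoment_zero, cosMoment_two]
  · rw [key 2 1 0 (by intro p; simp [psi])]
    norm_num [cosMoment_zero, cosMoment_one, cosMoment_three]
  · rw [key 2 0 1 (by intro p; simp [psi])]
    norm_num [cosMoment_one]
  · rw [key 2 1 0 (by intro p; simp [psi])]
    norm_num [cosMoment_zero, cosMoment_one, cosMoment_three]
  · rw [key 4 2 0 (by intro p; simp [psi]; ring)]
    norm_num [cosMoment_zero, cosMoment_two, cosMoment_four]
  · rw [key 4 1 1 (by intro p; simp [psi]; ring)]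
    norm_num [cosMoment_one]
  · rw [key 2 0 1 (by intro p; simp [psi])]
    norm_num [cosMoment_one]
  · rw [key 4 1 1 (by intro p; simp [psi]; ring)]
    norm_num [cosMoment_one]
  · rw [key 4 0 2 (by intro p; simp [psi]; ring)]
    norm_num [cosMoment_zero, cosMoment_two]

/-- Multiplication by the dispersion sends φ₀ into the span of the three functions. Averaged against
φⱼ, this gives a linear relation in each row of the Gram matrix. -/
theorem phi_relation (p : Torus) (z : ℝ) :
    (4 - z) * phi 0 p - phi 1 p - phi 2 p = (dispersion p - z) * phi 0 p := by
  simp only [phi, psi, dispersion, Matrix.cons_val]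
  ring

/-- The lattice equation for the Gram matrix. -/
theorem gram_relation {z : ℝ} (hz : z ≤ 0) (j : Fin 3) :
    (4 - z) * gram z j 0 - gram z j 1 - gram z j 2 = if j = 0 then 1 / 2 else 0 := by
  simp only [gram_apply]
  rw [← avg_const_mul, ← avg_sub ((integrable_gram_integrand j 0 hz).const_mul _)
    (integrable_gram_integrand j 1 hz), ← avg_sub (F := fun p => (4 - z) *
      (phi j p * phi 0 p / (dispersion p - z)) - phi j p * phi 1 p / (dispersion p - z))
    (((integrable_gram_integrand j 0 hz).const_mul _).sub (integrable_gram_integrand j 1 hz))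
    (integrable_gram_integrand j 2 hz)]
  trans avg (fun p => phi j p * phi 0 p)
  · congr 1
    ext p
    -- A zero denominator occurs only for z = 0 at a zero of the dispersion. There the numerators
    -- vanish too, and so do both sides.
    by_cases h : dispersion p - z = 0
    · have h0 : dispersion p = 0 := by
        have := dispersion_nonneg p
        linarith
      have := abs_phi_mul_phi_le j 0 p
      rw [h0, mul_zero] at this
      rw [abs_eq_zero.1 (le_antisymm this (abs_nonneg _)), h]
      simp
    · have := phi_relation p z
      field_simp
      linear_combination phi j p * this
  · rw [avg_phi_mul_phi]
    fin_cases j <;> simp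

theorem dotProduct_gram (z : ℝ) (hz : z ≤ 0) (y : Fin 3 → ℝ) :
    y ⬝ᵥ gram z *ᵥ y = avg fun p => (∑ k, y k * phi k p) ^ 2 / (dispersion p - z) := by
  have h := integrable_gram_integrand (z := z)
  have hsum : ∀ (f : Fin 3 → Fin 3 → ℝ), (∑ j, ∑ k, f j k) = ∑ x : Fin 3 × Fin 3, f x.1 x.2 :=
    fun f => (Fintype.sum_prod_type' f).symm
  have h1 : y ⬝ᵥ gram z *ᵥ y = ∑ x : Fin 3 × Fin 3, (y x.1 * y x.2) * gram z x.1 x.2 := by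
    rw [← hsum fun j k => y j * y k * gram z j k]
    simp only [dotProduct, Matrix.mulVec, Finset.mul_sum]
    refine Finset.sum_congr rfl fun j _ => Finset.sum_congr rfl fun k _ => by ring
  have h2 : ∀ p, (∑ k, y k * phi k p) ^ 2 / (dispersion p - z) =
      ∑ x : Fin 3 × Fin 3, (y x.1 * y x.2) * (phi x.1 p * phi x.2 p / (dispersion p - z)) := by
    intro p
    rw [← hsum fun j k => (y j * y k) * (phi j p * phi k p / (dispersion p - z)), sq,
      Finset.sum_mul_sum, Finset.sum_div]
    refine Finset.sum_congr rfl fun j _ => ?_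
    rw [Finset.sum_div]
    refine Finset.sum_congr rfl fun k _ => by ring
  rw [h1, funext h2, avg, integral_finsetSum _ fun x _ => (h x.1 x.2 hz).const_mul _,
    Finset.mul_sum]
  refine Finset.sum_congr rfl fun x _ => ?_
  rw [integral_const_mul, gram_apply, avg]
  ring

/-- The squared norm of `∑ yₖ φₖ` for the averaged scalar product. -/
def weight (y : Fin 3 → ℝ) : ℝ := y 0 ^ 2 / 2 + y 1 ^ 2 / 2 + y 2 ^ 2

theorem weight_pos {y : Fin 3 → ℝ} (hy : y ≠ 0) : 0 < weight y := by
  by_contra h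
  unfold weight at h
  apply hy
  have h0 : y 0 = 0 := by nlinarith [sq_nonneg (y 0), sq_nonneg (y 1), sq_nonneg (y 2)]
  have h1 : y 1 = 0 := by nlinarith [sq_nonneg (y 0), sq_nonneg (y 1), sq_nonneg (y 2)]
  have h2 : y 2 = 0 := by nlinarith [sq_nonneg (y 0), sq_nonneg (y 1), sq_nonneg (y 2)]
  ext i
  fin_cases i <;> assumption

theorem integrable_sq_sum_phi (y : Fin 3 → ℝ) :
    Integrable fun p => (∑ k, y k * phi k p) ^ 2 := by
  have h := continuous_phi
  exact integrable_of_continuous (by fun_prop)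

theorem avg_sq_sum_phi (y : Fin 3 → ℝ) : avg (fun p => (∑ k, y k * phi k p) ^ 2) = weight y := by
  have hi : ∀ j k, Integrable fun p : Torus => phi j p * phi k p := fun j k => by
    have h1 := continuous_phi j
    have h2 := continuous_phi k
    exact integrable_of_continuous (by fun_prop)
  have h2 : ∀ p, (∑ k, y k * phi k p) ^ 2 =
      ∑ x : Fin 3 × Fin 3, (y x.1 * y x.2) * (phi x.1 p * phi x.2 p) := by
    intro p
    rw [Fintype.sum_prod_type' fun j k => (y j * y k) * (phi j p * phi k p), sq,
      Finset.sum_mul_sum]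
    refine Finset.sum_congr rfl fun j _ => Finset.sum_congr rfl fun k _ => by ring
  rw [funext h2, avg, integral_finsetSum _ fun x _ => (hi x.1 x.2).const_mul _, Finset.mul_sum]
  have h3 : ∀ x : Fin 3 × Fin 3, 1 / (2 * π) ^ 2 * ∫ p : Torus,
      (y x.1 * y x.2) * (phi x.1 p * phi x.2 p) =
      (y x.1 * y x.2) * if x.1 = x.2 then (![1 / 2, 1 / 2, 1] : Fin 3 → ℝ) x.1 else 0 := by
    intro x
    rw [integral_const_mul, ← avg_phi_mul_phi, avg]
    ring
  simp only [h3, Fintype.sum_prod_type, Fin.sum_univ_three, weight]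
  simp
  ring

theorem integrable_sq_sum_phi_div (y : Fin 3 → ℝ) {z : ℝ} (hz : z ≤ 0) :
    Integrable fun p => (∑ k, y k * phi k p) ^ 2 / (dispersion p - z) := by
  have h := fun x : Fin 3 × Fin 3 => (integrable_gram_integrand x.1 x.2 hz).const_mul (y x.1 * y x.2)
  refine (integrable_finsetSum Finset.univ fun x _ => h x).congr (Eventually.of_forall fun p => ?_)
  simp only [sq, Finset.sum_mul_sum, Finset.sum_div,
    Fintype.sum_prod_type' fun j k => (y j * y k) * (phi j p * phi k p / (dispersion p - z))]
  refine Finset.sum_congr rfl fun j _ => Finset.sum_congr rfl fun k _ => by ring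

theorem weight_div_le_dotProduct_gram {z : ℝ} (hz : z ≤ 0) (y : Fin 3 → ℝ) :
    weight y / (8 - z) ≤ y ⬝ᵥ gram z *ᵥ y := by
  rw [dotProduct_gram z hz, ← avg_sq_sum_phi, div_eq_inv_mul, ← avg_const_mul]
  refine avg_mono ((integrable_sq_sum_phi y).const_mul _) (integrable_sq_sum_phi_div y hz)
    fun p => ?_
  rcases (sub_nonneg.2 (hz.trans (dispersion_nonneg p))).eq_or_lt with h | h
  · have h0 : dispersion p = 0 := by
      have := dispersion_nonneg p
      linarith
    have h1 : ∀ k, phi k p = 0 := fun k => by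
      have := abs_phi_mul_phi_le k k p
      rw [h0, mul_zero] at this
      exact mul_self_eq_zero.1 (abs_eq_zero.1 (le_antisymm this (abs_nonneg _)))
    simp [h1]
  · rw [div_eq_inv_mul]
    have := dispersion_le p
    gcongr

theorem gram_pos {z : ℝ} (hz : z ≤ 0) {y : Fin 3 → ℝ} (hy : y ≠ 0) : 0 < y ⬝ᵥ gram z *ᵥ y :=
  (div_pos (weight_pos hy) (by linarith)).trans_le (weight_div_le_dotProduct_gram hz y)

theorem dotProduct_gram_le {z : ℝ} (hz : z < 0) (y : Fin 3 → ℝ) :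
    y ⬝ᵥ gram z *ᵥ y ≤ weight y / -z := by
  rw [dotProduct_gram z hz.le, ← avg_sq_sum_phi, div_eq_inv_mul, ← avg_const_mul]
  refine avg_mono (integrable_sq_sum_phi_div y hz.le) ((integrable_sq_sum_phi y).const_mul _)
    fun p => ?_
  rw [div_eq_inv_mul]
  have := dispersion_nonneg p
  gcongr
  · linarith
  · linarith

/-- Since E ≤ 8, the difference 1/(E - z') - 1/(E - z) is at least (z' - z)/((8 - z)(8 - z')). The
gain in the form is therefore at least this constant times the positive quantity `weight y`. -/
theorem dotProduct_gram_lt {z z' : ℝ} (h : z < z') (hz' : z' ≤ 0) {y : Fin 3 → ℝ} (hy : y ≠ 0) :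
    y ⬝ᵥ gram z *ᵥ y < y ⬝ᵥ gram z' *ᵥ y := by
  have hz : z ≤ 0 := h.le.trans hz'
  have h1 : 0 < (z' - z) / ((8 - z) * (8 - z')) * weight y :=
    mul_pos (div_pos (by linarith) (mul_pos (by linarith) (by linarith))) (weight_pos hy)
  have h2 : y ⬝ᵥ gram z *ᵥ y + (z' - z) / ((8 - z) * (8 - z')) * weight y ≤
      y ⬝ᵥ gram z' *ᵥ y := by
    rw [dotProduct_gram z hz, dotProduct_gram z' hz', ← avg_sq_sum_phi, ← avg_const_mul,
      ← avg_add (integrable_sq_sum_phi_div y hz) ((integrable_sq_sum_phi y).const_mul _)]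
    refine avg_mono ((integrable_sq_sum_phi_div y hz).add ((integrable_sq_sum_phi y).const_mul _))
      (integrable_sq_sum_phi_div y hz') fun p => ?_
    have hE := dispersion_nonneg p
    have hE8 := dispersion_le p
    rcases (sub_nonneg.2 (hz'.trans hE)).eq_or_lt with h | h
    · have h0 : dispersion p = 0 := by linarith
      have h1 : ∀ k, phi k p = 0 := fun k => by
        have := abs_phi_mul_phi_le k k p
        rw [h0, mul_zero] at this
        exact mul_self_eq_zero.1 (abs_eq_zero.1 (le_antisymm this (abs_nonneg _)))
      simp [h1]
    · have h3 : 0 < dispersion p - z := by linarith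
      have h4 : (∑ k, y k * phi k p) ^ 2 / (dispersion p - z') =
          (∑ k, y k * phi k p) ^ 2 / (dispersion p - z) +
            (z' - z) / ((dispersion p - z) * (dispersion p - z')) * (∑ k, y k * phi k p) ^ 2 := by
        field_simp
        ring
      rw [h4]
      gcongr
      linarith
  linarith

/-- The averages of `sin p₁ sin 2p₁` and `2 sin² p₁ cos p₂` with weight `1 / (𝓔₀ - z)` differ. -/
theorem gram_zero_one_lt {z : ℝ} (hz : z < 0) : gram z 0 1 < gram z 0 2 := by
  have hne : ∀ p, dispersion p - z ≠ 0 := fun p => by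
    have := dispersion_nonneg p
    linarith
  have hE : Continuous fun p => dispersion p := continuous_dispersion
  have hc := continuous_cosT
  have ha : 0 < 4 - z := by linarith
  set F : Torus → ℝ := fun p =>
    2 * (1 - cosT p.1 ^ 2) * (cosT p.2 - cosT p.1) / (dispersion p - z) with hF
  have hFc : Continuous F := by
    rw [hF]
    exact Continuous.div (by fun_prop) (by fun_prop) hne
  have h1 : gram z 0 2 - gram z 0 1 = avg F := by
    rw [gram_apply, gram_apply, ← avg_sub (integrable_gram_integrand 0 2 hz.le)
      (integrable_gram_integrand 0 1 hz.le)]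
    congr 1
    ext p
    rw [phi_mul_phi, phi_mul_phi, hF]
    simp [psi]
    ring
  -- F has no sign. Its symmetrization under p₁ ↔ p₂ has numerator 2(x - y)²(x + y), where x and y
  -- are the two cosines.
  have h2 : 2 * avg F = avg F + avg (fun p => F p.swap) := by
    rw [avg_swap]
    ring
  have hFs : Continuous fun p : Torus => F p.swap := hFc.comp continuous_swap
  rw [← avg_add (integrable_of_continuous hFc) (integrable_of_continuous hFs)] at h2
  -- With a = 4 - z and s = x + y, use s/(a - 2s) = s/a + 2s²/(a(a - 2s)). The first term
  -- contributes odd moments, which average to zero. The second gives 4(x² - y²)²/(a(a - 2s)), and a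
  -- - 2s ≤ 8 - z yields the lower bound P. The average of (x² - y²)² is 1/4.
  set P : C(Torus, ℝ) := (2 / (4 - z)) • (cosC₁ ^ 3 * cosC₂ ^ 0 + cosC₁ ^ 0 * cosC₂ ^ 3
    - cosC₁ ^ 2 * cosC₂ ^ 1 - cosC₁ ^ 1 * cosC₂ ^ 2) + (4 / ((4 - z) * (8 - z))) •
    (cosC₁ ^ 4 * cosC₂ ^ 0 + cosC₁ ^ 0 * cosC₂ ^ 4 - (2 : ℝ) • (cosC₁ ^ 2 * cosC₂ ^ 2)) with hP
  have h3 : avg P ≤ avg fun p => F p + F p.swap := by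
    refine avg_mono (integrable_of_continuous P.continuous)
      (integrable_of_continuous (hFc.add hFs)) fun p => ?_
    have e1 := cosT_mem_Icc p.1
    have e2 := cosT_mem_Icc p.2
    set x := cosT p.1
    set y := cosT p.2
    have hd : dispersion p = 4 - 2 * (x + y) := by
      rw [dispersion]
      ring
    have hds : dispersion p.swap = 4 - 2 * (x + y) := by
      rw [dispersion, Prod.fst_swap, Prod.snd_swap]
      ring
    have hpos : 0 < 4 - 2 * (x + y) - z := by linarith [e1.2, e2.2]
    have hPp : P p = 2 / (4 - z) * (x ^ 3 + y ^ 3 - x ^ 2 * y - x * y ^ 2) +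
        4 / ((4 - z) * (8 - z)) * (x ^ 4 + y ^ 4 - 2 * (x ^ 2 * y ^ 2)) := by
      rw [hP]
      simp [cosC₁, cosC₂, x, y]
    have hFp : F p + F p.swap = 2 / (4 - z) * (x ^ 3 + y ^ 3 - x ^ 2 * y - x * y ^ 2) +
        4 / ((4 - z) * (4 - 2 * (x + y) - z)) * (x ^ 4 + y ^ 4 - 2 * (x ^ 2 * y ^ 2)) := by
      simp only [hF, hd, hds, Prod.fst_swap, Prod.snd_swap]
      change 2 * (1 - x ^ 2) * (y - x) / _ + 2 * (1 - y ^ 2) * (x - y) / _ = _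
      field_simp
      ring
    rw [hPp, hFp]
    have : 0 ≤ x ^ 4 + y ^ 4 - 2 * (x ^ 2 * y ^ 2) := by nlinarith [sq_nonneg (x ^ 2 - y ^ 2)]
    gcongr
    linarith [e1.1, e2.1]
  have h4 : avg P = 4 / ((4 - z) * (8 - z)) * (1 / 4) := by
    rw [avg_eq_avgC P fun _ => rfl, hP]
    simp only [map_add, map_sub, map_smul, avgC_monomial, cosMoment_zero, cosMoment_one,
      cosMoment_two, cosMoment_three, cosMoment_four, smul_eq_mul]
    ring
  have h5 : 0 < avg P := by
    rw [h4]
    have : 0 < 8 - z := by linarith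
    positivity
  linarith

/-! ### Explicit values at the threshold -/

/-- This is the Poisson formula on the unit circle for the constant function 1, evaluated at the
real point r. -/
theorem integral_poisson {r : ℝ} (h0 : 0 ≤ r) (h1 : r < 1) :
    ∫ θ in (0 : ℝ)..2 * π, (1 - r ^ 2) / (1 + r ^ 2 - 2 * r * Real.cos θ) = 2 * π := by
  have h := DiffContOnCl.circleAverage_poissonKernel_smul' (f := fun _ : ℂ => (1 : ℂ)) (R := 1)
    (c := 0) (w := r) diffContOnCl_const (by simpa [abs_of_nonneg h0] using h1)
  rw [Real.circleAverage_def] at h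
  have h2 : ∀ θ : ℝ, ((‖circleMap 0 1 θ - 0‖ ^ 2 - ‖(r : ℂ) - 0‖ ^ 2) /
      ‖circleMap 0 1 θ - 0 - ((r : ℂ) - 0)‖ ^ 2) • (1 : ℂ) =
      (((1 - r ^ 2) / (1 + r ^ 2 - 2 * r * Real.cos θ) : ℝ) : ℂ) := by
    intro θ
    have h3 : ‖circleMap 0 1 θ - 0 - ((r : ℂ) - 0)‖ ^ 2 = 1 + r ^ 2 - 2 * r * Real.cos θ := by
      rw [← Complex.normSq_eq_norm_sq, Complex.normSq_apply]
      simp [circleMap, Complex.exp_ofReal_mul_I_re, Complex.exp_ofReal_mul_I_im]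
      linear_combination Real.sin_sq_add_cos_sq θ
    rw [h3]
    simp
  simp only [h2] at h
  rw [intervalIntegral.integral_ofReal, Complex.real_smul, ← Complex.ofReal_mul] at h
  have h4 : (2 * π)⁻¹ * ∫ θ in (0 : ℝ)..2 * π, (1 - r ^ 2) / (1 + r ^ 2 - 2 * r * Real.cos θ)
      = 1 := by exact_mod_cast h
  rw [inv_mul_eq_one₀ Real.two_pi_pos.ne'] at h4
  exact h4.symm

theorem integral_inv_sub_two_mul_cos {a : ℝ} (ha : 2 < a) :
    ∫ θ in (0 : ℝ)..2 * π, 1 / (a - 2 * Real.cos θ) = 2 * π / √(a ^ 2 - 4) := by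
  set s := √(a ^ 2 - 4) with hs
  have hpos : 0 < a ^ 2 - 4 := by nlinarith
  have hs0 : 0 < s := Real.sqrt_pos.2 hpos
  have hs2 : s ^ 2 = a ^ 2 - 4 := Real.sq_sqrt hpos.le
  -- The smaller root of r² - ar + 1 = 0. Then 1 + r² = ar, which makes the Poisson denominator
  -- proportional to a - 2 cos θ, and 1 - r² = rs.
  set r := (a - s) / 2 with hr
  have hsa : s < a := by nlinarith
  have has : a - 2 < s := by nlinarith
  have hr0 : 0 < r := by rw [hr]; linarith
  have hr1 : r < 1 := by rw [hr]; linarith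
  have hra : r ^ 2 = a * r - 1 := by rw [hr]; linear_combination hs2 / 4
  have h := integral_poisson hr0.le hr1
  have h2 : ∀ θ, (1 - r ^ 2) / (1 + r ^ 2 - 2 * r * Real.cos θ) =
      s * (1 / (a - 2 * Real.cos θ)) := by
    intro θ
    have hd : 1 + r ^ 2 - 2 * r * Real.cos θ = r * (a - 2 * Real.cos θ) := by
      rw [hra]
      ring
    have hn : 1 - r ^ 2 = r * s := by
      rw [hra, hr]
      linear_combination hs2 / 2
    have : a - 2 * Real.cos θ ≠ 0 := by
      have := Real.cos_le_one θ
      linarith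
    rw [hd, hn]
    field_simp
  simp only [h2, intervalIntegral.integral_const_mul] at h
  rw [eq_div_iff hs0.ne', mul_comm]
  exact h

/-- Substitute cos t = (1 - cos x)/2. Then 2(1 - cos t) = 1 + cos x and cos x = 1 - 2 cos t, so the
square roots disappear. The endpoints 0 and π go to π/2 and 0, and the constant 1/2 comes from the
derivative. -/
theorem integral_threshold_profile (k : ℕ) :
    ∫ x in (0 : ℝ)..π, (1 - Real.cos x ^ 2) * Real.cos x ^ k / √((4 - 2 * Real.cos x) ^ 2 - 4) =
      1 / 2 * ∫ t in (0 : ℝ)..π / 2, 2 * (1 - Real.cos t) * (1 - 2 * Real.cos t) ^ k := by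
  set g : ℝ → ℝ := fun t => 2 * (1 - Real.cos t) * (1 - 2 * Real.cos t) ^ k with hg
  have hgc : Continuous g := by
    rw [hg]
    fun_prop
  set h : ℝ → ℝ := fun x =>
    √(1 - Real.cos x) * ((1 + Real.cos x) * Real.cos x ^ k) / (2 * √(3 - Real.cos x)) with hh
  have h3 : ∀ x, 0 < √(3 - Real.cos x) := fun x =>
    Real.sqrt_pos.2 (by linarith [Real.cos_le_one x])
  have hhc : Continuous h := by
    rw [hh]
    exact Continuous.div (by fun_prop) (by fun_prop) fun x => by have := h3 x; positivity
  have h1 : ∀ x, (1 - Real.cos x ^ 2) * Real.cos x ^ k / √((4 - 2 * Real.cos x) ^ 2 - 4) = h x := by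
    intro x
    have e1 : 0 ≤ 1 - Real.cos x := by linarith [Real.cos_le_one x]
    have e2 : √((4 - 2 * Real.cos x) ^ 2 - 4) = 2 * (√(1 - Real.cos x) * √(3 - Real.cos x)) := by
      rw [← Real.sqrt_mul e1, show (4 - 2 * Real.cos x) ^ 2 - 4 =
        2 ^ 2 * ((1 - Real.cos x) * (3 - Real.cos x)) by ring, Real.sqrt_mul (by norm_num),
        Real.sqrt_sq (by norm_num)]
    have e3 : 1 - Real.cos x ^ 2 =
        √(1 - Real.cos x) * √(1 - Real.cos x) * (1 + Real.cos x) := by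
      rw [Real.mul_self_sqrt e1]
      ring
    rw [e2, e3, hh]
    have := h3 x
    rcases (Real.sqrt_nonneg (1 - Real.cos x)).eq_or_lt with h0 | h0
    · simp [← h0]
    · field_simp
  simp only [h1]
  set Ψ : ℝ → ℝ := fun u => ∫ t in (0 : ℝ)..u, g t with hΨ
  have hΨd : ∀ u, HasDerivAt Ψ (g u) u := fun u =>
    (hgc.integral_hasStrictDerivAt 0 u).hasDerivAt
  have hΨc : Continuous Ψ := continuous_iff_continuousAt.2 fun u => (hΨd u).continuousAt
  have key := intervalIntegral.integral_eq_sub_of_hasDerivAt_of_le (a := 0) (b := π) (f' := h)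
    (f := fun x => -(1 / 2) * Ψ (Real.arccos ((1 - Real.cos x) / 2))) Real.pi_pos.le
    (by
      have := Real.continuous_arccos
      exact Continuous.continuousOn (by fun_prop))
    (by
      intro x hx
      have hc1 : Real.cos x < 1 := by
        have := Real.cos_lt_cos_of_nonneg_of_le_pi le_rfl hx.2.le hx.1
        simpa using this
      have hc2 : -1 < Real.cos x := by
        have := Real.cos_lt_cos_of_nonneg_of_le_pi hx.1.le le_rfl hx.2
        simpa using this
      have hu : HasDerivAt (fun x => (1 - Real.cos x) / 2) (Real.sin x / 2) x := by
        have := ((Real.hasDerivAt_cos x).const_sub 1).div_const 2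
        simpa using this
      have hd := ((hΨd _).comp x ((Real.hasDerivAt_arccos (x := (1 - Real.cos x) / 2)
        (by linarith) (by linarith)).comp x hu)).const_mul (-(1 / 2))
      refine hd.congr_deriv ?_
      have e1 : 0 < 1 - Real.cos x := by linarith
      have e2 : 0 < 1 + Real.cos x := by linarith
      have e4 : √(1 - ((1 - Real.cos x) / 2) ^ 2) =
          √(1 + Real.cos x) * √(3 - Real.cos x) / 2 := by
        rw [← Real.sqrt_mul e2.le, show 1 - ((1 - Real.cos x) / 2) ^ 2 =
          (1 + Real.cos x) * (3 - Real.cos x) / 2 ^ 2 by ring, Real.sqrt_div' _ (by norm_num),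
          Real.sqrt_sq (by norm_num)]
      have e5 : Real.sin x = √(1 - Real.cos x) * √(1 + Real.cos x) := by
        rw [← Real.sqrt_mul e1.le, ← Real.sqrt_sq
          (Real.sin_pos_of_pos_of_lt_pi hx.1 hx.2).le, Real.sin_sq]
        congr 1
        ring
      have e6 := Real.sqrt_pos.2 e2
      have e7 := h3 x
      simp only [hg, Function.comp_apply]
      rw [Real.cos_arccos (by linarith) (by linarith), e4, e5, hh]
      field_simp
      ring)
    (hhc.intervalIntegrable _ _)
  rw [key]
  simp [Real.arccos_zero, hΨ]

theorem integral_threshold_circle (k : ℕ) :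
    ∫ x : AddCircle (2 * π), (1 - cosT x ^ 2) * cosT x ^ k / √((4 - 2 * cosT x) ^ 2 - 4) =
      ∫ t in (0 : ℝ)..π / 2, 2 * (1 - Real.cos t) * (1 - 2 * Real.cos t) ^ k := by
  rw [integral_addCircle]
  simp only [cosT_coe]
  set f : ℝ → ℝ := fun x =>
    (1 - Real.cos x ^ 2) * Real.cos x ^ k / √((4 - 2 * Real.cos x) ^ 2 - 4) with hf
  have h1 : ∫ x in π..2 * π, f x = ∫ x in (0 : ℝ)..π, f x := by
    have := intervalIntegral.integral_comp_sub_left f (a := 0) (b := π) (2 * π)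
    rw [show 2 * π - π = π by ring, sub_zero] at this
    rw [← this]
    simp [hf, Real.cos_two_pi_sub]
  have hm : Measurable f := by
    rw [hf]
    fun_prop
  have hb : ∀ x, ‖f x‖ ≤ 2 := by
    intro x
    have e0 := Real.cos_le_one x
    have e1 := Real.neg_one_le_cos x
    rw [hf, Real.norm_eq_abs, abs_div, abs_of_nonneg (Real.sqrt_nonneg _)]
    refine div_le_of_le_mul₀ (Real.sqrt_nonneg _) (by norm_num) ?_
    have e2 : |Real.cos x ^ k| ≤ 1 := by
      rw [abs_pow]
      exact pow_le_one₀ (abs_nonneg _) (Real.abs_cos_le_one x)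
    have e3 : |1 - Real.cos x ^ 2| ≤ 2 * (1 - Real.cos x) := by
      rw [abs_le]
      constructor <;> nlinarith
    have e4 : 1 - Real.cos x ≤ √((4 - 2 * Real.cos x) ^ 2 - 4) := by
      apply Real.le_sqrt_of_sq_le
      nlinarith
    rw [abs_mul]
    calc |1 - Real.cos x ^ 2| * |Real.cos x ^ k| ≤ 2 * (1 - Real.cos x) * 1 := by
          gcongr
      _ ≤ _ := by linarith
  have hi : ∀ a b, IntervalIntegrable f volume a b := fun a b =>
    (intervalIntegrable_const (c := (2 : ℝ))).mono_fun hm.aestronglyMeasurable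
      (Eventually.of_forall fun x => (hb x).trans (by norm_num))
  rw [← intervalIntegral.integral_add_adjacent_intervals (hi 0 π) (hi π (2 * π)), h1, hf,
    integral_threshold_profile]
  ring

theorem integral_threshold_fiber (k : ℕ) (x : AddCircle (2 * π)) :
    ∫ y : AddCircle (2 * π), (1 - cosT x ^ 2) * cosT x ^ k / (dispersion (x, y) - 0) =
      2 * π * ((1 - cosT x ^ 2) * cosT x ^ k / √((4 - 2 * cosT x) ^ 2 - 4)) := by
  -- For cos x = 1 the inner integral has no closed form of this kind, as a = 2 is excluded; there
  -- the factor 1 - cos² x makes both sides zero.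
  rcases (cosT_mem_Icc x).2.eq_or_lt with h | h
  · simp [h]
  · have e : ∀ y, (1 - cosT x ^ 2) * cosT x ^ k / (dispersion (x, y) - 0) =
        (1 - cosT x ^ 2) * cosT x ^ k * (1 / ((4 - 2 * cosT x) - 2 * cosT y)) := by
      intro y
      rw [dispersion, mul_one_div]
      congr 1
      ring
    simp only [e]
    rw [integral_const_mul, integral_addCircle]
    simp only [cosT_coe]
    rw [integral_inv_sub_two_mul_cos (by linarith)]
    ring

theorem avg_threshold (k : ℕ)
    (hi : Integrable fun p : Torus => (1 - cosT p.1 ^ 2) * cosT p.1 ^ k / (dispersion p - 0)) :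
    avg (fun p => (1 - cosT p.1 ^ 2) * cosT p.1 ^ k / (dispersion p - 0)) =
      (2 * π)⁻¹ * ∫ t in (0 : ℝ)..π / 2, 2 * (1 - Real.cos t) * (1 - 2 * Real.cos t) ^ k := by
  rw [avg, Measure.volume_eq_prod, integral_prod _ (by rwa [← Measure.volume_eq_prod])]
  simp only [integral_threshold_fiber]
  rw [integral_const_mul, integral_threshold_circle]
  have := Real.pi_pos
  field_simp

theorem integral_cos_pow_half_pi :
    (∫ t in (0 : ℝ)..π / 2, Real.cos t = 1) ∧ (∫ t in (0 : ℝ)..π / 2, Real.cos t ^ 2 = π / 4) ∧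
      ∫ t in (0 : ℝ)..π / 2, Real.cos t ^ 3 = 2 / 3 := by
  refine ⟨by simp, ?_, ?_⟩
  · rw [integral_cos_sq]
    simp
    ring
  · rw [integral_cos_pow_three]
    norm_num

theorem gram_zero_entries : gram 0 0 0 = 1 / 2 - 1 / π ∧ gram 0 0 1 = 2 - 6 / π ∧
    gram 0 1 1 = 10 - 92 / (3 * π) := by
  obtain ⟨c1, c2, c3⟩ := integral_cos_pow_half_pi
  have hi : ∀ f : ℝ → ℝ, Continuous f → IntervalIntegrable f volume 0 (π / 2) :=
    fun f hf => hf.intervalIntegrable _ _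
  have hpi := Real.pi_pos
  have hE := continuous_cosT
  have poly : ∀ a b c d : ℝ, ∫ t in (0 : ℝ)..π / 2,
      (a + b * Real.cos t + c * Real.cos t ^ 2 + d * Real.cos t ^ 3) =
      a * (π / 2) + b + c * (π / 4) + d * (2 / 3) := by
    intro a b c d
    rw [intervalIntegral.integral_add (hi _ (by fun_prop)) (hi _ (by fun_prop)),
      intervalIntegral.integral_add (hi _ (by fun_prop)) (hi _ (by fun_prop)),
      intervalIntegral.integral_add (hi _ (by fun_prop)) (hi _ (by fun_prop)),
      intervalIntegral.integral_const_mul, intervalIntegral.integral_const_mul,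
      intervalIntegral.integral_const_mul, c1, c2, c3]
    simp
    ring
  have red : ∀ (i j : Fin 3) (k : ℕ) (c : ℝ), c ≠ 0 →
      (∀ p, psi i p * psi j p = c * cosT p.1 ^ k) → gram 0 i j =
      c * ((2 * π)⁻¹ * ∫ t in (0 : ℝ)..π / 2, 2 * (1 - Real.cos t) * (1 - 2 * Real.cos t) ^ k) := by
    intro i j k c hc h
    have e : ∀ p, phi i p * phi j p / (dispersion p - 0) =
        c * ((1 - cosT p.1 ^ 2) * cosT p.1 ^ k / (dispersion p - 0)) := by
      intro p
      rw [phi_mul_phi, h]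
      ring
    rw [gram_apply, funext e, avg_const_mul, avg_threshold]
    have h1 := integrable_gram_integrand i j (le_refl 0)
    rw [funext e] at h1
    have h2 := h1.const_mul c⁻¹
    simpa [hc] using h2
  refine ⟨?_, ?_, ?_⟩
  · rw [red 0 0 0 1 one_ne_zero (by intro p; simp [psi]), show (fun t : ℝ => 2 * (1 - Real.cos t) *
      (1 - 2 * Real.cos t) ^ 0) = fun t => 2 + (-2) * Real.cos t + 0 * Real.cos t ^ 2 +
      0 * Real.cos t ^ 3 by ext t; ring, poly]
    field_simp
    ring
  · rw [red 0 1 1 2 two_ne_zero (by intro p; simp [psi]), show (fun t : ℝ => 2 * (1 - Real.cos t) *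
      (1 - 2 * Real.cos t) ^ 1) = fun t => 2 + (-6) * Real.cos t + 4 * Real.cos t ^ 2 +
      0 * Real.cos t ^ 3 by ext t; ring, poly]
    field_simp
    ring
  · rw [red 1 1 2 4 four_ne_zero (by intro p; simp [psi]; ring), show (fun t : ℝ =>
      2 * (1 - Real.cos t) * (1 - 2 * Real.cos t) ^ 2) = fun t => 2 + (-10) * Real.cos t +
      16 * Real.cos t ^ 2 + (-8) * Real.cos t ^ 3 by ext t; ring, poly]
    field_simp
    ring

/-! ### The reduced matrix -/

/-- The matrix `G(z)⁻¹ + diag(λ, μ, μ)`, whose kernel describes the eigenvectors for `z`. -/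
def redMatrix (l m z : ℝ) : Matrix (Fin 3) (Fin 3) ℝ :=
  (gram z)⁻¹ + Matrix.diagonal ![l, m, m]

theorem gram_transpose (z : ℝ) : (gram z)ᵀ = gram z := by
  ext i j
  exact gram_symm z j i

theorem redMatrix_isHermitian (l m z : ℝ) : (redMatrix l m z).IsHermitian := by
  rw [Matrix.IsHermitian, Matrix.conjTranspose_eq_transpose_of_trivial, redMatrix,
    Matrix.transpose_add, Matrix.transpose_nonsing_inv, gram_transpose, Matrix.diagonal_transpose]

theorem det_gram_ne_zero {z : ℝ} (hz : z ≤ 0) : (gram z).det ≠ 0 := by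
  intro h
  obtain ⟨v, hv, h0⟩ := Matrix.exists_mulVec_eq_zero_iff.2 h
  have := gram_pos hz hv
  rw [h0, dotProduct_zero] at this
  exact lt_irrefl _ this

theorem gram_mul_inv {z : ℝ} (hz : z ≤ 0) : gram z * (gram z)⁻¹ = 1 :=
  Matrix.mul_nonsing_inv _ (det_gram_ne_zero hz).isUnit

theorem gram_inv_mul {z : ℝ} (hz : z ≤ 0) : (gram z)⁻¹ * gram z = 1 :=
  Matrix.nonsing_inv_mul _ (det_gram_ne_zero hz).isUnit

theorem gram_mulVec_inv {z : ℝ} (hz : z ≤ 0) (x : Fin 3 → ℝ) :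
    gram z *ᵥ ((gram z)⁻¹ *ᵥ x) = x := by
  rw [Matrix.mulVec_mulVec, gram_mul_inv hz, Matrix.one_mulVec]

theorem gram_dotProduct_comm (z : ℝ) (x y : Fin 3 → ℝ) :
    x ⬝ᵥ gram z *ᵥ y = y ⬝ᵥ gram z *ᵥ x := by
  rw [Matrix.dotProduct_mulVec, ← Matrix.mulVec_transpose, gram_transpose, dotProduct_comm]

theorem gram_nonneg {z : ℝ} (hz : z ≤ 0) (y : Fin 3 → ℝ) : 0 ≤ y ⬝ᵥ gram z *ᵥ y := by
  by_cases h : y = 0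
  · simp [h]
  · exact (gram_pos hz h).le

/-- The variational lower bound for the inverse Gram form. -/
theorem le_dotProduct_gram_inv {z : ℝ} (hz : z ≤ 0) (x y : Fin 3 → ℝ) :
    2 * (y ⬝ᵥ x) - y ⬝ᵥ gram z *ᵥ y ≤ x ⬝ᵥ (gram z)⁻¹ *ᵥ x := by
  set u := (gram z)⁻¹ *ᵥ x with hu
  have hx : x = gram z *ᵥ u := (gram_mulVec_inv hz x).symm
  have h := gram_nonneg hz (u - y)
  rw [Matrix.mulVec_sub, dotProduct_sub, sub_dotProduct, sub_dotProduct,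
    gram_dotProduct_comm z u y, ← hx] at h
  rw [dotProduct_comm x u]
  linarith

/-- Inversion reverses the order. The vector `y` maximizing the variational expression at z' gives a
strictly larger value of that expression at z, where `le_dotProduct_gram_inv` bounds it by the
inverse form. -/
theorem dotProduct_gram_inv_lt {z z' : ℝ} (h : z < z') (hz' : z' ≤ 0) {x : Fin 3 → ℝ}
    (hx : x ≠ 0) : x ⬝ᵥ (gram z')⁻¹ *ᵥ x < x ⬝ᵥ (gram z)⁻¹ *ᵥ x := by
  have hz : z ≤ 0 := h.le.trans hz'
  set y := (gram z')⁻¹ *ᵥ x with hy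
  have hxy : gram z' *ᵥ y = x := gram_mulVec_inv hz' x
  have hy0 : y ≠ 0 := by
    intro h0
    rw [h0, Matrix.mulVec_zero] at hxy
    exact hx hxy.symm
  have h1 := le_dotProduct_gram_inv hz x y
  have h2 := dotProduct_gram_lt h hz' hy0
  rw [hxy] at h2
  rw [dotProduct_comm x y]
  linarith

theorem dotProduct_redMatrix (l m z : ℝ) (x : Fin 3 → ℝ) : x ⬝ᵥ redMatrix l m z *ᵥ x =
    x ⬝ᵥ (gram z)⁻¹ *ᵥ x + (l * x 0 ^ 2 + m * x 1 ^ 2 + m * x 2 ^ 2) := by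
  rw [redMatrix, Matrix.add_mulVec, dotProduct_add]
  congr 1
  simp [dotProduct, Matrix.mulVec_diagonal, Fin.sum_univ_three]
  ring

theorem redMatrix_lt {l m z z' : ℝ} (h : z < z') (hz' : z' ≤ 0) {x : Fin 3 → ℝ}
    (hx : x ≠ 0) : x ⬝ᵥ redMatrix l m z' *ᵥ x < x ⬝ᵥ redMatrix l m z *ᵥ x := by
  rw [dotProduct_redMatrix, dotProduct_redMatrix]
  linarith [dotProduct_gram_inv_lt h hz' hx]

/-- At z = -c the Gram form is at most weight/c. The test vector c·x in the variational bound then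
gives an inverse form of at least c|x|², and c exceeds both |λ| and |μ|. -/
theorem redMatrix_nonneg (l m : ℝ) (x : Fin 3 → ℝ) :
    0 ≤ x ⬝ᵥ redMatrix l m (-(|l| + |m| + 1)) *ᵥ x := by
  set c := |l| + |m| + 1 with hc
  have hl := abs_nonneg l
  have hm := abs_nonneg m
  have hc0 : 0 < c := by linarith
  have h1 := le_dotProduct_gram_inv (z := -c) (by linarith) x (c • x)
  have h2 := dotProduct_gram_le (z := -c) (by linarith) (c • x)
  have h3 : weight (c • x) / - -c = c * weight x := by
    simp only [weight, Pi.smul_apply, smul_eq_mul]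
    field_simp
  rw [h3] at h2
  have h4 : (c • x) ⬝ᵥ x = c * (x 0 ^ 2 + x 1 ^ 2 + x 2 ^ 2) := by
    simp [dotProduct, Fin.sum_univ_three]
    ring
  rw [h4] at h1
  rw [dotProduct_redMatrix]
  unfold weight at h2
  have hl' : -l ≤ c := by linarith [neg_le_abs l]
  have hm' : -m ≤ c := by linarith [neg_le_abs m]
  nlinarith [mul_le_mul_of_nonneg_right hl' (sq_nonneg (x 0)),
    mul_le_mul_of_nonneg_right hm' (sq_nonneg (x 1)),
    mul_le_mul_of_nonneg_right hm' (sq_nonneg (x 2)), mul_nonneg hc0.le (sq_nonneg (x 0)),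
    mul_nonneg hc0.le (sq_nonneg (x 1)), mul_nonneg hc0.le (sq_nonneg (x 2))]

theorem continuousOn_redMatrix (l m : ℝ) : ContinuousOn (redMatrix l m) (Set.Iic 0) := by
  have h1 : ContinuousOn (fun z => (gram z).det) (Set.Iic 0) :=
    (continuous_id.matrix_det).comp_continuousOn continuousOn_gram
  have h2 : ContinuousOn (fun z => (gram z).adjugate) (Set.Iic 0) :=
    (continuous_id.matrix_adjugate).comp_continuousOn continuousOn_gram
  have h3 : ContinuousOn (fun z => (gram z)⁻¹) (Set.Iic 0) := by
    simp only [Matrix.inv_def, Ring.inverse_eq_inv']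
    exact (h1.inv₀ fun z hz => det_gram_ne_zero hz).smul h2
  exact h3.add continuousOn_const

/-- The relations of `gram_relation` for all rows say that G(z) maps (2(4 - z), -2, -2) to the first
basis vector; by symmetry this column of G⁻¹ is also its first row. -/
theorem gram_inv_apply_zero {z : ℝ} (hz : z ≤ 0) (j : Fin 3) :
    (gram z)⁻¹ 0 j = (![2 * (4 - z), -2, -2] : Fin 3 → ℝ) j := by
  have h : gram z *ᵥ ![2 * (4 - z), -2, -2] = Pi.single 0 1 := by
    ext i
    have := gram_relation hz i
    simp only [Matrix.mulVec, dotProduct, Fin.sum_univ_three, Matrix.cons_val]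
    rw [Pi.single_apply]
    split_ifs at this ⊢ <;> linarith
  have h2 : (gram z)⁻¹ *ᵥ (gram z *ᵥ ![2 * (4 - z), -2, -2]) = ![2 * (4 - z), -2, -2] := by
    rw [Matrix.mulVec_mulVec, gram_inv_mul hz, Matrix.one_mulVec]
  rw [h, Matrix.mulVec_single_one] at h2
  have h3 : ((gram z)⁻¹)ᵀ = (gram z)⁻¹ := by
    rw [Matrix.transpose_nonsing_inv, gram_transpose]
  rw [← h3]
  exact congrFun h2 j

theorem gram_mul_redMatrix {l m z : ℝ} (hz : z ≤ 0) :
    gram z * redMatrix l m z = 1 + gram z * Matrix.diagonal ![l, m, m] := by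
  rw [redMatrix, mul_add, gram_mul_inv hz]

/-- A kernel vector of the reduced matrix is determined by its first component. -/
theorem eq_zero_of_redMatrix_mulVec_eq_zero {l m z : ℝ} (hz : z < 0) {x : Fin 3 → ℝ}
    (hx : redMatrix l m z *ᵥ x = 0) (h0 : x 0 = 0) : x = 0 := by
  -- When x₀ = 0, the known first row of G⁻¹ reduces this equation to x₁ + x₂ = 0.
  have h1 := congrFun hx 0
  rw [redMatrix, Matrix.add_mulVec, Pi.add_apply, Matrix.mulVec_diagonal, h0] at h1
  simp only [Matrix.mulVec, dotProduct, Fin.sum_univ_three, gram_inv_apply_zero hz.le,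
    Matrix.cons_val, h0, Pi.zero_apply, mul_zero, zero_add, add_zero] at h1
  have h2 : (1 + gram z * Matrix.diagonal ![l, m, m]) *ᵥ x = 0 := by
    rw [← gram_mul_redMatrix hz.le, ← Matrix.mulVec_mulVec, hx, Matrix.mulVec_zero]
  rw [Matrix.add_mulVec, Matrix.one_mulVec, ← Matrix.mulVec_mulVec] at h2
  have h3 : ∀ i, x i + (gram z i 1 * (m * x 1) + gram z i 2 * (m * x 2)) = 0 := by
    intro i
    have := congrFun h2 i
    simpa [Matrix.mulVec, dotProduct, Fin.sum_univ_three, Matrix.mulVec_diagonal, h0,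
      Matrix.diagonal_apply, mul_assoc] using this
  have h4 : x 2 = -x 1 := by linarith
  have hx1 : x 1 = 0 := by
    have h5 := h3 0
    rw [h0, h4] at h5
    -- Row 0 of (1 + GD)x = 0. The product μx₁ is kept whole because μ may vanish; once it is zero,
    -- row 1 gives x₁ = 0.
    have h6 : m * x 1 * (gram z 0 2 - gram z 0 1) = 0 := by linarith
    rcases mul_eq_zero.1 h6 with h7 | h7
    · have h8 := h3 1
      rw [h4] at h8
      linear_combination h8 + (gram z 1 2 - gram z 1 1) * h7
    · exact absurd h7 (sub_pos.2 (gram_zero_one_lt hz)).ne'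
  ext i
  fin_cases i
  · exact h0
  · exact hx1
  · exact h4.trans (by rw [hx1, neg_zero]; rfl)

theorem finrank_ker_redMatrix_le {l m z : ℝ} (hz : z < 0) :
    Module.finrank ℝ (LinearMap.ker (redMatrix l m z).mulVecLin) ≤ 1 := by
  have h := LinearMap.finrank_le_finrank_of_injective
    (f := (LinearMap.proj (0 : Fin 3) : (Fin 3 → ℝ) →ₗ[ℝ] ℝ).comp
      (LinearMap.ker (redMatrix l m z).mulVecLin).subtype) (by
    rw [← LinearMap.ker_eq_bot, LinearMap.ker_eq_bot']
    rintro ⟨x, hx⟩ h0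
    exact Subtype.ext (eq_zero_of_redMatrix_mulVec_eq_zero hz hx h0))
  simpa using h

/-- The index of the threshold matrix. -/
def redIndex (l m : ℝ) : ℕ := (redMatrix_isHermitian l m 0).negIndex

theorem exists_det_redMatrix_eq_zero (l m : ℝ) :
    ∃ Z : Fin (redIndex l m) → ℝ, StrictMono Z ∧ (∀ j, Z j < 0) ∧
      ∀ z < 0, (redMatrix l m z).det = 0 ↔ z ∈ Set.range Z :=
  Matrix.exists_strictMono_range_det_eq_zero (redMatrix_isHermitian l m)
    (continuousOn_redMatrix l m) (fun _ _ h h' _ hx => redMatrix_lt h h' hx)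
    (by have := abs_nonneg l; have := abs_nonneg m; linarith) (redMatrix_nonneg l m)
    fun _ hz => finrank_ker_redMatrix_le hz

/-! ### The threshold matrix -/

/-- Up to constant factors, this is the common denominator of the lower block of G(0)⁻¹ and of the
numbers μ₀±, μ₁±. The bounds 3.14 < π < 3.15 are sharp enough. -/
theorem threshold_denominator_pos : 0 < 30 * π - 3 * π ^ 2 - 64 := by
  nlinarith [Real.pi_gt_d2, Real.pi_lt_d2]

/-- Only three entries require integration. The lattice relation at z = 0, read row by row, gives
the others. -/
theorem gram_zero_eq : gram 0 = !![1 / 2 - 1 / π, 2 - 6 / π, 2 / π - 1 / 2;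
    2 - 6 / π, 10 - 92 / (3 * π), -2 + 20 / (3 * π);
    2 / π - 1 / 2, -2 + 20 / (3 * π), 4 / (3 * π)] := by
  obtain ⟨h1, h2, h3⟩ := gram_zero_entries
  have r0 := gram_relation (le_refl 0) 0
  have r1 := gram_relation (le_refl 0) 1
  have r2 := gram_relation (le_refl 0) 2
  have s1 := gram_symm 0 0 1
  have s2 := gram_symm 0 0 2
  have s3 := gram_symm 0 1 2
  simp only [if_true, Fin.isValue, one_ne_zero, if_false, Fin.reduceEq] at r0 r1 r2
  have hp := Real.pi_ne_zero
  have e1 : gram 0 0 2 = 2 / π - 1 / 2 := by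
    rw [h1, h2] at r0
    field_simp at r0 ⊢
    linarith
  have e2 : gram 0 1 2 = -2 + 20 / (3 * π) := by
    rw [← s1, h2, h3] at r1
    field_simp at r1 ⊢
    linarith
  have e3 : gram 0 2 2 = 4 / (3 * π) := by
    rw [← s2, ← s3, e1, e2] at r2
    field_simp at r2 ⊢
    linarith
  ext i j
  fin_cases i <;> fin_cases j <;> simp [h1, h2, h3, e1, e2, e3, ← s1, ← s2, ← s3]

/-- The first diagonal entry of the lower block of `G(0)⁻¹`. -/
def blockP : ℝ := (32 * π - 3 * π ^ 2 - 64) / (2 * (30 * π - 3 * π ^ 2 - 64))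

/-- The off-diagonal entry of the lower block of `G(0)⁻¹`. -/
def blockQ : ℝ := (10 * π - 32) / (30 * π - 3 * π ^ 2 - 64)

/-- The last entry of the lower block of `G(0)⁻¹`. -/
def blockR : ℝ := (6 * π ^ 2 - 8 * π - 32) / (30 * π - 3 * π ^ 2 - 64)

theorem gram_zero_inv : (gram 0)⁻¹ = !![8, -2, -2; -2, blockP, blockQ; -2, blockQ, blockR] := by
  apply Matrix.inv_eq_right_inv
  have hp := Real.pi_ne_zero
  have hd := threshold_denominator_pos.ne'
  rw [gram_zero_eq, blockP, blockQ, blockR]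
  set d := 30 * π - 3 * π ^ 2 - 64 with hdd
  ext i j
  fin_cases i <;> fin_cases j <;>
    simp [Matrix.mul_apply, Fin.sum_univ_three] <;> field_simp <;> (try rw [hdd]) <;> ring

theorem redMatrix_zero (l m : ℝ) : redMatrix l m 0 =
    !![8 + l, -2, -2; -2, blockP + m, blockQ; -2, blockQ, blockR + m] := by
  rw [redMatrix, gram_zero_inv]
  ext i j
  fin_cases i <;> fin_cases j <;> simp

theorem blockQ_neg : blockQ < 0 :=
  div_neg_of_neg_of_pos (by linarith [Real.pi_lt_d2]) threshold_denominator_pos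

theorem blockP_ne_blockR : blockP ≠ blockR := by
  have hd := threshold_denominator_pos
  rw [blockP, blockR, Ne, div_eq_div_iff (by positivity) hd.ne']
  intro h
  have h2 : (30 * π - 3 * π ^ 2 - 64) * (3 * π * (16 - 5 * π)) = 0 := by linear_combination h
  have h3 : 3 * π * (16 - 5 * π) ≠ 0 :=
    mul_ne_zero (by have := Real.pi_pos; positivity) (by linarith [Real.pi_lt_d2])
  exact mul_ne_zero hd.ne' h3 h2

/-- Together with `mu1_mul` this is Vieta's theorem: -μ₁± are the eigenvalues of the block with
entries `blockP`, `blockQ`, `blockR`. -/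
theorem mu1_add : mu1p + mu1m = -(blockP + blockR) := by
  have hd := threshold_denominator_pos.ne'
  rw [mu1p, mu1m, blockP, blockR,
    show 120 * π - 12 * π ^ 2 - 256 = 4 * (30 * π - 3 * π ^ 2 - 64) by ring]
  field_simp
  ring

theorem mu1_mul : mu1p * mu1m = blockP * blockR - blockQ ^ 2 := by
  have hd := threshold_denominator_pos.ne'
  rw [mu1p, mu1m, blockP, blockQ, blockR,
    show 120 * π - 12 * π ^ 2 - 256 = 4 * (30 * π - 3 * π ^ 2 - 64) by ring,
    div_mul_div_comm, ← sq_sub_sq, Real.sq_sqrt]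
  · field_simp
    ring
  -- The radicand factors as (16 - 5π)²(9π² + 64).
  · nlinarith [mul_nonneg (sq_nonneg (16 - 5 * π)) (by positivity : 0 ≤ 9 * π ^ 2 + 64)]

theorem mu1m_le_mu1p : mu1m ≤ mu1p := by
  have hd := threshold_denominator_pos
  rw [mu1p, mu1m,
    show 120 * π - 12 * π ^ 2 - 256 = 4 * (30 * π - 3 * π ^ 2 - 64) by ring]
  gcongr
  have := Real.sqrt_nonneg (225 * π ^ 4 - 1440 * π ^ 3 + 3904 * π ^ 2 - 10240 * π + 16384)
  linarith

/-- Together with `mu0_mul` this is Vieta's theorem for the threshold determinant at λ = 0, a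
quadratic in μ with leading coefficient 8 and roots μ₀±. -/
theorem mu0_add : mu0p + mu0m = -(blockP + blockR - 1) := by
  have hd := threshold_denominator_pos.ne'
  rw [mu0p, mu0m, blockP, blockR,
    show 240 * π - 24 * π ^ 2 - 512 = 8 * (30 * π - 3 * π ^ 2 - 64) by ring]
  set d := 30 * π - 3 * π ^ 2 - 64 with hdd
  field_simp
  rw [hdd]
  ring

theorem mu0_mul : mu0p * mu0m =
    blockP * blockR - blockQ ^ 2 - (blockP + blockR) / 2 + blockQ := by
  have hd := threshold_denominator_pos.ne'
  rw [mu0p, mu0m, blockP, blockQ, blockR,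
    show 240 * π - 24 * π ^ 2 - 512 = 8 * (30 * π - 3 * π ^ 2 - 64) by ring,
    mul_mul_mul_comm, div_mul_div_comm, ← sq_sub_sq, Real.sq_sqrt]
  · field_simp
    ring
  -- Completing the square: 1044 times the radicand is (1044π - 3360)² + 2304.
  · nlinarith [sq_nonneg (1044 * π - 3360)]

theorem block_det (m : ℝ) :
    (blockP + m) * (blockR + m) - blockQ ^ 2 = (m - mu1p) * (m - mu1m) := by
  linear_combination (-1) * mu1_mul + m * mu1_add

theorem det_redMatrix_zero (l m : ℝ) : (redMatrix l m 0).det =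
    l * ((m - mu1p) * (m - mu1m)) + 8 * (m - mu0p) * (m - mu0m) := by
  rw [redMatrix_zero, Matrix.det_fin_three]
  simp only [Matrix.of_apply, Matrix.cons_val', Matrix.cons_val]
  linear_combination (8 + l) * block_det m - 8 * m * mu1_add + 8 * mu1_mul + 8 * m * mu0_add -
    8 * mu0_mul

/-! ### The index of the threshold matrix in the regions of the plane -/

/-- The quadratic form of the lower block of the threshold matrix. -/
def blockForm (m x y : ℝ) : ℝ :=
  (blockP + m) * x ^ 2 + 2 * blockQ * (x * y) + (blockR + m) * y ^ 2

theorem dotProduct_redMatrix_zero {l m : ℝ} {x : Fin 3 → ℝ} (hx : x 0 = 0) :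
    x ⬝ᵥ redMatrix l m 0 *ᵥ x = blockForm m (x 1) (x 2) := by
  rw [redMatrix_zero, blockForm]
  simp [Matrix.mulVec, dotProduct, Fin.sum_univ_three, hx]
  ring

/-- The shifted block has eigenvalues μ - μ₁⁺ and μ - μ₁⁻. In elementary terms, trace and
determinant make the first diagonal entry positive, and completing the square does the rest. -/
theorem blockForm_nonneg {m : ℝ} (h : mu1p ≤ m) (x y : ℝ) : 0 ≤ blockForm m x y := by
  have hle := mu1m_le_mu1p
  have hdet := block_det m
  have hdet0 : 0 ≤ (m - mu1p) * (m - mu1m) := mul_nonneg (by linarith) (by linarith)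
  have htr : 0 ≤ (blockP + m) + (blockR + m) := by linarith [mu1_add]
  have hq := blockQ_neg
  have hpr : 0 < (blockP + m) * (blockR + m) := by nlinarith [mul_pos_of_neg_of_neg hq hq]
  have hP : 0 < blockP + m := by
    by_contra hc
    nlinarith [not_lt.1 hc]
  have : 0 ≤ (blockP + m) * blockForm m x y := by
    have : (blockP + m) * blockForm m x y = ((blockP + m) * x + blockQ * y) ^ 2 +
        (m - mu1p) * (m - mu1m) * y ^ 2 := by
      rw [← hdet, blockForm]
      ring
    rw [this]
    positivity
  exact nonneg_of_mul_nonneg_right this hP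

theorem blockForm_neg {m : ℝ} (h : m < mu1m) {x y : ℝ} (hxy : x ≠ 0 ∨ y ≠ 0) :
    blockForm m x y < 0 := by
  have hle := mu1m_le_mu1p
  have hdet := block_det m
  have hdet0 : 0 < (m - mu1p) * (m - mu1m) := mul_pos_of_neg_of_neg (by linarith) (by linarith)
  have htr : (blockP + m) + (blockR + m) < 0 := by linarith [mu1_add]
  have hpr : 0 < (blockP + m) * (blockR + m) := by nlinarith [sq_nonneg blockQ]
  have hP : blockP + m < 0 := by
    by_contra hc
    nlinarith [not_lt.1 hc]
  have h1 : (blockP + m) * blockForm m x y = ((blockP + m) * x + blockQ * y) ^ 2 +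
      (m - mu1p) * (m - mu1m) * y ^ 2 := by
    rw [← hdet, blockForm]
    ring
  have : 0 < (blockP + m) * blockForm m x y := by
    rw [h1]
    by_cases hy : y = 0
    · subst hy
      have hx : x ≠ 0 := by simpa using hxy
      have := sq_pos_of_ne_zero (mul_ne_zero hP.ne hx)
      linarith
    · positivity
  by_contra hc
  exact absurd this (not_lt.2 (mul_nonpos_of_nonpos_of_nonneg hP.le (not_lt.1 hc)))

/-- For e = μ₁± the vector (Q, -e - P) is an eigenvector of the block with eigenvalue -e; it is
nonzero because Q < 0. It serves as trial vector for the one-dimensional index bounds. -/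
theorem blockForm_eigenvector {m e : ℝ} (he : (e - mu1p) * (e - mu1m) = 0) :
    blockForm m blockQ (-e - blockP) = (m - e) * (blockQ ^ 2 + (-e - blockP) ^ 2) := by
  have := block_det e
  rw [he] at this
  rw [blockForm]
  linear_combination (e + blockP) * this

theorem finrank_ker_proj :
    Module.finrank ℝ (LinearMap.ker (LinearMap.proj (0 : Fin 3) : (Fin 3 → ℝ) →ₗ[ℝ] ℝ)) = 2 := by
  have h := LinearMap.finrank_range_add_finrank_ker
    (LinearMap.proj (0 : Fin 3) : (Fin 3 → ℝ) →ₗ[ℝ] ℝ)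
  rw [LinearMap.range_eq_top.2 (LinearMap.proj_surjective _)] at h
  simp at h
  omega

/-- The form is nonnegative on the plane x₀ = 0, which leaves room for at most one negative
direction whatever λ is. -/
theorem redIndex_le_one (l : ℝ) {m : ℝ} (h : mu1p ≤ m) : redIndex l m ≤ 1 := by
  have := (redMatrix_isHermitian l m 0).finrank_add_negIndex_le
    (W := LinearMap.ker (LinearMap.proj (0 : Fin 3) : (Fin 3 → ℝ) →ₗ[ℝ] ℝ)) fun x hx => by
      rw [dotProduct_redMatrix_zero hx]
      exact blockForm_nonneg h _ _
  rw [finrank_ker_proj, Fintype.card_fin] at this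
  unfold redIndex
  omega

theorem two_le_redIndex (l : ℝ) {m : ℝ} (h : m < mu1m) : 2 ≤ redIndex l m := by
  have := (redMatrix_isHermitian l m 0).finrank_le_negIndex
    (W := LinearMap.ker (LinearMap.proj (0 : Fin 3) : (Fin 3 → ℝ) →ₗ[ℝ] ℝ)) fun x hx hne => by
      rw [dotProduct_redMatrix_zero hx]
      refine blockForm_neg h ?_
      by_contra! hc
      apply hne
      ext i
      fin_cases i
      · exact hx
      · exact hc.1
      · exact hc.2
  rwa [finrank_ker_proj] at this

theorem dotProduct_redMatrix_eigenvector {l m e : ℝ} (he : (e - mu1p) * (e - mu1m) = 0) (c : ℝ) :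
    (c • ![0, blockQ, -e - blockP]) ⬝ᵥ redMatrix l m 0 *ᵥ (c • ![0, blockQ, -e - blockP]) =
      c ^ 2 * ((m - e) * (blockQ ^ 2 + (-e - blockP) ^ 2)) := by
  rw [← blockForm_eigenvector he, dotProduct_redMatrix_zero (by simp), blockForm, blockForm]
  simp
  ring

theorem eigenvector_ne_zero (e : ℝ) : (![0, blockQ, -e - blockP] : Fin 3 → ℝ) ≠ 0 := by
  intro h
  have := congrFun h 1
  exact blockQ_neg.ne this

theorem one_le_redIndex (l : ℝ) {m : ℝ} (h : m < mu1p) : 1 ≤ redIndex l m := by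
  have hq := blockQ_neg.ne
  have := (redMatrix_isHermitian l m 0).finrank_le_negIndex
    (W := Submodule.span ℝ {![0, blockQ, -mu1p - blockP]}) fun x hx hne => by
      obtain ⟨c, rfl⟩ := Submodule.mem_span_singleton.1 hx
      rw [dotProduct_redMatrix_eigenvector (by simp)]
      have hc : c ≠ 0 := by
        rintro rfl
        simp at hne
      refine mul_neg_of_pos_of_neg (by positivity) (mul_neg_of_neg_of_pos (by linarith) ?_)
      positivity
  rwa [finrank_span_singleton (eigenvector_ne_zero _)] at this

theorem redIndex_le_two (l : ℝ) {m : ℝ} (h : mu1m ≤ m) : redIndex l m ≤ 2 := by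
  have := (redMatrix_isHermitian l m 0).finrank_add_negIndex_le
    (W := Submodule.span ℝ {![0, blockQ, -mu1m - blockP]}) fun x hx => by
      obtain ⟨c, rfl⟩ := Submodule.mem_span_singleton.1 hx
      rw [dotProduct_redMatrix_eigenvector (by simp)]
      exact mul_nonneg (sq_nonneg _) (mul_nonneg (by linarith) (by positivity))
  rw [finrank_span_singleton (eigenvector_ne_zero _), Fintype.card_fin] at this
  unfold redIndex
  omega

theorem redIndex_le_three (l m : ℝ) : redIndex l m ≤ 3 := by
  have := (redMatrix_isHermitian l m 0).finrank_add_negIndex_le (W := ⊥) fun x hx => by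
    rw [(Submodule.mem_bot ℝ).1 hx]
    simp
  rw [Fintype.card_fin] at this
  unfold redIndex
  omega

theorem even_redIndex {l m : ℝ} (h : 0 < (redMatrix l m 0).det) : Even (redIndex l m) :=
  ((redMatrix_isHermitian l m 0).even_negIndex_iff h.ne').2 h

theorem odd_redIndex {l m : ℝ} (h : (redMatrix l m 0).det < 0) : Odd (redIndex l m) := by
  rw [← Nat.not_even_iff_odd]
  intro he
  exact absurd (((redMatrix_isHermitian l m 0).even_negIndex_iff h.ne).1 he) (not_lt.2 h.le)

theorem det_redMatrix_zero_eq_mul {l m : ℝ} (h : (m - mu1p) * (m - mu1m) ≠ 0) :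
    (redMatrix l m 0).det = (m - mu1p) * (m - mu1m) * (l - curveMinus m) := by
  rw [det_redMatrix_zero, curveMinus, sub_neg_eq_add, mul_add, mul_div_cancel₀ _ h]
  ring

theorem mu1_sub_sq : (mu1p - mu1m) ^ 2 = (blockP - blockR) ^ 2 + (2 * blockQ) ^ 2 := by
  linear_combination (mu1p + mu1m - (blockP + blockR)) * mu1_add - 4 * mu1_mul

/-- The squared gap between the block eigenvalues is (P - R)² + 4Q², and P ≠ R makes the inequality
strict. -/
theorem neg_two_mul_blockQ_lt : 2 * -blockQ < mu1p - mu1m := by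
  have h1 := mu1_sub_sq
  have h2 : 0 < (blockP - blockR) ^ 2 := by
    have := sub_ne_zero.2 blockP_ne_blockR
    positivity
  exact lt_of_pow_lt_pow_left₀ 2 (by linarith [mu1m_le_mu1p]) (by nlinarith)

/-- At μ = μ₁⁺ the lower block is singular, so λ drops out of the determinant and its sign is a
matter of constants. This is why the whole line belongs to one region. -/
theorem det_redMatrix_zero_mu1p_neg (l : ℝ) : (redMatrix l mu1p 0).det < 0 := by
  have h : (redMatrix l mu1p 0).det = -4 * (mu1p - mu1m - 2 * blockQ) := by
    rw [det_redMatrix_zero]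
    linear_combination -8 * mu1p * mu0_add + 8 * mu0_mul - 8 * mu1_mul + (8 * mu1p - 4) * mu1_add
  rw [h]
  have := neg_two_mul_blockQ_lt
  have := blockQ_neg
  linarith

theorem det_redMatrix_zero_mu1m_pos (l : ℝ) : 0 < (redMatrix l mu1m 0).det := by
  have h : (redMatrix l mu1m 0).det = -4 * (mu1m - mu1p - 2 * blockQ) := by
    rw [det_redMatrix_zero]
    linear_combination -8 * mu1m * mu0_add + 8 * mu0_mul - 8 * mu1_mul + (8 * mu1m - 4) * mu1_add
  rw [h]
  have := neg_two_mul_blockQ_lt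
  linarith

theorem det_pos_of_outer {l m : ℝ} (h : m < mu1m ∨ mu1p < m) (hl : curveMinus m < l) :
    0 < (redMatrix l m 0).det := by
  have hle := mu1m_le_mu1p
  have hQ : 0 < (m - mu1p) * (m - mu1m) := by
    rcases h with h | h
    · exact mul_pos_of_neg_of_neg (by linarith) (by linarith)
    · exact mul_pos (by linarith) (by linarith)
  rw [det_redMatrix_zero_eq_mul hQ.ne']
  exact mul_pos hQ (by linarith)

theorem det_neg_of_outer {l m : ℝ} (h : m < mu1m ∨ mu1p < m) (hl : l < curveMinus m) :
    (redMatrix l m 0).det < 0 := by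
  have hle := mu1m_le_mu1p
  have hQ : 0 < (m - mu1p) * (m - mu1m) := by
    rcases h with h | h
    · exact mul_pos_of_neg_of_neg (by linarith) (by linarith)
    · exact mul_pos (by linarith) (by linarith)
  rw [det_redMatrix_zero_eq_mul hQ.ne']
  exact mul_neg_of_pos_of_neg hQ (by linarith)

theorem middle_neg {m : ℝ} (h1 : mu1m < m) (h2 : m < mu1p) : (m - mu1p) * (m - mu1m) < 0 :=
  mul_neg_of_neg_of_pos (by linarith) (by linarith)

theorem redIndex_of_mem_regionMinus0 {l m : ℝ} (h : (l, m) ∈ regionMinus0) :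
    redIndex l m = 0 := by
  obtain ⟨h1, h2⟩ := h
  have e1 := redIndex_le_one l h2.le
  have e2 := even_redIndex (det_pos_of_outer (Or.inr h2) h1)
  grind

theorem redIndex_of_mem_regionMinus1 {l m : ℝ} (h : (l, m) ∈ regionMinus1) :
    redIndex l m = 1 := by
  rcases h with (⟨h1, h2⟩ | h) | ⟨h1, h2, h3⟩
  · have e1 := redIndex_le_one l h2.le
    have e2 := odd_redIndex (det_neg_of_outer (Or.inr h2) h1)
    grind
  · have h : m = mu1p := h
    subst h
    have e1 := redIndex_le_one l le_rfl
    have e2 := odd_redIndex (det_redMatrix_zero_mu1p_neg l)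
    grind
  · have e1 := redIndex_le_two l h2.le
    have hQ := middle_neg h2 h3
    have e2 := odd_redIndex (l := l) (m := m) (by
      rw [det_redMatrix_zero_eq_mul hQ.ne]
      exact mul_neg_of_neg_of_pos hQ (sub_pos.2 h1))
    grind

theorem redIndex_of_mem_regionMinus2 {l m : ℝ} (h : (l, m) ∈ regionMinus2) :
    redIndex l m = 2 := by
  rcases h with (⟨h1, h2, h3⟩ | h) | ⟨h1, h2⟩
  · have e0 := one_le_redIndex l h3
    have e1 := redIndex_le_two l h2.le
    have hQ := middle_neg h2 h3
    have e2 := even_redIndex (l := l) (m := m) (by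
      rw [det_redMatrix_zero_eq_mul hQ.ne]
      exact mul_pos_of_neg_of_neg hQ (sub_neg.2 h1))
    grind
  · have h : m = mu1m := h
    subst h
    have hlt : mu1m < mu1p := by linarith [neg_two_mul_blockQ_lt, blockQ_neg]
    have e0 := one_le_redIndex l hlt
    have e1 := redIndex_le_two l le_rfl
    have e2 := even_redIndex (det_redMatrix_zero_mu1m_pos l)
    grind
  · have e0 := two_le_redIndex l h2
    have e1 := redIndex_le_three l m
    have e2 := even_redIndex (det_pos_of_outer (Or.inl h2) h1)
    grind

theorem redIndex_of_mem_regionMinus3 {l m : ℝ} (h : (l, m) ∈ regionMinus3) :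
    redIndex l m = 3 := by
  obtain ⟨h1, h2⟩ := h
  have e0 := two_le_redIndex l h2
  have e1 := redIndex_le_three l m
  have e2 := odd_redIndex (det_neg_of_outer (Or.inl h2) h1)
  grind

/-- Where G(0)⁻¹ + D is negative, D must be negative because G(0)⁻¹ ≥ 0; there G(0)⁻¹ - D is
positive. The two index spaces therefore compete for three dimensions. -/
theorem redIndex_add_redIndex_neg_le (l m : ℝ) : redIndex l m + redIndex (-l) (-m) ≤ 3 := by
  obtain ⟨U, h1, h2⟩ := (redMatrix_isHermitian l m 0).exists_neg_subspace
  have := (redMatrix_isHermitian (-l) (-m) 0).finrank_add_negIndex_le (W := U) fun x hx => by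
    by_cases hne : x = 0
    · simp [hne]
    · have e1 := h2 x hx hne
      have e2 := le_dotProduct_gram_inv (le_refl 0) x 0
      rw [dotProduct_redMatrix] at e1 ⊢
      simp only [zero_dotProduct, mul_zero, sub_zero] at e2
      linarith
  rw [h1, Fintype.card_fin] at this
  exact this

/-! ### The regions 𝒞ₖ⁺ as reflections of 𝒞ₖ⁻ through the origin -/

theorem curvePlus_eq (m : ℝ) : curvePlus m = -curveMinus (-m) := by
  rw [curvePlus, curveMinus, neg_neg]
  congr 1 <;> ring

theorem mem_regionPlus0_iff {l m : ℝ} : (l, m) ∈ regionPlus0 ↔ (-l, -m) ∈ regionMinus0 := by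
  simp only [regionPlus0, regionMinus0, Set.mem_ofPred_eq, curvePlus_eq]
  constructor <;> rintro ⟨h1, h2⟩ <;> exact ⟨by linarith, by linarith⟩

theorem mem_regionPlus1_iff {l m : ℝ} : (l, m) ∈ regionPlus1 ↔ (-l, -m) ∈ regionMinus1 := by
  simp only [regionPlus1, regionMinus1, Set.mem_union, Set.mem_ofPred_eq, curvePlus_eq]
  constructor
  · rintro ((⟨h1, h2⟩ | h1) | ⟨h1, h2, h3⟩)
    · exact Or.inl (Or.inl ⟨by linarith, by linarith⟩)
    · exact Or.inl (Or.inr (by linarith))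
    · exact Or.inr ⟨by linarith, by linarith, by linarith⟩
  · rintro ((⟨h1, h2⟩ | h1) | ⟨h1, h2, h3⟩)
    · exact Or.inl (Or.inl ⟨by linarith, by linarith⟩)
    · exact Or.inl (Or.inr (by linarith))
    · exact Or.inr ⟨by linarith, by linarith, by linarith⟩

theorem mem_regionPlus2_iff {l m : ℝ} : (l, m) ∈ regionPlus2 ↔ (-l, -m) ∈ regionMinus2 := by
  simp only [regionPlus2, regionMinus2, Set.mem_union, Set.mem_ofPred_eq, curvePlus_eq]
  constructor
  · rintro ((⟨h1, h2, h3⟩ | h1) | ⟨h1, h2⟩)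
    · exact Or.inl (Or.inl ⟨by linarith, by linarith, by linarith⟩)
    · exact Or.inl (Or.inr (by linarith))
    · exact Or.inr ⟨by linarith, by linarith⟩
  · rintro ((⟨h1, h2, h3⟩ | h1) | ⟨h1, h2⟩)
    · exact Or.inl (Or.inl ⟨by linarith, by linarith, by linarith⟩)
    · exact Or.inl (Or.inr (by linarith))
    · exact Or.inr ⟨by linarith, by linarith⟩

theorem mem_regionPlus3_iff {l m : ℝ} : (l, m) ∈ regionPlus3 ↔ (-l, -m) ∈ regionMinus3 := by
  simp only [regionPlus3, regionMinus3, Set.mem_ofPred_eq, curvePlus_eq]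
  constructor <;> rintro ⟨h1, h2⟩ <;> exact ⟨by linarith, by linarith⟩

/-! ### The interaction as a finite rank operator -/

/-- The functions `phi` and their images under the exchange of `p₁` and `p₂`. -/
def sectorPhi (i : Bool × Fin 3) (p : Torus) : ℝ := phi i.2 (if i.1 then p.swap else p)

/-- The coupling constants of the functions `phi`. -/
def coupling (l m : ℝ) : Fin 3 → ℝ := ![l, m, m]

theorem continuous_sectorPhi (i : Bool × Fin 3) : Continuous (sectorPhi i) := by
  rcases i with ⟨_ | _, k⟩
  · exact continuous_phi k
  · exact (continuous_phi k).comp continuous_swap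

theorem phi_neg (k : Fin 3) (p : Torus) : phi k (-p) = -phi k p := by
  have : psi k (-p) = psi k p := by
    fin_cases k <;> simp [psi, cosT_neg]
  rw [phi, phi, this, Prod.fst_neg, sinT_neg, neg_mul]

theorem sectorPhi_neg (i : Bool × Fin 3) (p : Torus) : sectorPhi i (-p) = -sectorPhi i p := by
  rcases i with ⟨_ | _, k⟩
  · exact phi_neg k p
  · exact phi_neg k p.swap

/-- The part of the interaction kernel which is even in the second variable. -/
def evenKernel (l m : ℝ) (p u : Torus) : ℝ :=
  l * (cosT p.1 * cosT u.1 + cosT p.2 * cosT u.2) +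
    2 * m * ((cosT p.1 * cosT u.1) ^ 2 + (sinT p.1 * sinT u.1) ^ 2 +
      (cosT p.2 * cosT u.2) ^ 2 + (sinT p.2 * sinT u.2) ^ 2 - 1) +
    4 * m * (cosT p.1 * cosT u.1 * (cosT p.2 * cosT u.2) +
      sinT p.1 * sinT u.1 * (sinT p.2 * sinT u.2))

theorem evenKernel_neg (l m : ℝ) (p u : Torus) : evenKernel l m p (-u) = evenKernel l m p u := by
  simp only [evenKernel, Prod.fst_neg, Prod.snd_neg, cosT_neg, sinT_neg]
  ring

theorem continuous_evenKernel (l m : ℝ) (p : Torus) : Continuous (evenKernel l m p) := by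
  have h1 := continuous_cosT
  have h2 := continuous_sinT
  unfold evenKernel
  fun_prop

/-- The addition formulas split each cosine of a difference into products of cosines and products of
sines. The terms odd in u are products of the functions `sectorPhi`; the others form `evenKernel`
and vanish against odd functions. -/
theorem potential_sub (l m : ℝ) (p u : Torus) : potential l m (p - u) =
    ∑ i : Bool × Fin 3, coupling l m i.2 * sectorPhi i p * sectorPhi i u +
      evenKernel l m p u := by
  simp only [potential, Prod.fst_sub, Prod.snd_sub, cosT_two_nsmul, cosT_sub, evenKernel,
    Fintype.sum_prod_type, Fin.sum_univ_three, Fintype.sum_bool, sectorPhi, phi, psi, coupling,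
    Matrix.cons_val, if_true, Bool.false_eq_true, if_false, Prod.fst_swap, Prod.snd_swap]
  ring

theorem memLp_ofReal_continuous {F : Torus → ℝ} (hF : Continuous F) :
    MemLp (fun p => (F p : ℂ)) 2 (volume : Measure Torus) := by
  obtain ⟨C, hC⟩ := (isCompact_univ (X := Torus)).exists_bound_of_continuousOn
    (f := fun p : Torus => (F p : ℂ)) (Complex.continuous_ofReal.comp hF).continuousOn
  exact MemLp.of_bound (Complex.continuous_ofReal.comp hF).aestronglyMeasurable C
    (Eventually.of_forall fun p => hC p (Set.mem_univ p))

/-- A continuous real function as an element of `L²(𝕋²)`. -/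
def toL2 (F : Torus → ℝ) (hF : Continuous F) : L2 := (memLp_ofReal_continuous hF).toLp _

theorem coeFn_toL2 {F : Torus → ℝ} (hF : Continuous F) :
    toL2 F hF =ᵐ[volume] fun p => (F p : ℂ) := (memLp_ofReal_continuous hF).coeFn_toLp

theorem toL2_mem_oddL2 {F : Torus → ℝ} (hF : Continuous F) (h : ∀ p, F (-p) = -F p) :
    toL2 F hF ∈ oddL2 := by
  have h1 := coeFn_toL2 hF
  change ∀ᵐ p : Torus, toL2 F hF (-p) = -toL2 F hF p
  filter_upwards [h1, (Measure.measurePreserving_neg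
    (volume : Measure Torus)).quasiMeasurePreserving.ae h1] with p e1 e2
  rw [e1, e2, h, Complex.ofReal_neg]

/-- The averaged product with `sectorPhi i` as a linear functional. -/
def coef (i : Bool × Fin 3) : L2 →ₗ[ℂ] ℂ :=
  ((1 / (2 * π) ^ 2 : ℝ) : ℂ) •
    (innerSL ℂ (toL2 (sectorPhi i) (continuous_sectorPhi i))).toLinearMap

theorem coef_eq_inner (i : Bool × Fin 3) (f : L2) : coef i f = ((1 / (2 * π) ^ 2 : ℝ) : ℂ) *
    inner ℂ (toL2 (sectorPhi i) (continuous_sectorPhi i)) f := rfl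

theorem inner_toL2 {F : Torus → ℝ} (hF : Continuous F) (f : L2) :
    inner ℂ (toL2 F hF) f = ∫ u, (F u : ℂ) * f u := by
  rw [L2.inner_def]
  refine integral_congr_ae ?_
  filter_upwards [coeFn_toL2 hF] with u hu
  rw [hu]
  simp [mul_comm]

theorem coef_eq_integral (i : Bool × Fin 3) (f : L2) :
    coef i f = ((1 / (2 * π) ^ 2 : ℝ) : ℂ) * ∫ u, (sectorPhi i u : ℂ) * f u := by
  rw [coef_eq_inner, inner_toL2]

theorem coef_toL2 (i : Bool × Fin 3) {F : Torus → ℝ} (hF : Continuous F) :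
    coef i (toL2 F hF) = (avg fun p => sectorPhi i p * F p : ℝ) := by
  rw [coef_eq_integral, avg, Complex.ofReal_mul, ← integral_complex_ofReal]
  congr 1
  refine integral_congr_ae ?_
  filter_upwards [coeFn_toL2 hF] with u hu
  rw [hu, Complex.ofReal_mul]

theorem integrable_continuous_mul {F : Torus → ℝ} (hF : Continuous F) (f : L2) :
    Integrable (fun u => (F u : ℂ) * f u) volume := by
  obtain ⟨C, hC⟩ := (isCompact_univ (X := Torus)).exists_bound_of_continuousOn
    (f := fun p : Torus => (F p : ℂ)) (Complex.continuous_ofReal.comp hF).continuousOn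
  exact (integrable_L2 f).bdd_mul (c := C)
    (Complex.continuous_ofReal.comp hF).aestronglyMeasurable
    (Eventually.of_forall fun u => hC u (Set.mem_univ u))

theorem integral_even_mul_odd {F : Torus → ℝ} (hF : ∀ p, F (-p) = F p) {f : L2}
    (hf : f ∈ oddL2) : ∫ u, (F u : ℂ) * f u = 0 := by
  have h1 : ∫ u, (F u : ℂ) * f u = -∫ u, (F u : ℂ) * f u := by
    conv_lhs => rw [← integral_neg_eq_self]
    rw [← integral_neg]
    refine integral_congr_ae ?_
    have hf' : ∀ᵐ p : Torus, f (-p) = -f p := hf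
    filter_upwards [hf'] with u hu
    rw [hF, hu, mul_neg]
  exact self_eq_neg.1 h1

theorem interactionFun_eq (l m : ℝ) {f : L2} (hf : f ∈ oddL2) (p : Torus) :
    interactionFun l m f p =
      ∑ i : Bool × Fin 3, ((coupling l m i.2 : ℂ) * coef i f) * (sectorPhi i p : ℂ) := by
  have h1 : ∀ u, (potential l m (p - u) : ℂ) * f u =
      ∑ i : Bool × Fin 3, ((coupling l m i.2 : ℂ) * (sectorPhi i p : ℂ)) *
        ((sectorPhi i u : ℂ) * f u) + (evenKernel l m p u : ℂ) * f u := by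
    intro u
    rw [potential_sub]
    push_cast
    rw [add_mul, Finset.sum_mul]
    congr 1
    refine Finset.sum_congr rfl fun i _ => by ring
  have hi : ∀ i : Bool × Fin 3, Integrable (fun u => ((coupling l m i.2 : ℂ) *
      (sectorPhi i p : ℂ)) * ((sectorPhi i u : ℂ) * f u)) volume := fun i =>
    (integrable_continuous_mul (continuous_sectorPhi i) f).const_mul _
  rw [interactionFun, funext h1, integral_add (integrable_finsetSum _ fun i _ => hi i)
    (integrable_continuous_mul (continuous_evenKernel l m p) f),
    integral_even_mul_odd (evenKernel_neg l m p) hf, add_zero, integral_finsetSum _ fun i _ => hi i,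
    Finset.mul_sum]
  refine Finset.sum_congr rfl fun i _ => ?_
  rw [integral_const_mul, coef_eq_integral]
  ring

theorem coeFn_sum_smul_toL2 (c : Bool × Fin 3 → ℂ) {F : Bool × Fin 3 → Torus → ℝ}
    (hF : ∀ i, Continuous (F i)) :
    (∑ i, c i • toL2 (F i) (hF i) : L2) =ᵐ[volume] fun p => ∑ i, c i * (F i p : ℂ) := by
  have h2 : ∀ i, ∀ᵐ p, (c i • toL2 (F i) (hF i) : L2) p = c i * (F i p : ℂ) := by
    intro i
    filter_upwards [Lp.coeFn_smul (c i) (toL2 (F i) (hF i)), coeFn_toL2 (hF i)] with p e1 e2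
    rw [e1, Pi.smul_apply, e2, smul_eq_mul]
  filter_upwards [Lp.coeFn_fun_finsetSum Finset.univ fun i => c i • toL2 (F i) (hF i), ae_all_iff.2 h2]
    with p e2 e3
  rw [e2]
  exact Finset.sum_congr rfl fun i _ => e3 i

/-- On odd functions the interaction is an operator of finite rank. -/
theorem interactionL2_eq (l m : ℝ) {f : L2} (hf : f ∈ oddL2) :
    interactionL2 l m f = ∑ i : Bool × Fin 3, ((coupling l m i.2 : ℂ) * coef i f) •
      toL2 (sectorPhi i) (continuous_sectorPhi i) := by
  refine Lp.ext ?_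
  have h1 : interactionL2 l m f =ᵐ[volume] interactionFun l m f :=
    (memLp_interactionFun l m f).coeFn_toLp
  filter_upwards [h1, coeFn_sum_smul_toL2 (fun i => (coupling l m i.2 : ℂ) * coef i f)
    continuous_sectorPhi] with p e1 e2
  rw [e1, interactionFun_eq l m hf, e2]

theorem hamiltonian_coe (l m : ℝ) (f : oddL2) :
    (hamiltonian l m f : L2) = freeL2 f + interactionL2 l m f := rfl

theorem coeFn_freeL2 (f : L2) : freeL2 f =ᵐ[volume] fun p => (dispersion p : ℂ) * f p :=
  (memLp_freeFun f).coeFn_toLp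

theorem inner_freeL2 (f g : L2) : inner ℂ (freeL2 f) g = inner ℂ f (freeL2 g) := by
  rw [L2.inner_def, L2.inner_def]
  refine integral_congr_ae ?_
  filter_upwards [coeFn_freeL2 f, coeFn_freeL2 g] with p e1 e2
  rw [e1, e2]
  simp
  ring

theorem hamiltonian_isSymmetric (l m : ℝ) : (hamiltonian l m).IsSymmetric := by
  intro f g
  rw [Submodule.coe_inner, Submodule.coe_inner, hamiltonian_coe, hamiltonian_coe, inner_add_left,
    inner_add_right, inner_freeL2, interactionL2_eq l m f.2, interactionL2_eq l m g.2, sum_inner,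
    inner_sum]
  congr 1
  refine Finset.sum_congr rfl fun i _ => ?_
  rw [inner_smul_left, inner_smul_right, coef_eq_inner, coef_eq_inner]
  simp only [map_mul, Complex.conj_ofReal, inner_conj_symm]
  ring

theorem eq_ofReal_of_hasEigenvalue {l m : ℝ} {z : ℂ}
    (h : Module.End.HasEigenvalue (hamiltonian l m) z) : z = (z.re : ℂ) :=
  (Complex.conj_eq_iff_re.1 ((hamiltonian_isSymmetric l m).conj_eigenvalue_eq_self h)).symm

/-! ### Eigenspaces -/

theorem dispersion_sub_ne_zero {z : ℝ} (hz : z ∉ Set.Icc (0 : ℝ) 8) (p : Torus) :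
    dispersion p - z ≠ 0 := fun h =>
  hz ⟨by linarith [dispersion_nonneg p], by linarith [dispersion_le p]⟩

theorem continuous_sectorPhi_div {z : ℝ} (hz : z ∉ Set.Icc (0 : ℝ) 8) (i : Bool × Fin 3) :
    Continuous fun p => sectorPhi i p / (dispersion p - z) := by
  have h1 := continuous_sectorPhi i
  have h2 := continuous_dispersion
  exact Continuous.div (by fun_prop) (by fun_prop) (dispersion_sub_ne_zero hz)

/-- The free resolvent applied to `sectorPhi i`. -/
def resolventPhi {z : ℝ} (hz : z ∉ Set.Icc (0 : ℝ) 8) (i : Bool × Fin 3) : oddL2 :=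
  ⟨toL2 _ (continuous_sectorPhi_div hz i), toL2_mem_oddL2 _ fun p => by
    rw [sectorPhi_neg, dispersion_neg, neg_div]⟩

theorem dispersion_swap (p : Torus) : dispersion p.swap = dispersion p := by
  simp only [dispersion, Prod.fst_swap, Prod.snd_swap]
  ring

theorem phi_neg_fst (k : Fin 3) (p : Torus) : phi k (-p.1, p.2) = -phi k p := by
  have : psi k (-p.1, p.2) = psi k p := by
    fin_cases k <;> simp [psi, cosT_neg]
  rw [phi, phi, this, sinT_neg, neg_mul]

theorem phi_swap_neg_fst (k : Fin 3) (p : Torus) :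
    phi k (Prod.swap (-p.1, p.2)) = phi k p.swap := by
  have : psi k (Prod.swap (-p.1, p.2)) = psi k p.swap := by
    fin_cases k <;> simp [psi, cosT_neg]
  rw [phi, phi, this, Prod.fst_swap, Prod.fst_swap]

theorem dispersion_neg_fst (p : Torus) : dispersion (-p.1, p.2) = dispersion p := by
  simp [dispersion, cosT_neg]

/-- Under p₁ ↦ -p₁ the function φⱼ is odd, while φₖ with exchanged variables and the dispersion are
even. Hence the two sectors decouple. -/
theorem avg_phi_mul_phi_swap (j k : Fin 3) (z : ℝ) :
    avg (fun p => phi j p * (phi k p.swap / (dispersion p - z))) = 0 := by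
  have h := avg_neg_fst fun p => phi j p * (phi k p.swap / (dispersion p - z))
  simp only [phi_neg_fst, phi_swap_neg_fst, dispersion_neg_fst, neg_mul] at h
  rw [avg_neg] at h
  linarith

theorem coef_resolventPhi {z : ℝ} (hz : z ∉ Set.Icc (0 : ℝ) 8) (i j : Bool × Fin 3) :
    coef i (resolventPhi hz j) = if i.1 = j.1 then (gram z i.2 j.2 : ℂ) else 0 := by
  rw [resolventPhi, coef_toL2]
  rcases i with ⟨_ | _, i⟩ <;> rcases j with ⟨_ | _, j⟩
  · simp [sectorPhi, gram_apply, mul_div_assoc]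
  · simp [sectorPhi, avg_phi_mul_phi_swap]
  · have := avg_phi_mul_phi_swap j i z
    have e : ∀ p : Torus, phi i p.swap * (phi j p / (dispersion p - z)) =
      phi j p * (phi i p.swap / (dispersion p - z)) := fun p => by ring
    simp [sectorPhi, e, this]
  · have := avg_swap fun p => phi i p * (phi j p / (dispersion p - z))
    simp only [dispersion_swap] at this
    simp [sectorPhi, gram_apply, mul_div_assoc, this]

/-- Outside [0, 8] the factor E - z never vanishes, so the eigenvalue equation may be divided by it.
An eigenvector is then determined by its six coefficients. -/
theorem mem_eigenspace_iff {l m z : ℝ} (hz : z ∉ Set.Icc (0 : ℝ) 8) (f : oddL2) :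
    f ∈ Module.End.eigenspace (hamiltonian l m) (z : ℂ) ↔
      f = -∑ i, ((coupling l m i.2 : ℂ) * coef i f) • resolventPhi hz i := by
  rw [Module.End.mem_eigenspace_iff, ← Subtype.coe_inj (a := hamiltonian l m f),
    ← Subtype.coe_inj (a := f), hamiltonian_coe,
    interactionL2_eq l m f.2]
  have e0 : ((-∑ i, ((coupling l m i.2 : ℂ) * coef i f) • resolventPhi hz i : oddL2) : L2) =
      -∑ i, ((coupling l m i.2 : ℂ) * coef i f) • toL2 _ (continuous_sectorPhi_div hz i) := by
    simp [resolventPhi]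
  rw [e0, Submodule.coe_smul]
  set c : Bool × Fin 3 → ℂ := fun i => (coupling l m i.2 : ℂ) * coef i f with hc
  have h1 := coeFn_sum_smul_toL2 c continuous_sectorPhi
  have h2 := coeFn_sum_smul_toL2 c (continuous_sectorPhi_div hz)
  have h3 := coeFn_freeL2 (f : L2)
  have h4 := Lp.coeFn_add (freeL2 (f : L2))
    (∑ i, c i • toL2 (sectorPhi i) (continuous_sectorPhi i))
  have h5 := Lp.coeFn_neg (∑ i, c i • toL2 _ (continuous_sectorPhi_div hz i))
  have h6 := Lp.coeFn_smul (z : ℂ) (f : L2)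
  have key : ∀ p, (∑ i, c i * ((sectorPhi i p / (dispersion p - z) : ℝ) : ℂ)) *
      ((dispersion p : ℂ) - z) = ∑ i, c i * (sectorPhi i p : ℂ) := by
    intro p
    have hne : ((dispersion p : ℂ) - z) ≠ 0 := by
      exact_mod_cast dispersion_sub_ne_zero hz p
    rw [Finset.sum_mul]
    refine Finset.sum_congr rfl fun i _ => ?_
    push_cast
    field_simp
  constructor
  · intro h
    refine Lp.ext ?_
    have h7 : (freeL2 (f : L2) + ∑ i, c i • toL2 (sectorPhi i) (continuous_sectorPhi i) : L2)
        =ᵐ[volume] ((z : ℂ) • (f : L2) : L2) := by rw [h]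
    filter_upwards [h1, h2, h3, h4, h5, h6, h7] with p e1 e2 e3 e4 e5 e6 e7
    have hne : ((dispersion p : ℂ) - z) ≠ 0 := by
      exact_mod_cast dispersion_sub_ne_zero hz p
    rw [e4, e6, Pi.add_apply, Pi.smul_apply, e3, e1, smul_eq_mul, ← key p] at e7
    rw [e5, Pi.neg_apply, e2]
    apply mul_right_cancel₀ hne
    linear_combination e7
  · intro h
    refine Lp.ext ?_
    have h7 : (f : L2) =ᵐ[volume]
        (-∑ i, c i • toL2 _ (continuous_sectorPhi_div hz i) : L2) := by rw [← h]
    filter_upwards [h1, h2, h3, h4, h5, h6, h7] with p e1 e2 e3 e4 e5 e6 e7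
    rw [e5, Pi.neg_apply, e2] at e7
    rw [e4, e6, Pi.add_apply, Pi.smul_apply, e3, e1, smul_eq_mul, ← key p]
    linear_combination ((dispersion p : ℂ) - z) * e7

/-- The matrix of the eigenvalue equation in one sector. -/
def sectorMatrix (l m z : ℝ) : Matrix (Fin 3) (Fin 3) ℝ :=
  1 + gram z * Matrix.diagonal ![l, m, m]

/-- The kernel of the complexified matrix of the eigenvalue equation. -/
def sectorKernel (l m z : ℝ) : Submodule ℂ (Fin 3 → ℂ) :=
  LinearMap.ker ((sectorMatrix l m z).map Complex.ofReal).mulVecLin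

theorem mem_sectorKernel_iff {l m z : ℝ} {b : Fin 3 → ℂ} : b ∈ sectorKernel l m z ↔
    ∀ j, b j = -∑ k, ((coupling l m k : ℂ) * b k) * (gram z j k : ℂ) := by
  rw [sectorKernel, LinearMap.mem_ker, Matrix.mulVecLin_apply, funext_iff]
  refine forall_congr' fun j => ?_
  have : (((sectorMatrix l m z).map Complex.ofReal) *ᵥ b) j =
      b j + ∑ k, ((coupling l m k : ℂ) * b k) * (gram z j k : ℂ) := by
    simp only [Matrix.mulVec, dotProduct, Matrix.map_apply, sectorMatrix, Matrix.add_apply,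
      Matrix.mul_diagonal, Complex.ofReal_add, add_mul, Finset.sum_add_distrib]
    congr 1
    · simp [Matrix.one_apply, apply_ite Complex.ofReal]
    · refine Finset.sum_congr rfl fun k _ => ?_
      rw [coupling]
      push_cast
      ring
  rw [this, Pi.zero_apply, eq_neg_iff_add_eq_zero]

theorem sum_coef_resolventPhi {z : ℝ} (hz : z ∉ Set.Icc (0 : ℝ) 8) (c : Bool × Fin 3 → ℂ)
    (s : Bool) (j : Fin 3) : coef (s, j) ((-∑ i, c i • resolventPhi hz i : oddL2) : L2) =
      -∑ k, c (s, k) * (gram z j k : ℂ) := by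
  have e0 : ((-∑ i, c i • resolventPhi hz i : oddL2) : L2) =
      -∑ i, c i • (resolventPhi hz i : L2) := by simp
  rw [e0, map_neg, map_sum, Fintype.sum_prod_type]
  simp only [map_smul, coef_resolventPhi, smul_eq_mul]
  cases s <;> simp

/-- Outside `[0, 8]` the eigenspaces are two copies of the kernel of the sector matrix. -/
def eigenspaceEquiv {l m z : ℝ} (hz : z ∉ Set.Icc (0 : ℝ) 8) :
    Module.End.eigenspace (hamiltonian l m) (z : ℂ) ≃ₗ[ℂ] (Bool → sectorKernel l m z) :=
  LinearEquiv.ofBijective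
    (LinearMap.pi fun s => LinearMap.codRestrict (sectorKernel l m z)
      (LinearMap.pi fun k => (coef (s, k)).comp (oddL2.subtype.comp (Submodule.subtype _)))
      (by
        intro f
        rw [mem_sectorKernel_iff]
        intro j
        have h := (mem_eigenspace_iff hz f.1).1 f.2
        have h2 := congrArg (fun g : oddL2 => coef (s, j) (g : L2)) h
        simp only [sum_coef_resolventPhi] at h2
        exact h2))
    (by
      constructor
      · rw [← LinearMap.ker_eq_bot, LinearMap.ker_eq_bot']
        intro f hf
        have h0 : ∀ i, coef i (f.1 : L2) = 0 := by
          rintro ⟨s, k⟩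
          have := congrArg Subtype.val (congrFun hf s)
          exact congrFun this k
        have h := (mem_eigenspace_iff hz f.1).1 f.2
        simp only [h0, mul_zero, zero_smul, Finset.sum_const_zero, neg_zero] at h
        exact Subtype.ext h
      · intro b
        -- The inverse map: prescribed kernel vectors are inserted as coefficients in the resolvent
        -- formula, and the kernel equation says that the resulting function has exactly these
        -- coefficients.
        set c : Bool × Fin 3 → ℂ := fun i => (coupling l m i.2 : ℂ) * (b i.1).1 i.2 with hc
        set f : oddL2 := -∑ i, c i • resolventPhi hz i with hf
        have hcoef : ∀ i : Bool × Fin 3, coef i (f : L2) = (b i.1).1 i.2 := by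
          rintro ⟨s, j⟩
          rw [hf, sum_coef_resolventPhi]
          exact ((mem_sectorKernel_iff.1 (b s).2) j).symm
        refine ⟨⟨f, (mem_eigenspace_iff hz f).2 ?_⟩, ?_⟩
        · simp only [hcoef]
          exact hf
        · ext s k
          exact hcoef (s, k))

/-- If the first component determines the kernel vectors of a real matrix, then the
complexified kernel is a line or zero. -/
theorem finrank_ker_map_ofReal (A : Matrix (Fin 3) (Fin 3) ℝ)
    (hA : ∀ x, A *ᵥ x = 0 → x 0 = 0 → x = 0) :
    Module.finrank ℂ (LinearMap.ker (A.map Complex.ofReal).mulVecLin) =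
      if A.det = 0 then 1 else 0 := by
  have hdet : (A.map Complex.ofReal).det = (A.det : ℂ) := (RingHom.map_det Complex.ofRealHom A).symm
  split_ifs with h
  · have h1 : Module.finrank ℂ (LinearMap.ker (A.map Complex.ofReal).mulVecLin) ≤ 1 := by
      have h2 := LinearMap.finrank_le_finrank_of_injective
        (f := (LinearMap.proj (0 : Fin 3) : (Fin 3 → ℂ) →ₗ[ℂ] ℂ).comp
          (LinearMap.ker (A.map Complex.ofReal).mulVecLin).subtype) (by
        rw [← LinearMap.ker_eq_bot, LinearMap.ker_eq_bot']
        rintro ⟨x, hx⟩ h0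
        have h0 : x 0 = 0 := h0
        have hx : A.map Complex.ofReal *ᵥ x = 0 := hx
        -- As A is real, the real and imaginary parts of a kernel vector are again kernel vectors,
        -- to which the real hypothesis applies.
        have hre : A *ᵥ (fun i => (x i).re) = 0 := by
          ext i
          have := congrArg Complex.re (congrFun hx i)
          simpa [Matrix.mulVec, dotProduct] using this
        have him : A *ᵥ (fun i => (x i).im) = 0 := by
          ext i
          have := congrArg Complex.im (congrFun hx i)
          simpa [Matrix.mulVec, dotProduct] using this
        have e1 := hA _ hre (by simp [h0])
        have e2 := hA _ him (by simp [h0])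
        apply Subtype.ext
        funext i
        exact Complex.ext (congrFun e1 i) (congrFun e2 i))
      simpa using h2
    have h2 : Module.finrank ℂ (LinearMap.ker (A.map Complex.ofReal).mulVecLin) ≠ 0 := by
      rw [Ne, Submodule.finrank_eq_zero]
      intro hbot
      obtain ⟨v, hv, h0⟩ := Matrix.exists_mulVec_eq_zero_iff.2
        (show (A.map Complex.ofReal).det = 0 by rw [hdet, h, Complex.ofReal_zero])
      apply hv
      rw [← Submodule.mem_bot ℂ, ← hbot]
      exact h0
    omega
  · rw [Submodule.finrank_eq_zero, LinearMap.ker_eq_bot']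
    intro v hv
    by_contra hne
    have := Matrix.exists_mulVec_eq_zero_iff.1 ⟨v, hne, hv⟩
    rw [hdet] at this
    exact h (by exact_mod_cast this)

theorem sectorMatrix_eq_mul {l m z : ℝ} (hz : z ≤ 0) :
    sectorMatrix l m z = gram z * redMatrix l m z := (gram_mul_redMatrix hz).symm

theorem eq_zero_of_sectorMatrix_mulVec {l m z : ℝ} (hz : z < 0) {x : Fin 3 → ℝ}
    (hx : sectorMatrix l m z *ᵥ x = 0) (h0 : x 0 = 0) : x = 0 := by
  refine eq_zero_of_redMatrix_mulVec_eq_zero (l := l) (m := m) hz ?_ h0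
  have h1 : (gram z)⁻¹ *ᵥ (sectorMatrix l m z *ᵥ x) = redMatrix l m z *ᵥ x := by
    rw [Matrix.mulVec_mulVec, sectorMatrix_eq_mul hz.le, ← mul_assoc, gram_inv_mul hz.le, one_mul]
  rw [← h1, hx, Matrix.mulVec_zero]

theorem det_sectorMatrix_eq_zero_iff {l m z : ℝ} (hz : z ≤ 0) :
    (sectorMatrix l m z).det = 0 ↔ (redMatrix l m z).det = 0 := by
  rw [sectorMatrix_eq_mul hz, Matrix.det_mul, mul_eq_zero, or_iff_right (det_gram_ne_zero hz)]

/-! ### The shift by `(π, π)` -/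

/-- The signs of the functions `phi` under the shift by `(π, π)`. -/
def shiftSign : Matrix (Fin 3) (Fin 3) ℝ := Matrix.diagonal ![-1, 1, 1]

theorem phi_add_pi (k : Fin 3) (p : Torus) :
    phi k (p + (((π : ℝ) : AddCircle (2 * π)), ((π : ℝ) : AddCircle (2 * π)))) =
      (![-1, 1, 1] : Fin 3 → ℝ) k * phi k p := by
  fin_cases k <;> simp [phi, psi, cosT_add_pi, sinT_add_pi]

theorem dispersion_add_pi (p : Torus) :
    dispersion (p + (((π : ℝ) : AddCircle (2 * π)), ((π : ℝ) : AddCircle (2 * π)))) =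
      8 - dispersion p := by
  simp only [dispersion, Prod.fst_add, Prod.snd_add, cosT_add_pi]
  ring

/-- Translation by (π, π) preserves the average, multiplies the φₖ by the signs (-1, 1, 1), and
turns E - z into -(E - (8 - z)). -/
theorem gram_reflect (z : ℝ) : gram z = -(shiftSign * gram (8 - z) * shiftSign) := by
  ext j k
  rw [Matrix.neg_apply, shiftSign, Matrix.mul_diagonal, Matrix.diagonal_mul, gram_apply,
    gram_apply, ← avg_add_pi, mul_right_comm, ← avg_const_mul, ← avg_neg]
  congr 1
  ext p
  rw [phi_add_pi, phi_add_pi, dispersion_add_pi, show 8 - dispersion p - z =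
    -(dispersion p - (8 - z)) by ring, div_neg]
  ring

theorem shiftSign_mul_self : shiftSign * shiftSign = 1 := by
  rw [shiftSign, Matrix.diagonal_mul_diagonal, ← Matrix.diagonal_one]
  congr 1
  ext i
  fin_cases i <;> simp

/-- The minus sign of `gram_reflect` is absorbed by reversing the couplings, and the diagonal sign
matrix commutes with the diagonal coupling matrix. Eigenvalues above 8 thus become eigenvalues below
0. -/
theorem sectorMatrix_reflect (l m z : ℝ) :
    sectorMatrix l m z = shiftSign * sectorMatrix (-l) (-m) (8 - z) * shiftSign := by
  have h1 : Matrix.diagonal ![-l, -m, -m] = -Matrix.diagonal ![l, m, m] := by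
    rw [Matrix.diagonal_neg]
    congr 1
    ext i
    fin_cases i <;> rfl
  have h2 : shiftSign * Matrix.diagonal ![l, m, m] = Matrix.diagonal ![l, m, m] * shiftSign := by
    rw [shiftSign, Matrix.diagonal_mul_diagonal, Matrix.diagonal_mul_diagonal]
    congr 1
    ext i
    ring
  rw [sectorMatrix, sectorMatrix, gram_reflect, h1, mul_add, add_mul, mul_one, shiftSign_mul_self,
    Matrix.neg_mul, Matrix.mul_neg, Matrix.mul_neg, Matrix.neg_mul]
  simp only [mul_assoc, h2]

theorem finrank_sectorKernel {l m z : ℝ} (hz : z ∉ Set.Icc (0 : ℝ) 8) :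
    Module.finrank ℂ (sectorKernel l m z) = if (sectorMatrix l m z).det = 0 then 1 else 0 := by
  apply finrank_ker_map_ofReal
  intro x hx h0
  rcases lt_or_ge z 0 with h | h
  · exact eq_zero_of_sectorMatrix_mulVec h hx h0
  · have h8 : 8 < z := by
      by_contra hc
      exact hz ⟨h, not_lt.1 hc⟩
    have hS : ∀ y : Fin 3 → ℝ, shiftSign *ᵥ (shiftSign *ᵥ y) = y := fun y => by
      rw [Matrix.mulVec_mulVec, shiftSign_mul_self, Matrix.one_mulVec]
    have h1 : shiftSign *ᵥ x = 0 := by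
      refine eq_zero_of_sectorMatrix_mulVec (l := -l) (m := -m) (z := 8 - z) (by linarith) ?_ ?_
      · rw [sectorMatrix_reflect, ← Matrix.mulVec_mulVec, ← Matrix.mulVec_mulVec] at hx
        rw [← hS (sectorMatrix (-l) (-m) (8 - z) *ᵥ shiftSign *ᵥ x), hx, Matrix.mulVec_zero]
      · simp [shiftSign, Matrix.mulVec_diagonal, h0]
    rw [← hS x, h1, Matrix.mulVec_zero]

theorem det_sectorMatrix_reflect (l m z : ℝ) :
    (sectorMatrix l m z).det = (sectorMatrix (-l) (-m) (8 - z)).det := by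
  have h : shiftSign.det * shiftSign.det = 1 := by
    rw [← Matrix.det_mul, shiftSign_mul_self, Matrix.det_one]
  rw [sectorMatrix_reflect, Matrix.det_mul, Matrix.det_mul]
  linear_combination (sectorMatrix (-l) (-m) (8 - z)).det * h

theorem finrank_eigenspace {l m z : ℝ} (hz : z ∉ Set.Icc (0 : ℝ) 8) :
    Module.finrank ℂ (Module.End.eigenspace (hamiltonian l m) (z : ℂ)) =
      if (sectorMatrix l m z).det = 0 then 2 else 0 := by
  rw [(eigenspaceEquiv hz).finrank_eq, Module.finrank_pi_fintype]
  simp only [finrank_sectorKernel hz]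
  split_ifs <;> simp

theorem hasEigenvalue_iff {l m z : ℝ} (hz : z ∉ Set.Icc (0 : ℝ) 8) :
    Module.End.HasEigenvalue (hamiltonian l m) (z : ℂ) ↔ (sectorMatrix l m z).det = 0 := by
  have : FiniteDimensional ℂ (Module.End.eigenspace (hamiltonian l m) (z : ℂ)) :=
    (eigenspaceEquiv hz).symm.finiteDimensional
  rw [Module.End.hasEigenvalue_iff, Ne, ← Submodule.finrank_eq_zero, finrank_eigenspace hz]
  split_ifs with h <;> simp [h]

/-! ### The essential spectrum -/

/-- The six coefficients are inner products with fixed odd functions, so they tend to zero along a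
weakly null sequence. This is compactness of a finite rank operator. -/
theorem tendsto_interactionL2 (l m : ℝ) {f : ℕ → oddL2}
    (hf : ∀ g : oddL2, Tendsto (fun n => inner ℂ g (f n)) atTop (𝓝 0)) :
    Tendsto (fun n => interactionL2 l m (f n : L2)) atTop (𝓝 0) := by
  have hc : ∀ i, Tendsto (fun n => coef i (f n : L2)) atTop (𝓝 0) := by
    intro i
    have := hf ⟨toL2 (sectorPhi i) (continuous_sectorPhi i),
      toL2_mem_oddL2 _ (sectorPhi_neg i)⟩
    simp only [Submodule.coe_inner] at this
    simp only [coef_eq_inner]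
    simpa only [mul_zero] using this.const_mul ((1 / (2 * π) ^ 2 : ℝ) : ℂ)
  have : Tendsto (fun n => ∑ i : Bool × Fin 3, ((coupling l m i.2 : ℂ) * coef i (f n : L2)) •
      toL2 (sectorPhi i) (continuous_sectorPhi i)) atTop (𝓝 (∑ i : Bool × Fin 3,
      ((coupling l m i.2 : ℂ) * 0) • toL2 (sectorPhi i) (continuous_sectorPhi i))) :=
    tendsto_finsetSum _ fun i _ => ((hc i).const_mul _).smul_const _
  simpa only [mul_zero, zero_smul, Finset.sum_const_zero, ← interactionL2_eq l m (f _).2] using this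

theorem coeFn_freeL2_sub (f : L2) (z : ℂ) :
    (freeL2 f - z • f : L2) =ᵐ[volume] fun p => ((dispersion p : ℂ) - z) * f p := by
  filter_upwards [Lp.coeFn_sub (freeL2 f) (z • f), coeFn_freeL2 f, Lp.coeFn_smul z f]
    with p e1 e2 e3
  rw [e1, Pi.sub_apply, e2, e3, Pi.smul_apply, smul_eq_mul, sub_mul]

theorem hamiltonian_sub_coe (l m : ℝ) (z : ℂ) (f : oddL2) :
    ((hamiltonian l m f - z • f : oddL2) : L2) =
      (freeL2 (f : L2) - z • (f : L2)) + interactionL2 l m f := by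
  rw [Submodule.coe_sub, hamiltonian_coe, Submodule.coe_smul]
  abel

/-- At distance δ > 0 from [0, 8] the free part satisfies ‖(H₀ - z)f‖ ≥ δ‖f‖. Along a Weyl sequence
the interaction tends to zero, so the left side would too, although ‖f‖ = 1. -/
theorem essentialSpectrum_subset (l m : ℝ) :
    essentialSpectrum (hamiltonian l m) ⊆ Complex.ofReal '' Set.Icc (0 : ℝ) 8 := by
  rintro z ⟨f, hf1, hfw, hft⟩
  by_contra hz
  have hclosed : IsClosed (Complex.ofReal '' Set.Icc (0 : ℝ) 8) :=
    (isCompact_Icc.image Complex.continuous_ofReal).isClosed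
  obtain ⟨δ, hδ, hball⟩ := Metric.isOpen_iff.1 hclosed.isOpen_compl z hz
  have hd : ∀ p, δ ≤ ‖(dispersion p : ℂ) - z‖ := by
    intro p
    by_contra hc
    exact hball (show (dispersion p : ℂ) ∈ Metric.ball z δ by
      rw [mem_ball_iff_norm]
      exact not_le.1 hc) ⟨_, ⟨dispersion_nonneg p, dispersion_le p⟩, rfl⟩
  have h1 : ∀ n, (1 : ℝ) ≤ δ⁻¹ * ‖freeL2 (f n : L2) - z • (f n : L2)‖ := by
    intro n
    have h2 : ‖(f n : L2)‖ ≤ δ⁻¹ * ‖freeL2 (f n : L2) - z • (f n : L2)‖ := by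
      refine Lp.norm_le_mul_norm_of_ae_le_mul ?_
      filter_upwards [coeFn_freeL2_sub (f n : L2) z] with p e1
      rw [e1, norm_mul, ← mul_assoc]
      refine le_mul_of_one_le_left (norm_nonneg _) ?_
      rw [inv_mul_eq_div, le_div_iff₀ hδ, one_mul]
      exact hd p
    rwa [← Submodule.coe_norm, hf1] at h2
  have h3 : Tendsto (fun n => freeL2 (f n : L2) - z • (f n : L2)) atTop (𝓝 0) := by
    have h4 : Tendsto (fun n => ((hamiltonian l m (f n) - z • f n : oddL2) : L2)) atTop (𝓝 0) :=
      (continuous_subtype_val.tendsto (0 : oddL2)).comp hft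
    have h5 := h4.sub (tendsto_interactionL2 l m hfw)
    simpa only [hamiltonian_sub_coe, add_sub_cancel_right, sub_zero] using h5
  have h4 := (h3.norm).const_mul δ⁻¹
  rw [norm_zero, mul_zero] at h4
  exact absurd (ge_of_tendsto' h4 h1) (by norm_num)

/-- A point of the diagonal p₁ = p₂ suffices: there the dispersion is 4(1 - cos p₁). -/
theorem exists_dispersion_eq {t : ℝ} (h0 : 0 < t) (h8 : t < 8) :
    ∃ p : Torus, dispersion p = t ∧ sinT p.1 ≠ 0 := by
  refine ⟨((Real.arccos (1 - t / 4) : ℝ), (Real.arccos (1 - t / 4) : ℝ)), ?_, ?_⟩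
  · simp only [dispersion, cosT_coe]
    rw [Real.cos_arccos (by linarith) (by linarith)]
    ring
  · simp only [sinT_coe]
    refine (Real.sin_pos_of_pos_of_lt_pi (Real.arccos_pos.2 (by linarith)) ?_).ne'
    refine (Real.arccos_le_pi _).lt_of_ne fun h => ?_
    rw [Real.arccos_eq_pi] at h
    linarith

theorem memLp_indicator_sinT {U : Set Torus} (hU : MeasurableSet U) :
    MemLp (U.indicator fun p => (sinT p.1 : ℂ)) 2 (volume : Measure Torus) :=
  (memLp_ofReal_continuous (continuous_sinT.comp continuous_fst)).indicator hU

/-- The odd function `sin p₁` cut off to the set where `𝓔₀` lies in `J`. -/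
def cutoffSin {J : Set ℝ} (hJ : IsOpen J) : oddL2 :=
  ⟨(memLp_indicator_sinT (hJ.preimage continuous_dispersion).measurableSet).toLp _, by
    have h := (memLp_indicator_sinT (hJ.preimage continuous_dispersion).measurableSet).coeFn_toLp
    change ∀ᵐ p : Torus, _ = _
    filter_upwards [h, (Measure.measurePreserving_neg
      (volume : Measure Torus)).quasiMeasurePreserving.ae h] with p e1 e2
    rw [e1, e2]
    by_cases hp : dispersion p ∈ J
    · simp [Set.indicator, dispersion_neg, sinT_neg, hp]
    · simp [Set.indicator, dispersion_neg, hp]⟩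

theorem coeFn_cutoffSin {J : Set ℝ} (hJ : IsOpen J) : ((cutoffSin hJ : oddL2) : L2) =ᵐ[volume]
    (dispersion ⁻¹' J).indicator fun p => (sinT p.1 : ℂ) :=
  (memLp_indicator_sinT (hJ.preimage continuous_dispersion).measurableSet).coeFn_toLp

/-- The set where E lies in `J` and sin p₁ ≠ 0 is open and nonempty, hence of positive measure. -/
theorem cutoffSin_ne_zero {J : Set ℝ} (hJ : IsOpen J) {t : ℝ} (ht : t ∈ J) (h0 : 0 < t)
    (h8 : t < 8) : cutoffSin hJ ≠ 0 := by
  intro h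
  obtain ⟨p, hp, hs⟩ := exists_dispersion_eq h0 h8
  have h1 := coeFn_cutoffSin hJ
  rw [h] at h1
  have h2 : ∀ᵐ q : Torus, ¬ (dispersion q ∈ J ∧ sinT q.1 ≠ 0) := by
    filter_upwards [h1, Lp.coeFn_zero ℂ 2 (volume : Measure Torus)] with q e1 e2
    rintro ⟨h3, h4⟩
    have e3 : ((0 : oddL2) : L2) q = 0 := e2
    rw [e3, Set.indicator_of_mem (show q ∈ dispersion ⁻¹' J from h3)] at e1
    exact h4 (by exact_mod_cast e1.symm)
  have hopen : IsOpen {q : Torus | dispersion q ∈ J ∧ sinT q.1 ≠ 0} :=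
    (hJ.preimage continuous_dispersion).inter
      (isOpen_ne_fun (continuous_sinT.comp continuous_fst) continuous_const)
  have : (volume : Measure Torus).IsOpenPosMeasure := by
    rw [Measure.volume_eq_prod]
    infer_instance
  refine hopen.measure_ne_zero volume ⟨p, by rw [Set.mem_ofPred_eq, hp]; exact ⟨ht, hs⟩⟩ ?_
  rw [ae_iff] at h2
  simpa using h2

theorem inner_cutoffSin {J J' : Set ℝ} (hJ : IsOpen J) (hJ' : IsOpen J') (h : Disjoint J J') :
    inner ℂ (cutoffSin hJ) (cutoffSin hJ') = 0 := by
  rw [Submodule.coe_inner, L2.inner_def]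
  refine integral_eq_zero_of_ae ?_
  filter_upwards [coeFn_cutoffSin hJ, coeFn_cutoffSin hJ'] with p e1 e2
  rw [e1, e2]
  by_cases hp : dispersion p ∈ J
  · have hp' : dispersion p ∉ J' := Set.disjoint_left.1 h hp
    simp [Set.indicator, hp']
  · simp [Set.indicator, hp]

theorem norm_freeL2_sub_cutoffSin_le {J : Set ℝ} (hJ : IsOpen J) {x ε : ℝ}
    (h : ∀ t ∈ J, |t - x| ≤ ε) : ‖freeL2 (cutoffSin hJ : L2) - (x : ℂ) • (cutoffSin hJ : L2)‖ ≤
      ε * ‖cutoffSin hJ‖ := by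
  rw [Submodule.coe_norm]
  refine Lp.norm_le_mul_norm_of_ae_le_mul ?_
  filter_upwards [coeFn_freeL2_sub (cutoffSin hJ : L2) x, coeFn_cutoffSin hJ] with p e1 e2
  rw [e1, e2]
  by_cases hp : dispersion p ∈ J
  · rw [norm_mul, ← Complex.ofReal_sub, Complex.norm_real]
    exact mul_le_mul_of_nonneg_right (h _ hp) (norm_nonneg _)
  · simp [Set.indicator, hp]

/-- A normalized orthogonal sequence converges weakly to zero. -/
theorem tendsto_inner_normalized {E : Type*} [NormedAddCommGroup E] [InnerProductSpace ℂ E]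
    {g : ℕ → E} (hne : ∀ n, g n ≠ 0) (horth : ∀ i j, i ≠ j → inner ℂ (g i) (g j) = 0) (h : E) :
    Tendsto (fun n => inner ℂ h (((‖g n‖⁻¹ : ℝ) : ℂ) • g n)) atTop (𝓝 0) := by
  have hf : Orthonormal ℂ fun n => ((‖g n‖⁻¹ : ℝ) : ℂ) • g n := by
    refine ⟨fun n => ?_, fun i j hij => ?_⟩
    · rw [norm_smul, Complex.norm_real, norm_inv, norm_norm,
        inv_mul_cancel₀ (norm_ne_zero_iff.2 (hne n))]
    · beta_reduce
      rw [inner_smul_left, inner_smul_right, horth i j hij, mul_zero, mul_zero]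
  have h2 := (hf.inner_products_summable h).tendsto_atTop_zero.sqrt
  simp only [Real.sqrt_sq (norm_nonneg _), Real.sqrt_zero] at h2
  rw [tendsto_zero_iff_norm_tendsto_zero]
  exact h2.congr fun n => norm_inner_symm _ _

/-- A Weyl sequence is obtained by restricting sin p₁ to disjoint shells of the dispersion which
shrink to x. Disjointness gives orthogonality, hence weak convergence to zero after normalization.
-/
theorem mem_essentialSpectrum (l m : ℝ) {x : ℝ} (hx : x ∈ Set.Icc (0 : ℝ) 8) :
    (x : ℂ) ∈ essentialSpectrum (hamiltonian l m) := by
  -- The direction d points from x into (0, 8), so that the shells lie on one side of x and inside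
  -- the range of the dispersion, even when x is an endpoint.
  obtain ⟨d, hd8, hd0, hd⟩ : ∃ d : ℝ, |d| ≤ 8 ∧ d ≠ 0 ∧
      ∀ t, 0 < t → t < 1 → 0 < x + d * t ∧ x + d * t < 8 := by
    rcases hx.2.lt_or_eq with h | h
    · refine ⟨8 - x, by rw [abs_le]; constructor <;> linarith [hx.1], by linarith,
        fun t h0 h1 => ⟨?_, ?_⟩⟩ <;> nlinarith [hx.1]
    · refine ⟨-8, by norm_num, by norm_num, fun t h0 h1 => ⟨?_, ?_⟩⟩ <;> linarith
  -- In the coordinate (t - x)/d the shells are the disjoint intervals (1/(n + 2), 1/(n + 1)).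
  set J : ℕ → Set ℝ := fun n =>
    (fun t => (t - x) / d) ⁻¹' Set.Ioo (1 / ((n : ℝ) + 2)) (1 / ((n : ℝ) + 1)) with hJdef
  have hJ : ∀ n, IsOpen (J n) := fun n => isOpen_Ioo.preimage (by fun_prop)
  have hdisj : ∀ i j, i < j → Disjoint (J i) (J j) := by
    intro i j hij
    rw [Set.disjoint_left]
    rintro t ⟨h1, _⟩ ⟨_, h2⟩
    have h3 : (1 : ℝ) / ((j : ℝ) + 1) ≤ 1 / ((i : ℝ) + 2) := by
      apply one_div_le_one_div_of_le (by positivity)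
      have : (i : ℝ) + 1 ≤ j := by exact_mod_cast hij
      linarith
    linarith
  have hne : ∀ n, cutoffSin (hJ n) ≠ 0 := by
    intro n
    obtain ⟨t, ht1, ht2⟩ := exists_between (show (1 : ℝ) / ((n : ℝ) + 2) < 1 / ((n : ℝ) + 1) from
      one_div_lt_one_div_of_lt (by positivity) (by linarith))
    have ht0 : 0 < t := lt_trans (by positivity) ht1
    have ht3 : t < 1 := ht2.trans_le (by
      rw [div_le_one (by positivity)]
      linarith [Nat.cast_nonneg (α := ℝ) n])
    refine cutoffSin_ne_zero (hJ n) (t := x + d * t) ?_ (hd t ht0 ht3).1 (hd t ht0 ht3).2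
    simp only [hJdef, Set.mem_preimage, add_sub_cancel_left]
    rw [mul_div_cancel_left₀ _ hd0]
    exact ⟨ht1, ht2⟩
  have hbound : ∀ n, ∀ t ∈ J n, |t - x| ≤ 8 * (1 / ((n : ℝ) + 1)) := by
    rintro n t ⟨h1, h2⟩
    have h3 : t - x = d * ((t - x) / d) := by field_simp
    have h0 : 0 < (t - x) / d := lt_trans (by positivity) h1
    rw [h3, abs_mul, abs_of_pos h0]
    exact mul_le_mul hd8 h2.le h0.le (by norm_num)
  set c : ℕ → ℂ := fun n => ((‖cutoffSin (hJ n)‖⁻¹ : ℝ) : ℂ) with hc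
  set f : ℕ → oddL2 := fun n => c n • cutoffSin (hJ n) with hf
  have hcn : ∀ n, ‖c n‖ * ‖cutoffSin (hJ n)‖ = 1 := by
    intro n
    rw [hc, Complex.norm_real, norm_inv, norm_norm]
    exact inv_mul_cancel₀ (norm_ne_zero_iff.2 (hne n))
  have hf1 : ∀ n, ‖f n‖ = 1 := fun n => by rw [hf, norm_smul, hcn]
  have horth : ∀ i j, i ≠ j → inner ℂ (cutoffSin (hJ i)) (cutoffSin (hJ j)) = 0 := by
    intro i j hij
    rcases lt_or_gt_of_ne hij with h | h
    · exact inner_cutoffSin _ _ (hdisj i j h)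
    · exact inner_cutoffSin _ _ (hdisj j i h).symm
  have hfw : ∀ g : oddL2, Tendsto (fun n => inner ℂ g (f n)) atTop (𝓝 0) :=
    tendsto_inner_normalized hne horth
  refine ⟨f, hf1, hfw, ?_⟩
  have h1 : ∀ n, ‖freeL2 (f n : L2) - (x : ℂ) • (f n : L2)‖ ≤ 8 * (1 / ((n : ℝ) + 1)) := by
    intro n
    have h2 := norm_freeL2_sub_cutoffSin_le (hJ n) (hbound n)
    have h3 : freeL2 (f n : L2) - (x : ℂ) • (f n : L2) = c n •
        (freeL2 (cutoffSin (hJ n) : L2) - (x : ℂ) • (cutoffSin (hJ n) : L2)) := by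
      rw [hf, Submodule.coe_smul, map_smul, smul_sub, smul_comm]
    rw [h3, norm_smul]
    calc _ ≤ ‖c n‖ * (8 * (1 / ((n : ℝ) + 1)) * ‖cutoffSin (hJ n)‖) := by gcongr
      _ = 8 * (1 / ((n : ℝ) + 1)) * (‖c n‖ * ‖cutoffSin (hJ n)‖) := by ring
      _ = _ := by rw [hcn, mul_one]
  have h2 : Tendsto (fun n => ((hamiltonian l m (f n) - (x : ℂ) • f n : oddL2) : L2)) atTop
      (𝓝 0) := by
    simp only [hamiltonian_sub_coe]
    have h3 : Tendsto (fun n => freeL2 (f n : L2) - (x : ℂ) • (f n : L2)) atTop (𝓝 0) := by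
      refine squeeze_zero_norm h1 ?_
      simpa using tendsto_one_div_add_atTop_nhds_zero_nat.const_mul (8 : ℝ)
    simpa only [add_zero] using h3.add (tendsto_interactionL2 l m hfw)
  rw [tendsto_zero_iff_norm_tendsto_zero] at h2 ⊢
  exact h2

theorem essentialSpectrum_hamiltonian (l m : ℝ) :
    essentialSpectrum (hamiltonian l m) = Complex.ofReal '' Set.Icc (0 : ℝ) 8 := by
  refine (essentialSpectrum_subset l m).antisymm ?_
  rintro _ ⟨x, hx, rfl⟩
  exact mem_essentialSpectrum l m hx

end

end LatticeFermion

/-! ### From threshold indices to the outer eigenvalues -/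

namespace LatticeFermion

/-- The eigenvalues of the Hamiltonian below and above its essential spectrum are counted by the
indices of the threshold matrices for the couplings `(λ, μ)` and `(-λ, -μ)`. -/
theorem exists_outerEigenvalues (l m : ℝ) :
    ∃ (Z : Fin (redIndex l m) → ℝ) (W : Fin (redIndex (-l) (-m)) → ℝ),
      StrictMono Z ∧ (∀ j, Z j < 0) ∧ StrictAnti W ∧ (∀ j, 8 < W j) ∧
        OuterEigenvaluesAreDouble (hamiltonian l m) (Set.range Z ∪ Set.range W) := by
  obtain ⟨Z, hZ, hZ0, hZr⟩ := exists_det_redMatrix_eq_zero l m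
  obtain ⟨Y, hY, hY0, hYr⟩ := exists_det_redMatrix_eq_zero (-l) (-m)
  have hbelow : ∀ z < 0, (sectorMatrix l m z).det = 0 ↔ z ∈ Set.range Z := fun z hz => by
    rw [det_sectorMatrix_eq_zero_iff hz.le, hZr z hz]
  -- By reflection the zeros above 8 are 8 - Y, with Y the zeros below 0 for the opposite couplings;
  -- this reverses their order.
  have habove : ∀ z, 8 < z → ((sectorMatrix l m z).det = 0 ↔
      z ∈ Set.range fun j => 8 - Y j) := fun z hz => by
    have h8 : 8 - z < 0 := by linarith
    rw [det_sectorMatrix_reflect, det_sectorMatrix_eq_zero_iff h8.le, hYr _ h8]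
    refine exists_congr fun j => ?_
    constructor <;> intro h <;> linarith
  have hW8 : ∀ j, 8 < 8 - Y j := fun j => by linarith [hY0 j]
  refine ⟨Z, fun j => 8 - Y j, hZ, hZ0, fun i j hij => sub_lt_sub_left (hY hij) 8, hW8, ?_, ?_⟩
  · have hess : ∀ x : ℝ, (x : ℂ) ∉ essentialSpectrum (hamiltonian l m) ↔
        x ∉ Set.Icc (0 : ℝ) 8 := fun x => by
      rw [essentialSpectrum_hamiltonian, Complex.ofReal_injective.mem_set_image]
    have key : ∀ x : ℝ, (Module.End.HasEigenvalue (hamiltonian l m) (x : ℂ) ∧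
        (x : ℂ) ∉ essentialSpectrum (hamiltonian l m)) ↔
        x ∈ Set.range Z ∪ Set.range fun j => 8 - Y j := fun x => by
      rw [hess, Set.mem_union]
      constructor
      · rintro ⟨he, hx⟩
        rw [hasEigenvalue_iff hx] at he
        rcases lt_or_ge x 0 with h | h
        · exact Or.inl ((hbelow x h).1 he)
        · exact Or.inr ((habove x (not_le.1 fun h8 => hx ⟨h, h8⟩)).1 he)
      · rintro (h | h)
        · have h0 : x < 0 := by
            obtain ⟨j, rfl⟩ := h
            exact hZ0 j
          have hx : x ∉ Set.Icc (0 : ℝ) 8 := fun hx => not_le.2 h0 hx.1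
          exact ⟨(hasEigenvalue_iff hx).2 ((hbelow x h0).2 h), hx⟩
        · have h8 : 8 < x := by
            obtain ⟨j, rfl⟩ := h
            exact hW8 j
          have hx : x ∉ Set.Icc (0 : ℝ) 8 := fun hx => not_le.2 h8 hx.2
          exact ⟨(hasEigenvalue_iff hx).2 ((habove x h8).2 h), hx⟩
    ext z
    constructor
    · rintro ⟨he, hz⟩
      -- Symmetry of the operator makes eigenvalues real, so complex candidates need no separate
      -- treatment.
      have hre := eq_ofReal_of_hasEigenvalue he
      rw [hre] at he hz
      exact ⟨z.re, (key z.re).1 ⟨he, hz⟩, hre.symm⟩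
    · rintro ⟨x, hx, rfl⟩
      exact (key x).2 hx
  · rintro x (h | h)
    · have h0 : x < 0 := by
        obtain ⟨j, rfl⟩ := h
        exact hZ0 j
      rw [finrank_eigenspace fun hx => not_le.2 h0 hx.1, if_pos ((hbelow x h0).2 h)]
    · have h8 : 8 < x := by
        obtain ⟨j, rfl⟩ := h
        exact hW8 j
      rw [finrank_eigenspace fun hx => not_le.2 h8 hx.2, if_pos ((habove x h8).2 h)]

/-- The families are indexed by `Fin` of an index; substituting its numerical value allows the
ranges to be written as explicit finite sets. -/
theorem exists_outerEigenvalues_of_index {l m : ℝ} {k k' : ℕ} (hk : redIndex l m = k)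
    (hk' : redIndex (-l) (-m) = k') :
    ∃ (Z : Fin k → ℝ) (W : Fin k' → ℝ),
      StrictMono Z ∧ (∀ j, Z j < 0) ∧ StrictAnti W ∧ (∀ j, 8 < W j) ∧
        OuterEigenvaluesAreDouble (hamiltonian l m) (Set.range Z ∪ Set.range W) := by
  subst hk hk'
  exact exists_outerEigenvalues l m

theorem range_fin_one {α : Type*} (Z : Fin 1 → α) : Set.range Z = {Z 0} := by
  ext x
  simp [eq_comm]

theorem range_fin_two {α : Type*} (Z : Fin 2 → α) : Set.range Z = {Z 0, Z 1} := by
  ext x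
  simp [Fin.exists_fin_two, eq_comm]

theorem range_fin_three {α : Type*} (Z : Fin 3 → α) : Set.range Z = {Z 0, Z 1, Z 2} := by
  ext x
  simp [Fin.exists_fin_succ, eq_comm]

end LatticeFermion

open LatticeFermion in
theorem mainTheorem1 (l m : ℝ) :
    -- the essential spectrum of the operator is `[0, 8]`
    LatticeFermion.essentialSpectrum (LatticeFermion.hamiltonian l m)
      = Complex.ofReal '' Set.Icc (0 : ℝ) 8 ∧
    -- three below
    ((l, m) ∈ LatticeFermion.regionMinus3 →
      ∃ z₁ z₂ z₃ : ℝ, z₁ < z₂ ∧ z₂ < z₃ ∧ z₃ < 0 ∧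
        LatticeFermion.OuterEigenvaluesAreDouble (LatticeFermion.hamiltonian l m) {z₁, z₂, z₃}) ∧
    -- two below, none above
    ((l, m) ∈ LatticeFermion.regionMinus2 ∩ LatticeFermion.regionPlus0 →
      ∃ z₁ z₂ : ℝ, z₁ < z₂ ∧ z₂ < 0 ∧
        LatticeFermion.OuterEigenvaluesAreDouble (LatticeFermion.hamiltonian l m) {z₁, z₂}) ∧
    -- two below, one above
    ((l, m) ∈ LatticeFermion.regionMinus2 ∩ LatticeFermion.regionPlus1 →
      ∃ z₁ z₂ w : ℝ, z₁ < z₂ ∧ z₂ < 0 ∧ 8 < w ∧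
        LatticeFermion.OuterEigenvaluesAreDouble (LatticeFermion.hamiltonian l m) {z₁, z₂, w}) ∧
    -- one below, one above
    ((l, m) ∈ LatticeFermion.regionMinus1 ∩ LatticeFermion.regionPlus1 →
      ∃ z₁ z₂ : ℝ, z₁ < 0 ∧ 8 < z₂ ∧
        LatticeFermion.OuterEigenvaluesAreDouble (LatticeFermion.hamiltonian l m) {z₁, z₂}) ∧
    -- one below, none above
    ((l, m) ∈ LatticeFermion.regionMinus1 ∩ LatticeFermion.regionPlus0 →
      ∃ z : ℝ, z < 0 ∧
        LatticeFermion.OuterEigenvaluesAreDouble (LatticeFermion.hamiltonian l m) {z}) ∧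
    -- none
    ((l, m) ∈ LatticeFermion.regionMinus0 ∩ LatticeFermion.regionPlus0 →
      LatticeFermion.OuterEigenvaluesAreDouble (LatticeFermion.hamiltonian l m) ∅) ∧
    -- none below, one above
    ((l, m) ∈ LatticeFermion.regionMinus0 ∩ LatticeFermion.regionPlus1 →
      ∃ z : ℝ, 8 < z ∧
        LatticeFermion.OuterEigenvaluesAreDouble (LatticeFermion.hamiltonian l m) {z}) ∧
    -- one below, two above
    ((l, m) ∈ LatticeFermion.regionMinus1 ∩ LatticeFermion.regionPlus2 →
      ∃ w z₁ z₂ : ℝ, w < 0 ∧ 8 < z₂ ∧ z₂ < z₁ ∧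
        LatticeFermion.OuterEigenvaluesAreDouble (LatticeFermion.hamiltonian l m) {w, z₁, z₂}) ∧
    -- none below, two above
    ((l, m) ∈ LatticeFermion.regionMinus0 ∩ LatticeFermion.regionPlus2 →
      ∃ z₁ z₂ : ℝ, 8 < z₂ ∧ z₂ < z₁ ∧
        LatticeFermion.OuterEigenvaluesAreDouble (LatticeFermion.hamiltonian l m) {z₁, z₂}) ∧
    -- three above
    ((l, m) ∈ LatticeFermion.regionPlus3 →
      ∃ z₁ z₂ z₃ : ℝ, 8 < z₃ ∧ z₃ < z₂ ∧ z₂ < z₁ ∧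
        LatticeFermion.OuterEigenvaluesAreDouble (LatticeFermion.hamiltonian l m) {z₁, z₂, z₃}) := by
  have h01 : (0 : Fin 3) < 1 := by decide
  have h12 : (1 : Fin 3) < 2 := by decide
  have h2 : (0 : Fin 2) < 1 := by decide
  refine ⟨essentialSpectrum_hamiltonian l m, ?_, ?_, ?_, ?_, ?_, ?_, ?_, ?_, ?_, ?_⟩
  · intro h
    have e1 := redIndex_of_mem_regionMinus3 h
    -- No region 𝒞ₖ⁺ is assumed here: index three already forces index zero for the opposite
    -- couplings.
    have e2 := redIndex_add_redIndex_neg_le l m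
    obtain ⟨Z, W, hZ, hZ0, hW, hW8, H⟩ :=
      exists_outerEigenvalues_of_index (k' := 0) e1 (by omega)
    rw [range_fin_three, Set.range_eq_empty W, Set.union_empty] at H
    exact ⟨Z 0, Z 1, Z 2, hZ h01, hZ h12, hZ0 2, H⟩
  · rintro ⟨h, h'⟩
    obtain ⟨Z, W, hZ, hZ0, hW, hW8, H⟩ := exists_outerEigenvalues_of_index
      (redIndex_of_mem_regionMinus2 h) (redIndex_of_mem_regionMinus0 (mem_regionPlus0_iff.1 h'))
    rw [range_fin_two, Set.range_eq_empty W, Set.union_empty] at H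
    exact ⟨Z 0, Z 1, hZ h2, hZ0 1, H⟩
  · rintro ⟨h, h'⟩
    obtain ⟨Z, W, hZ, hZ0, hW, hW8, H⟩ := exists_outerEigenvalues_of_index
      (redIndex_of_mem_regionMinus2 h) (redIndex_of_mem_regionMinus1 (mem_regionPlus1_iff.1 h'))
    rw [range_fin_two, range_fin_one, Set.insert_union, Set.singleton_union] at H
    exact ⟨Z 0, Z 1, W 0, hZ h2, hZ0 1, hW8 0, H⟩
  · rintro ⟨h, h'⟩
    obtain ⟨Z, W, hZ, hZ0, hW, hW8, H⟩ := exists_outerEigenvalues_of_index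
      (redIndex_of_mem_regionMinus1 h) (redIndex_of_mem_regionMinus1 (mem_regionPlus1_iff.1 h'))
    rw [range_fin_one, range_fin_one, Set.singleton_union] at H
    exact ⟨Z 0, W 0, hZ0 0, hW8 0, H⟩
  · rintro ⟨h, h'⟩
    obtain ⟨Z, W, hZ, hZ0, hW, hW8, H⟩ := exists_outerEigenvalues_of_index
      (redIndex_of_mem_regionMinus1 h) (redIndex_of_mem_regionMinus0 (mem_regionPlus0_iff.1 h'))
    rw [range_fin_one, Set.range_eq_empty W, Set.union_empty] at H
    exact ⟨Z 0, hZ0 0, H⟩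
  · rintro ⟨h, h'⟩
    obtain ⟨Z, W, hZ, hZ0, hW, hW8, H⟩ := exists_outerEigenvalues_of_index
      (redIndex_of_mem_regionMinus0 h) (redIndex_of_mem_regionMinus0 (mem_regionPlus0_iff.1 h'))
    rwa [Set.range_eq_empty Z, Set.range_eq_empty W, Set.union_empty] at H
  · rintro ⟨h, h'⟩
    obtain ⟨Z, W, hZ, hZ0, hW, hW8, H⟩ := exists_outerEigenvalues_of_index
      (redIndex_of_mem_regionMinus0 h) (redIndex_of_mem_regionMinus1 (mem_regionPlus1_iff.1 h'))
    rw [range_fin_one, Set.range_eq_empty Z, Set.empty_union] at H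
    exact ⟨W 0, hW8 0, H⟩
  · rintro ⟨h, h'⟩
    obtain ⟨Z, W, hZ, hZ0, hW, hW8, H⟩ := exists_outerEigenvalues_of_index
      (redIndex_of_mem_regionMinus1 h) (redIndex_of_mem_regionMinus2 (mem_regionPlus2_iff.1 h'))
    rw [range_fin_two, range_fin_one, Set.singleton_union] at H
    exact ⟨Z 0, W 0, W 1, hZ0 0, hW8 1, hW h2, H⟩
  · rintro ⟨h, h'⟩
    obtain ⟨Z, W, hZ, hZ0, hW, hW8, H⟩ := exists_outerEigenvalues_of_index
      (redIndex_of_mem_regionMinus0 h) (redIndex_of_mem_regionMinus2 (mem_regionPlus2_iff.1 h'))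
    rw [range_fin_two, Set.range_eq_empty Z, Set.empty_union] at H
    exact ⟨W 0, W 1, hW8 1, hW h2, H⟩
  · intro h
    have e1 := redIndex_of_mem_regionMinus3 (mem_regionPlus3_iff.1 h)
    have e2 := redIndex_add_redIndex_neg_le l m
    obtain ⟨Z, W, hZ, hZ0, hW, hW8, H⟩ :=
      exists_outerEigenvalues_of_index (k := 0) (by omega) e1
    rw [range_fin_three, Set.range_eq_empty Z, Set.empty_union] at H
    exact ⟨W 0, W 1, W 2, hW8 2, hW h12, hW h01, H⟩
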